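/- Let $d\ge 3$. Write $(x,y)\in\mathbb{R}\times\mathbb{R}^{d-1}=\mathbb{R}^d$, with dual (angular frequency) variables $(\xi,\eta)$, and let $U(t)$, $t\in\mathbb{R}$, be the unitary group on $L^2(\mathbb{R}^d)$ of the linear Zakharov--Kuznetsov equation $\partial_t u+\partial_x\Delta u=0$, that is, $$\widehat{U(t)u_0}(\xi,\eta)=e^{it\xi(\xi^2+|\eta|^2)}\,\widehat{u_0}(\xi,\eta).$$ Let $2\le q<\infty$ and $2\le r\le\infty$ satisfy $\frac2q+\frac2r\le 1$ (with $\frac{2}{\infty}=0$), and put $$s=d\left(\frac12-\frac1q\right)-\frac3r .$$ (Then $s\ge 0$.) There is a constant $C$, depending only on $d$, $q$, $r$, such that for every $u_0\in H^s(\mathbb{R}^d)$ $$\|U(t)u_0\|_{L^r_{t\in[0,1]}L^q(\mathbb{R}^d)}\le C\,\|u_0\|_{H^s(\mathbb{R}^d)},$$ where $\|u_0\|_{H^s}=\big\|(1+\xi^2+|\eta|^2)^{s/2}\,\widehat{u_0}\big\|_{L^2}$. -/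

import Mathlib

open MeasureTheory FourierTransform TemperedDistribution
open scoped ENNReal NNReal SchwartzMap

noncomputable section

namespace ZK

/-- The space variable `(x, y) ∈ ℝ × ℝ^{d-1}`, written as one vector of `ℝ^d` with the Euclidean
norm; the coordinate of index `0` is `x`. -/
abbrev Space (d : ℕ) : Type := EuclideanSpace ℝ (Fin d)

/-- The complex space `L²(ℝ^d)`. -/
abbrev L2 (d : ℕ) : Type := Lp (α := Space d) ℂ 2 volume

/-- The real symbol of the linear Zakharov--Kuznetsov equation `∂_t u + ∂_x Δ u = 0`: at the
angular frequency `(ξ, η)` it is `ξ (ξ² + |η|²)`. Mathlib's Fourier transform uses the kernel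
`exp (-2 π i ⟨z, ζ⟩)`, so the angular frequency that belongs to the dual variable `ζ` is
`(ξ, η) = 2 π ζ`. -/
def symbol {d : ℕ} [NeZero d] (ζ : Space d) : ℝ :=
  (2 * Real.pi * ζ 0) * (2 * Real.pi * ‖ζ‖) ^ 2

/-- The Fourier multiplier `exp (i t ξ (ξ² + |η|²))`. -/
def phase {d : ℕ} [NeZero d] (t : ℝ) (ζ : Space d) : ℂ :=
  Complex.exp (Complex.I * ((t * symbol ζ : ℝ) : ℂ))

theorem continuous_phase {d : ℕ} [NeZero d] (t : ℝ) : Continuous (phase (d := d) t) := by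
  unfold phase symbol
  fun_prop

theorem norm_phase {d : ℕ} [NeZero d] (t : ℝ) (ζ : Space d) : ‖phase t ζ‖ = 1 := by
  unfold phase
  rw [mul_comm]
  exact Complex.norm_exp_ofReal_mul_I _

theorem memLp_phase_mul {d : ℕ} [NeZero d] (t : ℝ) (g : L2 d) :
    MemLp (fun ζ ↦ phase t ζ * g ζ) 2 (volume : Measure (Space d)) :=
  (Lp.memLp g).of_le ((continuous_phase t).aestronglyMeasurable.mul (Lp.aestronglyMeasurable g))
    (Filter.Eventually.of_forall fun ζ ↦ by simp [norm_phase])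

/-- The unitary group `U(t)` of the linear Zakharov--Kuznetsov equation on `L²(ℝ^d)`:
the Fourier transform of `U(t) u` is `exp (i t ξ (ξ² + |η|²))` times that of `u`. -/
def U {d : ℕ} [NeZero d] (t : ℝ) (u : L2 d) : L2 d :=
  𝓕⁻ ((memLp_phase_mul t (𝓕 u)).toLp (fun ζ ↦ phase t ζ * (𝓕 u : L2 d) ζ))

/-- The norm of `H^s(ℝ^d)`, `‖(1 + |(ξ, η)|²)^{s/2} û‖_{L²}` with `(ξ, η) = 2 π ζ`, for a square
integrable `u`; the value is `∞` where `u` is not in `H^s`. -/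
def sobolevNorm {d : ℕ} (s : ℝ) (u : L2 d) : ℝ≥0∞ :=
  eLpNorm (fun ζ ↦ (((1 + (2 * Real.pi * ‖ζ‖) ^ 2) ^ (s / 2) : ℝ) : ℂ) *
    (𝓕 u : L2 d) ζ) 2 (volume : Measure (Space d))

/-- The mixed norm `‖v‖_{L^r_{t ∈ [0,1]} L^q(ℝ^d)}` of a curve `v` in `L²(ℝ^d)`. -/
def strichartzNorm {d : ℕ} (r q : ℝ≥0∞) (v : ℝ → L2 d) : ℝ≥0∞ :=
  eLpNorm (fun t ↦ eLpNorm (v t) q (volume : Measure (Space d))) r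
    (volume.restrict (Set.Icc (0 : ℝ) 1))

end ZK

end

/-! Put d = n + 1, a = 1/q and b = 1/r. The admissible exponents form the triangle a + b ≤ 1/2 with
a > 0, b ≥ 0, and s = (n+1)(1/2 - a) - 3b.

Dispersion. For fixed first frequency ξ the phase is quadratic in η, so under a Gaussian cut-off
exp(-ε|2πζ|²) the η-integral in the kernel of the flow is an explicit complex Gaussian, of size (ε²
+ (2πtξ)²)^(-n/4) up to a constant (`fourierInv_phase_gaussian`, `norm_partialKernel_le`).
Integrating absolute values in ξ bounds the kernel by a constant times ε^(-((n+1)/2 - 3σ/2))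
|t|^(-σ), for 0 ≤ σ < 1, and for σ = 1 when n ≥ 3. Take σ = b/(1/2 - a). Interpolation with the L²
bound (`lintegral_rpow_le_of_norm_le`) turns this into decay |t|^(-2/r) from L^{q'} to L^q. The T T*
argument (`strichartz_of_dispersive`) and the Hardy--Littlewood--Sobolev inequality
(`lintegral_riesz_le`) then give the estimate for frequencies up to l with loss l^s, on choosing ε =
l^(-2).

Summation. The dyadic pieces are added without a square function (`exists_strichartz_of_localized`).
The squared norm of the sum is at most the double sum of norms of products. In each product Hölder
puts the lower frequency in a space of loss s + κ and the higher one in a space of loss s - κ, which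
gains 2^(-κ|i-k|), and Schur's test finishes. The nearby exponents come from moving a alone inside
the triangle and on the edge b = 0, and from moving along the edge a + b = 1/2 when n ≥ 3. At the
vertex a = 1/2, b = 0 the estimate is conservation of the L² norm.

Endpoint. For n = 2 the edge a + b = 1/2 has s = 0 throughout: σ = 1 makes the ξ-integral diverge
logarithmically, and moving along the edge gains nothing. There the cancellation in ξ is used.
Pairing ξ with -ξ reduces the kernel to ∫ sin(xr + tr³ - c/(tr)) dr/r with c ≥ 0, and after r = e^τ
a van der Corput argument bounds this uniformly (`abs_integral_sin_phase_le`). The decay 1/|t| then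
holds for sharp cut-offs of ξ to bands, and no frequency summation is needed. -/

noncomputable section

namespace ZK

section

/-! ### Multipliers of modulus at most one -/

/-- A measurable function on frequency space with values in the closed unit disc. -/
structure UnitMultiplier (d : ℕ) where
  toFun : Space d → ℂ
  measurable : Measurable toFun
  norm_le_one : ∀ ζ, ‖toFun ζ‖ ≤ 1

namespace UnitMultiplier

variable {d : ℕ}

theorem memLp_mul (m : UnitMultiplier d) (g : L2 d) :
    MemLp (fun ζ ↦ m.toFun ζ * g ζ) 2 (volume : Measure (Space d)) :=
  (Lp.memLp g).of_le (m.measurable.aestronglyMeasurable.mul (Lp.aestronglyMeasurable g))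
    (Filter.Eventually.of_forall fun ζ ↦ by
      rw [norm_mul]
      exact mul_le_of_le_one_left (norm_nonneg _) (m.norm_le_one ζ))

/-- Multiplication by `m` on `L²`. -/
def act (m : UnitMultiplier d) (g : L2 d) : L2 d := (m.memLp_mul g).toLp _

theorem coeFn_act (m : UnitMultiplier d) (g : L2 d) :
    m.act g =ᵐ[volume] fun ζ ↦ m.toFun ζ * g ζ := (m.memLp_mul g).coeFn_toLp

theorem act_add (m : UnitMultiplier d) (f g : L2 d) : m.act (f + g) = m.act f + m.act g := by
  apply Lp.ext
  filter_upwards [m.coeFn_act (f + g), m.coeFn_act f, m.coeFn_act g, Lp.coeFn_add f g,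
    Lp.coeFn_add (m.act f) (m.act g)] with ζ h1 h2 h3 h4 h5
  rw [h1, h5, Pi.add_apply, h2, h3, h4, Pi.add_apply, mul_add]

theorem norm_act_le (m : UnitMultiplier d) (g : L2 d) : ‖m.act g‖ ≤ ‖g‖ := by
  apply Lp.norm_le_norm_of_ae_le
  filter_upwards [m.coeFn_act g] with ζ h
  rw [h, norm_mul]
  exact mul_le_of_le_one_left (norm_nonneg _) (m.norm_le_one ζ)

/-- The pointwise product of two multipliers. -/
def comp (m m' : UnitMultiplier d) : UnitMultiplier d where
  toFun ζ := m.toFun ζ * m'.toFun ζ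
  measurable := m.measurable.mul m'.measurable
  norm_le_one ζ := by
    rw [norm_mul]
    exact mul_le_one₀ (m.norm_le_one ζ) (norm_nonneg _) (m'.norm_le_one ζ)

theorem act_act (m m' : UnitMultiplier d) (g : L2 d) : m.act (m'.act g) = (m.comp m').act g := by
  apply Lp.ext
  filter_upwards [m.coeFn_act (m'.act g), m'.coeFn_act g, (m.comp m').coeFn_act g] with ζ h1 h2 h3
  rw [h1, h2, h3, comp, mul_assoc]

/-- The complex conjugate of a multiplier. -/
def conj (m : UnitMultiplier d) : UnitMultiplier d where
  toFun ζ := starRingEnd ℂ (m.toFun ζ)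
  measurable := Complex.continuous_conj.measurable.comp m.measurable
  norm_le_one ζ := by simpa using m.norm_le_one ζ

theorem inner_act_left (m : UnitMultiplier d) (f g : L2 d) :
    inner ℂ (m.act f) g = inner ℂ f (m.conj.act g) := by
  rw [L2.inner_def, L2.inner_def]
  apply integral_congr_ae
  filter_upwards [m.coeFn_act f, m.conj.coeFn_act g] with ζ h1 h2
  rw [h1, h2]
  simp only [RCLike.inner_apply, conj, map_mul]
  ring

@[ext]
theorem ext {m m' : UnitMultiplier d} (h : ∀ ζ, m.toFun ζ = m'.toFun ζ) : m = m' := by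
  cases m; cases m'; congr; exact funext h

/-- The Fourier multiplier operator with symbol `m`. -/
def op (m : UnitMultiplier d) (f : L2 d) : L2 d := 𝓕⁻ (m.act (𝓕 f))

theorem op_add (m : UnitMultiplier d) (f g : L2 d) : m.op (f + g) = m.op f + m.op g := by
  simp only [op, FourierTransform.fourier_add, act_add, FourierTransform.fourierInv_add]

theorem norm_fourierInv (f : L2 d) : ‖(𝓕⁻ f : L2 d)‖ = ‖f‖ := by
  rw [← Lp.norm_fourier_eq (𝓕⁻ f), fourier_fourierInv_eq]

theorem norm_op_le (m : UnitMultiplier d) (f : L2 d) : ‖m.op f‖ ≤ ‖f‖ := by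
  rw [op, norm_fourierInv]
  exact (m.norm_act_le _).trans_eq (Lp.norm_fourier_eq f)

theorem inner_fourierInv (f g : L2 d) : inner ℂ (𝓕⁻ f : L2 d) g = inner ℂ f (𝓕 g : L2 d) := by
  rw [← Lp.inner_fourier_eq (𝓕⁻ f), fourier_fourierInv_eq]

end UnitMultiplier

/-- The multiplier of the linear Zakharov--Kuznetsov flow. -/
def phaseMultiplier {d : ℕ} [NeZero d] (t : ℝ) : UnitMultiplier d where
  toFun := phase t
  measurable := (continuous_phase t).measurable
  norm_le_one ζ := (norm_phase t ζ).le

theorem U_eq_act {d : ℕ} [NeZero d] (t : ℝ) (u : L2 d) :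
    U t u = 𝓕⁻ ((phaseMultiplier t).act (𝓕 u)) := rfl

theorem phase_add {d : ℕ} [NeZero d] (s t : ℝ) (ζ : Space d) :
    phase (s + t) ζ = phase s ζ * phase t ζ := by
  unfold phase
  rw [← Complex.exp_add]
  congr 1
  push_cast
  ring

theorem conj_phase {d : ℕ} [NeZero d] (t : ℝ) (ζ : Space d) :
    starRingEnd ℂ (phase t ζ) = phase (-t) ζ := by
  unfold phase
  rw [← Complex.exp_conj]
  congr 1
  simp

/-! ### The Fourier transform on `L¹ ∩ L²` -/

theorem integral_fourier_smul_flip {d : ℕ} {f g : Space d → ℂ} (hf : Integrable f)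
    (hg : Integrable g) : ∫ ξ, 𝓕 f ξ * g ξ = ∫ x, f x * 𝓕 g x := by
  have := VectorFourier.integral_fourierIntegral_smul_eq_flip (L := innerₗ (Space d))
    Real.continuous_fourierChar continuous_inner hf hg
  rw [flip_innerₗ] at this
  exact this

theorem continuous_fourier_of_integrable {d : ℕ} {f : Space d → ℂ} (hf : Integrable f) :
    Continuous (𝓕 f) :=
  VectorFourier.fourierIntegral_continuous Real.continuous_fourierChar continuous_inner hf

/-- The L² transform agrees with the transform of tempered distributions, so its pairing with a test
function ψ is the integral of the transform of ψ against g. The multiplication formula moves the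
transform onto g, and test functions separate locally integrable functions. -/
theorem fourier_ae_eq {d : ℕ} (g : L2 d) (hg : Integrable g) :
    (𝓕 g : L2 d) =ᵐ[volume] 𝓕 (g : Space d → ℂ) := by
  apply ae_eq_of_integral_contDiff_smul_eq
  · exact (Lp.memLp _).locallyIntegrable (by norm_num)
  · exact (continuous_fourier_of_integrable hg).locallyIntegrable
  intro φ hφ hφc
  have hφ' : ContDiff ℝ (⊤ : ℕ∞) (fun x ↦ (φ x : ℂ)) := Complex.ofRealCLM.contDiff.comp hφ
  have hφc' : HasCompactSupport (fun x ↦ (φ x : ℂ)) := hφc.comp_left (g := ((↑) : ℝ → ℂ)) (by simp)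
  set ψ := hφc'.toSchwartzMap hφ'
  have h1 := congrArg (fun T : 𝓢'(Space d, ℂ) ↦ T ψ) (Lp.fourier_toTemperedDistribution_eq g)
  simp only [TemperedDistribution.fourier_apply, Lp.toTemperedDistribution_apply] at h1
  have hψ : ∀ x, ψ x = (φ x : ℂ) := fun x ↦ rfl
  simp only [hψ, smul_eq_mul, SchwartzMap.fourier_coe] at h1
  simp only [Complex.real_smul]
  rw [← h1]
  have := integral_fourier_smul_flip (ψ.integrable (μ := volume)) hg
  rw [this]
  rfl

theorem fourierInv_ae_eq {d : ℕ} (g : L2 d) (hg : Integrable g) :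
    (𝓕⁻ g : L2 d) =ᵐ[volume] 𝓕⁻ (g : Space d → ℂ) := by
  apply ae_eq_of_integral_contDiff_smul_eq
  · exact (Lp.memLp _).locallyIntegrable (by norm_num)
  · rw [Real.fourierInv_eq_fourier_comp_neg]
    exact (continuous_fourier_of_integrable hg.comp_neg).locallyIntegrable
  intro φ hφ hφc
  have hφ' : ContDiff ℝ (⊤ : ℕ∞) (fun x ↦ (φ x : ℂ)) := Complex.ofRealCLM.contDiff.comp hφ
  have hφc' : HasCompactSupport (fun x ↦ (φ x : ℂ)) := hφc.comp_left (g := ((↑) : ℝ → ℂ)) (by simp)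
  set ψ := hφc'.toSchwartzMap hφ'
  have h1 := congrArg (fun T : 𝓢'(Space d, ℂ) ↦ T ψ) (Lp.fourierInv_toTemperedDistribution_eq g)
  simp only [TemperedDistribution.fourierInv_apply, Lp.toTemperedDistribution_apply] at h1
  have hψ : ∀ x, ψ x = (φ x : ℂ) := fun x ↦ rfl
  simp only [hψ, smul_eq_mul, SchwartzMap.fourierInv_coe] at h1
  simp only [Complex.real_smul]
  rw [← h1]
  simp_rw [Real.fourierInv_eq_fourier_comp_neg (g : Space d → ℂ)]
  change _ = ∫ x, ψ x * 𝓕 (fun y ↦ g (-y)) x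
  rw [← integral_fourier_smul_flip (ψ.integrable (μ := volume)) hg.comp_neg,
    ← integral_neg_eq_self]
  simp only [neg_neg, Real.fourierInv_eq_fourier_neg]

/-- This is the multiplication formula for `h` and `m` times the character at `x`; the transform of
the latter is the inverse transform of `m`, reflected and translated. -/
theorem fourierInv_mul_fourier {d : ℕ} {m h : Space d → ℂ} (hm : Integrable m)
    (hh : Integrable h) (x : Space d) :
    𝓕⁻ (fun ζ ↦ m ζ * 𝓕 h ζ) x = ∫ y, 𝓕⁻ m (x - y) * h y := by
  have key := integral_fourier_smul_flip hh
    (g := fun ζ ↦ Complex.exp (↑(2 * Real.pi * inner ℝ ζ x) * Complex.I) * m ζ) (by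
      refine hm.bdd_mul (c := 1) (by fun_prop : Continuous _).aestronglyMeasurable ?_
      exact Filter.Eventually.of_forall fun ζ ↦ (Complex.norm_exp_ofReal_mul_I _).le)
  rw [Real.fourierInv_eq']
  simp only [smul_eq_mul]
  calc _ = ∫ ξ, 𝓕 h ξ * (Complex.exp (↑(2 * Real.pi * inner ℝ ξ x) * Complex.I) * m ξ) := by
        congr 1; ext ξ; ring
    _ = _ := key
    _ = _ := by
        congr 1; ext y
        rw [mul_comm, Real.fourier_eq', Real.fourierInv_eq']
        congr 2; ext v
        simp only [smul_eq_mul]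
        rw [← mul_assoc, ← Complex.exp_add, inner_sub_right]
        congr 2
        push_cast
        ring

/-- The operator with integrable symbol `m` is convolution with the inverse transform of `m`. -/
theorem UnitMultiplier.op_ae_eq {d : ℕ} (m : UnitMultiplier d) (hm : Integrable m.toFun)
    (h : L2 d) (hh : Integrable h) :
    m.op h =ᵐ[volume] fun x ↦ ∫ y, 𝓕⁻ m.toFun (x - y) * h y := by
  have h1 : m.act (𝓕 h) =ᵐ[volume] fun ζ ↦ m.toFun ζ * 𝓕 (h : Space d → ℂ) ζ := by
    filter_upwards [m.coeFn_act (𝓕 h), fourier_ae_eq h hh] with ζ h1 h2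
    rw [h1, h2]
  have h2 : Integrable (fun ζ ↦ m.toFun ζ * 𝓕 (h : Space d → ℂ) ζ) := by
    refine hm.mul_bdd (c := ∫ y, ‖h y‖)
      (continuous_fourier_of_integrable hh).aestronglyMeasurable
      (Filter.Eventually.of_forall fun ζ ↦ ?_)
    exact VectorFourier.norm_fourierIntegral_le_integral_norm _ _ _ _ _
  filter_upwards [fourierInv_ae_eq _ (h2.congr h1.symm)] with x hx
  rw [op, hx, Real.fourierInv_congr_ae h1, fourierInv_mul_fourier hm hh]

theorem UnitMultiplier.norm_op_le_of_kernel {d : ℕ} (m : UnitMultiplier d)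
    (hm : Integrable m.toFun) {M : ℝ} (hM : ∀ x, ‖𝓕⁻ m.toFun x‖ ≤ M) (h : L2 d)
    (hh : Integrable h) : ∀ᵐ x, ‖m.op h x‖ ≤ M * ∫ y, ‖h y‖ := by
  filter_upwards [m.op_ae_eq hm h hh] with x hx
  rw [hx, ← integral_const_mul]
  refine norm_integral_le_of_norm_le (hh.norm.const_mul M) (Filter.Eventually.of_forall fun y ↦ ?_)
  rw [norm_mul]
  exact mul_le_mul_of_nonneg_right (hM _) (norm_nonneg _)

end

section

/-! ### Interpolation between `L² → L²` and `L¹ → L^∞` -/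

section Interpolation

variable {α : Type*} [MeasurableSpace α] {μ : Measure α}

theorem integral_norm_indicator_le {f : α → ℂ} (hf : StronglyMeasurable f) {p A : ℝ} (hp : 1 < p)
    (hA : 0 < A) (hint : Integrable (fun x ↦ ‖f x‖ ^ p) μ) :
    Integrable ({x | A < ‖f x‖}.indicator f) μ ∧
      ∫ x, ‖{x | A < ‖f x‖}.indicator f x‖ ∂μ ≤ A ^ (1 - p) * ∫ x, ‖f x‖ ^ p ∂μ := by
  have hset : MeasurableSet {x | A < ‖f x‖} := measurableSet_lt measurable_const hf.norm.measurable
  have hpt : ∀ x, ‖{x | A < ‖f x‖}.indicator f x‖ ≤ A ^ (1 - p) * ‖f x‖ ^ p := by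
    intro x
    by_cases hx : A < ‖f x‖
    · rw [Set.indicator_of_mem (by exact hx)]
      have hpos : 0 < ‖f x‖ := hA.trans hx
      have h1 : ‖f x‖ = ‖f x‖ ^ (1 - p) * ‖f x‖ ^ p := by
        rw [← Real.rpow_add hpos]; simp
      calc ‖f x‖ = ‖f x‖ ^ (1 - p) * ‖f x‖ ^ p := h1
        _ ≤ _ := by
          gcongr ?_ * _
          exact Real.rpow_le_rpow_of_nonpos hA hx.le (by linarith)
    · rw [Set.indicator_of_notMem (by exact hx), norm_zero]
      positivity
  have h2 := hint.const_mul (A ^ (1 - p))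
  have h3 := h2.mono' (hf.indicator hset).aestronglyMeasurable (Filter.Eventually.of_forall hpt)
  refine ⟨h3, ?_⟩
  rw [← integral_const_mul]
  exact integral_mono h3.norm h2 hpt

/-- The level sets of the image of a function split at height `A`. -/
theorem meas_lt_le_lintegral_of_split (T : Lp ℂ 2 μ → Lp ℂ 2 μ)
    (hadd : ∀ f g, T (f + g) = T f + T g) (h2 : ∀ f, ‖T f‖ ≤ ‖f‖) {M : ℝ}
    (h1 : ∀ h : Lp ℂ 2 μ, Integrable h μ → ∀ᵐ x ∂μ, ‖T h x‖ ≤ M * ∫ y, ‖h y‖ ∂μ) (hM : 0 ≤ M)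
    {p : ℝ} (hp : 1 < p) (f : Lp ℂ 2 μ) (hint : Integrable (fun x ↦ ‖f x‖ ^ p) μ)
    {A l : ℝ} (hA : 0 < A) (hl : 0 < l) (hAl : M * (A ^ (1 - p) * ∫ x, ‖f x‖ ^ p ∂μ) ≤ l / 2) :
    μ {x | l < ‖T f x‖} ≤
      ENNReal.ofReal (4 / l ^ 2) * ∫⁻ x, {x | ‖f x‖ ≤ A}.indicator
        (fun x ↦ ENNReal.ofReal (‖f x‖ ^ 2)) x ∂μ := by
  have hf := Lp.stronglyMeasurable f
  have hset : MeasurableSet {x | A < ‖f x‖} := measurableSet_lt measurable_const hf.norm.measurable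
  obtain ⟨hi, hile⟩ := integral_norm_indicator_le hf hp hA hint
  have m1 : MemLp ({x | A < ‖f x‖}.indicator f) 2 μ := (Lp.memLp f).indicator hset
  have m2 : MemLp ({x | A < ‖f x‖}ᶜ.indicator f) 2 μ := (Lp.memLp f).indicator hset.compl
  have hsum : f = m1.toLp _ + m2.toLp _ := by
    apply Lp.ext
    filter_upwards [Lp.coeFn_add (m1.toLp _) (m2.toLp _), m1.coeFn_toLp, m2.coeFn_toLp]
      with x hx e1 e2
    rw [hx, Pi.add_apply, e1, e2, ← Pi.add_apply, Set.indicator_self_add_compl]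
  -- The part of `f` above height `A` contributes at most l/2 pointwise, by the L¹ to L^∞ bound. So
  -- the part below `A` must supply the other half, and Chebyshev in L² controls it.
  have hT : ∀ᵐ x ∂μ, ‖T f x‖ ≤ l / 2 + ‖T (m2.toLp _) x‖ := by
    filter_upwards [h1 (m1.toLp _) (hi.congr m1.coeFn_toLp.symm),
      Lp.coeFn_add (T (m1.toLp _)) (T (m2.toLp _))] with x hx hadd'
    conv_lhs => rw [hsum, hadd, hadd', Pi.add_apply]
    refine (norm_add_le _ _).trans (add_le_add_left ?_ _)
    refine hx.trans (le_trans ?_ hAl)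
    refine mul_le_mul_of_nonneg_left ?_ hM
    refine (integral_congr_ae ?_).trans_le hile
    filter_upwards [m1.coeFn_toLp] with y hy
    rw [hy]
  have hmono : μ {x | l < ‖T f x‖} ≤ μ {x | ENNReal.ofReal (l / 2) ≤ ‖T (m2.toLp _) x‖ₑ} := by
    apply measure_mono_ae
    filter_upwards [hT] with x hx hlt
    have hlt : l < ‖T f x‖ := hlt
    change ENNReal.ofReal (l / 2) ≤ ‖T (m2.toLp _) x‖ₑ
    rw [← ofReal_norm]
    exact ENNReal.ofReal_le_ofReal (by linarith)
  have hcheb := mul_meas_ge_le_pow_eLpNorm' μ two_ne_zero ENNReal.ofNat_ne_top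
    (Lp.aestronglyMeasurable (T (m2.toLp _))) (ENNReal.ofReal (l / 2))
  rw [← Lp.enorm_def] at hcheb
  have hnorm : ‖T (m2.toLp _)‖ₑ ^ (2 : ℝ≥0∞).toReal ≤ ∫⁻ x, {x | ‖f x‖ ≤ A}.indicator
        (fun x ↦ ENNReal.ofReal (‖f x‖ ^ 2)) x ∂μ := by
    have : ‖T (m2.toLp _)‖ₑ ≤ ‖m2.toLp _‖ₑ := by
      rw [← ofReal_norm, ← ofReal_norm]; exact ENNReal.ofReal_le_ofReal (h2 _)
    refine (ENNReal.rpow_le_rpow this (by simp)).trans ?_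
    rw [Lp.enorm_def, eLpNorm_congr_ae m2.coeFn_toLp,
      eLpNorm_eq_lintegral_rpow_enorm_toReal two_ne_zero ENNReal.ofNat_ne_top, ← ENNReal.rpow_mul]
    simp only [ENNReal.toReal_ofNat, one_div, ne_eq, OfNat.ofNat_ne_zero, not_false_eq_true,
      inv_mul_cancel₀, ENNReal.rpow_one]
    refine lintegral_mono fun x ↦ ?_
    by_cases hx : ‖f x‖ ≤ A
    · rw [Set.indicator_of_mem (by simpa using hx), Set.indicator_of_mem (by exact hx),
        ← ofReal_norm, ENNReal.ofReal_rpow_of_nonneg (norm_nonneg _) (by norm_num)]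
      norm_num
    · rw [Set.indicator_of_notMem (by simpa using hx)]
      simp
  have hc : ENNReal.ofReal (4 / l ^ 2) * ENNReal.ofReal (l / 2) ^ (2 : ℝ≥0∞).toReal = 1 := by
    rw [ENNReal.ofReal_rpow_of_nonneg (by positivity) (by simp), ← ENNReal.ofReal_mul (by positivity)]
    simp only [ENNReal.toReal_ofNat, Real.rpow_ofNat, ENNReal.ofReal_eq_one]
    field_simp
    norm_num
  calc μ {x | l < ‖T f x‖} ≤ _ := hmono
    _ = ENNReal.ofReal (4 / l ^ 2) * (ENNReal.ofReal (l / 2) ^ (2 : ℝ≥0∞).toReal *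
        μ {x | ENNReal.ofReal (l / 2) ≤ ‖T (m2.toLp _) x‖ₑ}) := by rw [← mul_assoc, hc, one_mul]
    _ ≤ _ := by gcongr; exact hcheb.trans hnorm

/-- The condition on `l` says l ≤ c y^(-1/(q-1)), so this is an explicit power integral; it
converges at 0 because q - 3 > -1. It is the inner integral left by Tonelli in the layer-cake
argument below. -/
theorem lintegral_level_le {q c y : ℝ} (hq : 2 < q) (hc : 0 < c) (hy : 0 ≤ y) :
    ∫⁻ l in Set.Ioi (0 : ℝ), (if y ≤ (c / l) ^ (q - 1) then
      ENNReal.ofReal (4 * l ^ (q - 3) * y ^ 2) else 0) ≤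
    ENNReal.ofReal (4 / (q - 2) * c ^ (q - 2) * y ^ (q / (q - 1))) := by
  rcases hy.eq_or_lt with rfl | hy
  · simp
  have hq1 : 0 < q - 1 := by linarith
  set L := c * y ^ (-(1 / (q - 1))) with hL
  have hL0 : 0 < L := by positivity
  have hle : ∀ l ∈ Set.Ioi (0 : ℝ), (if y ≤ (c / l) ^ (q - 1) then
      ENNReal.ofReal (4 * l ^ (q - 3) * y ^ 2) else 0) ≤
      (Set.Ioc 0 L).indicator (fun l ↦ ENNReal.ofReal (4 * l ^ (q - 3) * y ^ 2)) l := by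
    intro l hl
    have hl : 0 < l := hl
    split_ifs with h
    · rw [Set.indicator_of_mem]
      refine ⟨hl, ?_⟩
      have h1 := Real.rpow_le_rpow hy.le h (by positivity : 0 ≤ 1 / (q - 1))
      rw [← Real.rpow_mul (by positivity), mul_one_div_cancel hq1.ne', Real.rpow_one,
        le_div_iff₀ hl] at h1
      rw [hL, Real.rpow_neg hy.le, ← div_eq_mul_inv, le_div_iff₀ (by positivity)]
      linarith
    · exact zero_le
  calc _ ≤ ∫⁻ l in Set.Ioi (0 : ℝ), (Set.Ioc 0 L).indicator
        (fun l ↦ ENNReal.ofReal (4 * l ^ (q - 3) * y ^ 2)) l :=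
        setLIntegral_mono' measurableSet_Ioi hle
    _ ≤ ∫⁻ l, (Set.Ioc 0 L).indicator
        (fun l ↦ ENNReal.ofReal (4 * l ^ (q - 3) * y ^ 2)) l := setLIntegral_le_lintegral _ _
    _ = ∫⁻ l in Set.Ioc 0 L, ENNReal.ofReal (4 * l ^ (q - 3) * y ^ 2) :=
        lintegral_indicator measurableSet_Ioc _
    _ = ENNReal.ofReal (∫ l in Set.Ioc 0 L, 4 * l ^ (q - 3) * y ^ 2) := by
        rw [ofReal_integral_eq_lintegral_ofReal]
        · change IntegrableOn _ _ _
          rw [← intervalIntegrable_iff_integrableOn_Ioc_of_le hL0.le]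
          exact ((intervalIntegral.intervalIntegrable_rpow' (by linarith)).const_mul _).mul_const _
        · filter_upwards [ae_restrict_mem measurableSet_Ioc] with l hl
          have := hl.1
          positivity
    _ = _ := by
        congr 1
        rw [← intervalIntegral.integral_of_le hL0.le, intervalIntegral.integral_mul_const,
          intervalIntegral.integral_const_mul, integral_rpow (Or.inl (by linarith)),
          Real.zero_rpow (by linarith), hL, Real.mul_rpow hc.le (by positivity),
          ← Real.rpow_mul hy.le]
        have e1 : q - 3 + 1 = q - 2 := by ring
        have e2 : y ^ (q / (q - 1)) = y ^ (-(1 / (q - 1)) * (q - 2)) * y ^ 2 := by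
          rw [← Real.rpow_natCast y 2, ← Real.rpow_add hy]
          congr 1
          push_cast
          field_simp
          ring
        rw [e1, e2]
        ring

/-- An additive contraction of `L²` that maps `L¹` to `L^∞` with norm `M` maps `L^{q'}` to `L^q`
with norm at most a constant times `M ^ (1 - 2 / q)`, for `2 < q < ∞`. -/
theorem lintegral_rpow_le_of_norm_le [SigmaFinite μ] (T : Lp ℂ 2 μ → Lp ℂ 2 μ)
    (hadd : ∀ f g, T (f + g) = T f + T g) (h2 : ∀ f, ‖T f‖ ≤ ‖f‖) {M : ℝ} (hM : 0 < M)
    (h1 : ∀ h : Lp ℂ 2 μ, Integrable h μ → ∀ᵐ x ∂μ, ‖T h x‖ ≤ M * ∫ y, ‖h y‖ ∂μ)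
    {q : ℝ} (hq : 2 < q) (f : Lp ℂ 2 μ) :
    ∫⁻ x, ENNReal.ofReal (‖T f x‖ ^ q) ∂μ ≤
      ENNReal.ofReal (4 * q / (q - 2) * 2 ^ (q - 2) * M ^ (q - 2)) *
        (∫⁻ x, ENNReal.ofReal (‖f x‖ ^ (q / (q - 1))) ∂μ) ^ (q - 1) := by
  have hq1 : 0 < q - 1 := by linarith
  have hq2 : 0 < q - 2 := by linarith
  set p := q / (q - 1) with hp
  have hp1 : 1 < p := by rw [hp, lt_div_iff₀ hq1]; linarith
  have hf := Lp.stronglyMeasurable f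
  have hfp : Measurable (fun x ↦ ‖f x‖ ^ p) := hf.norm.measurable.pow_const p
  rcases eq_or_ne (∫⁻ x, ENNReal.ofReal (‖f x‖ ^ p) ∂μ) ∞ with htop | htop
  · rw [htop, ENNReal.top_rpow_of_pos hq1, ENNReal.mul_top]
    · exact le_top
    · exact (ENNReal.ofReal_pos.2 (by positivity)).ne'
  have hint : Integrable (fun x ↦ ‖f x‖ ^ p) μ := by
    refine ⟨hfp.aestronglyMeasurable, ?_⟩
    rw [hasFiniteIntegral_iff_ofReal (Filter.Eventually.of_forall fun x ↦ by positivity)]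
    exact htop.lt_top
  set Y := ∫ x, ‖f x‖ ^ p ∂μ with hY
  have hYe : ∫⁻ x, ENNReal.ofReal (‖f x‖ ^ p) ∂μ = ENNReal.ofReal Y :=
    (ofReal_integral_eq_lintegral_ofReal hint
      (Filter.Eventually.of_forall fun x ↦ by positivity)).symm
  have hY0 : 0 ≤ Y := integral_nonneg fun x ↦ by positivity
  rcases hY0.eq_or_lt with hYz | hYpos
  · have hz : f = 0 := by
      apply Lp.ext
      have := (integral_eq_zero_iff_of_nonneg (fun x ↦ by positivity) hint).1 hYz.symm
      filter_upwards [this, Lp.coeFn_zero ℂ 2 μ] with x hx h0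
      rw [h0, Pi.zero_apply]
      have := (Real.rpow_eq_zero (norm_nonneg _) (by linarith)).1 hx
      simpa using this
    have hTz : T f = 0 := by
      have := h2 f
      rw [hz, norm_zero] at this
      rw [hz]
      exact norm_le_zero_iff.1 this
    have : ∫⁻ x, ENNReal.ofReal (‖T f x‖ ^ q) ∂μ = 0 := by
      rw [hTz, lintegral_eq_zero_iff' (by
        exact ((Lp.stronglyMeasurable _).norm.measurable.pow_const q).ennreal_ofReal.aemeasurable)]
      filter_upwards [Lp.coeFn_zero ℂ 2 μ] with x h0
      rw [h0, Pi.zero_apply, norm_zero, Real.zero_rpow (by linarith), ENNReal.ofReal_zero,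
        Pi.zero_apply]
    rw [this]
    exact zero_le
  -- At level `l` the function is split at height (c/l)^(q-1). Since (q-1)(1-p) = -1, the L¹ norm of
  -- the upper part is at most (l/c)Y, and this `c` makes M times it equal to l/2.
  set c := 2 * M * Y with hc
  have hc0 : 0 < c := by positivity
  rw [lintegral_rpow_eq_lintegral_meas_lt_mul μ (Filter.Eventually.of_forall fun x ↦ norm_nonneg _)
    (Lp.stronglyMeasurable (T f)).norm.measurable.aemeasurable (by linarith)]
  have hlev : ∀ l ∈ Set.Ioi (0 : ℝ), μ {x | l < ‖T f x‖} * ENNReal.ofReal (l ^ (q - 1)) ≤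
      ∫⁻ x, (if ‖f x‖ ≤ (c / l) ^ (q - 1) then
        ENNReal.ofReal (4 * l ^ (q - 3) * ‖f x‖ ^ 2) else 0) ∂μ := by
    intro l hl
    have hl : 0 < l := hl
    have hA : 0 < (c / l) ^ (q - 1) := by positivity
    have hAp : ((c / l) ^ (q - 1)) ^ (1 - p) = l / c := by
      rw [← Real.rpow_mul (by positivity)]
      have : (q - 1) * (1 - p) = -1 := by rw [hp]; field_simp; ring
      rw [this, Real.rpow_neg_one, inv_div]
    have := meas_lt_le_lintegral_of_split T hadd h2 h1 hM.le hp1 f hint hA hl (by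
      rw [hAp, ← hY, hc]
      apply le_of_eq
      field_simp)
    refine (mul_le_mul_left this _).trans (le_of_eq ?_)
    rw [mul_right_comm, ← ENNReal.ofReal_mul (by positivity), ← lintegral_const_mul]
    · refine lintegral_congr fun x ↦ ?_
      by_cases hx : ‖f x‖ ≤ (c / l) ^ (q - 1)
      · rw [Set.indicator_of_mem (by exact hx), if_pos hx, ← ENNReal.ofReal_mul (by positivity)]
        congr 2
        rw [show q - 1 = q - 3 + (2 : ℕ) by push_cast; ring, Real.rpow_add_natCast hl.ne']
        field_simp
      · rw [Set.indicator_of_notMem (by exact hx), if_neg hx, mul_zero]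
    · exact (hf.norm.measurable.pow_const 2).ennreal_ofReal.indicator
        (measurableSet_le hf.norm.measurable measurable_const)
  calc _ ≤ ENNReal.ofReal q * ∫⁻ l in Set.Ioi (0 : ℝ), ∫⁻ x : α,
        (if ‖f x‖ ≤ (c / l) ^ (q - 1) then
          ENNReal.ofReal (4 * l ^ (q - 3) * ‖f x‖ ^ 2) else 0) ∂μ := by
        gcongr ENNReal.ofReal q * ?_
        exact setLIntegral_mono' measurableSet_Ioi hlev
    _ = ENNReal.ofReal q * ∫⁻ x, (∫⁻ l in Set.Ioi (0 : ℝ),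
        if ‖f x‖ ≤ (c / l) ^ (q - 1) then
          ENNReal.ofReal (4 * l ^ (q - 3) * ‖f x‖ ^ 2) else 0) ∂μ := by
        rw [lintegral_lintegral_swap]
        apply Measurable.aemeasurable
        have hm : Measurable fun z : ℝ × α ↦ ‖f z.2‖ := hf.norm.measurable.comp measurable_snd
        refine Measurable.ite (measurableSet_le hm (by fun_prop)) ?_ measurable_const
        exact (((measurable_fst.pow_const (q - 3)).const_mul 4).mul (hm.pow_const 2)).ennreal_ofReal
    _ ≤ ENNReal.ofReal q * ∫⁻ x, ENNReal.ofReal (4 / (q - 2) * c ^ (q - 2) * ‖f x‖ ^ p) ∂μ := by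
        gcongr ENNReal.ofReal q * ?_
        exact lintegral_mono fun x ↦ lintegral_level_le hq hc0 (norm_nonneg _)
    _ = _ := by
        simp_rw [ENNReal.ofReal_mul (show 0 ≤ 4 / (q - 2) * c ^ (q - 2) by positivity)]
        rw [lintegral_const_mul _ hfp.ennreal_ofReal, hYe, ENNReal.ofReal_rpow_of_pos hYpos,
          ← ENNReal.ofReal_mul (by positivity), ← ENNReal.ofReal_mul (by positivity),
          ← ENNReal.ofReal_mul (by positivity)]
        congr 1
        rw [show q - 1 = q - 2 + 1 by ring, Real.rpow_add_one hYpos.ne', hc,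
          Real.mul_rpow (by positivity) hY0, Real.mul_rpow (by positivity) hM.le]
        ring

end Interpolation

end

section

/-! ### The one-dimensional Hardy--Littlewood--Sobolev inequality on the diagonal -/

theorem lintegral_comp_abs_eq (f : ℝ → ℝ≥0∞) :
    ∫⁻ x, f |x| = 2 * ∫⁻ x in Set.Ioi 0, f x := by
  rw [← lintegral_add_compl (fun x ↦ f |x|) (measurableSet_Ioi (a := (0 : ℝ))), Set.compl_Ioi,
    ← Measure.restrict_congr_set (Iio_ae_eq_Iic (a := (0 : ℝ))), two_mul]
  have h1 : ∫⁻ x in Set.Ioi (0 : ℝ), f |x| = ∫⁻ x in Set.Ioi 0, f x :=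
    setLIntegral_congr_fun measurableSet_Ioi fun x hx ↦ by
      rw [abs_of_pos (by exact hx)]
  have h2 : ∫⁻ x in Set.Iio (0 : ℝ), f |x| = ∫⁻ x in Set.Ioi 0, f x := by
    rw [← lintegral_indicator measurableSet_Iio, ← lintegral_indicator measurableSet_Ioi,
      ← lintegral_neg_eq_self]
    congr 1
    ext x
    by_cases hx : 0 < x
    · rw [Set.indicator_of_mem (by simpa using hx), Set.indicator_of_mem (by exact hx), abs_neg,
        abs_of_pos hx]
    · rw [Set.indicator_of_notMem (by simpa using hx), Set.indicator_of_notMem (by exact hx)]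
  rw [h1, h2]

theorem lintegral_abs_rpow_le {γ R : ℝ} (hγ : γ < 1) (hR : 0 < R) :
    ∫⁻ x : ℝ, (if |x| ≤ R then ENNReal.ofReal (|x| ^ (-γ)) else 0) =
      ENNReal.ofReal (2 / (1 - γ) * R ^ (1 - γ)) := by
  rw [lintegral_comp_abs_eq (fun x ↦ if x ≤ R then ENNReal.ofReal (x ^ (-γ)) else 0)]
  have : ∫⁻ x in Set.Ioi (0 : ℝ), (if x ≤ R then ENNReal.ofReal (x ^ (-γ)) else 0) =
      ∫⁻ x in Set.Ioc 0 R, ENNReal.ofReal (x ^ (-γ)) := by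
    rw [← lintegral_indicator measurableSet_Ioi, ← lintegral_indicator measurableSet_Ioc]
    congr 1
    ext x
    by_cases h0 : 0 < x <;> by_cases h1 : x ≤ R <;> simp [Set.indicator, h0, h1]
  rw [this, ← ofReal_integral_eq_lintegral_ofReal, ← intervalIntegral.integral_of_le hR.le,
    integral_rpow (Or.inl (by linarith)), Real.zero_rpow (by linarith),
    ← ENNReal.ofReal_ofNat 2, ← ENNReal.ofReal_mul (by norm_num)]
  · congr 1
    rw [sub_zero, neg_add_eq_sub]
    ring
  · change IntegrableOn _ _ _
    rw [← intervalIntegrable_iff_integrableOn_Ioc_of_le hR.le]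
    exact intervalIntegral.intervalIntegrable_rpow' (by linarith)
  · filter_upwards [ae_restrict_mem measurableSet_Ioc] with l hl
    have := hl.1
    positivity

theorem lintegral_abs_rpow_gt {R : ℝ} (hR : 0 < R) :
    ∫⁻ x : ℝ, (if R < |x| then ENNReal.ofReal (|x| ^ (-2 : ℝ)) else 0) =
      ENNReal.ofReal (2 / R) := by
  rw [lintegral_comp_abs_eq (fun x ↦ if R < x then ENNReal.ofReal (x ^ (-2 : ℝ)) else 0)]
  have : ∫⁻ x in Set.Ioi (0 : ℝ), (if R < x then ENNReal.ofReal (x ^ (-2 : ℝ)) else 0) =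
      ∫⁻ x in Set.Ioi R, ENNReal.ofReal (x ^ (-2 : ℝ)) := by
    rw [← lintegral_indicator measurableSet_Ioi, ← lintegral_indicator measurableSet_Ioi]
    congr 1
    ext x
    by_cases h1 : R < x
    · simp [Set.indicator, h1, hR.trans h1]
    · simp [Set.indicator, h1]
  rw [this, ← ofReal_integral_eq_lintegral_ofReal, integral_Ioi_rpow_of_lt (by norm_num) hR,
    ← ENNReal.ofReal_ofNat 2, ← ENNReal.ofReal_mul (by norm_num)]
  · congr 1
    norm_num
    rw [Real.rpow_neg_one]
    ring
  · exact integrableOn_Ioi_rpow_of_lt (by norm_num) hR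
  · filter_upwards [ae_restrict_mem measurableSet_Ioi] with l hl
    have : 0 < l := hR.trans hl
    positivity

variable {r : ℝ} {a : ℝ → ℝ} {X : ℝ}

/-- Near `t` the bound a ≤ α is used against the locally integrable kernel. Far from `t` Hölder is
used: the r-th power of the kernel is |x|^(-2), integrable at infinity, and `a` lies in the dual
space. -/
theorem lintegral_riesz_sublevel_le (hr : 2 < r) (ha : Measurable a) (ha0 : ∀ t, 0 ≤ a t)
    (hX : 0 < X) (haX : ∫⁻ s, ENNReal.ofReal (a s ^ (r / (r - 1))) = ENNReal.ofReal X)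
    (t : ℝ) {α : ℝ} (hα : 0 < α) :
    ∫⁻ s, (if a s ≤ α then ENNReal.ofReal (|t - s| ^ (-(2 / r)) * a s) else 0) ≤
      ENNReal.ofReal ((2 / (1 - 2 / r) + 2 ^ (1 / r)) * α ^ (1 / (r - 1)) * X ^ (1 - 2 / r)) := by
  have hr0 : 0 < r := by linarith
  have hr1 : 0 < r - 1 := by linarith
  have hγ : 2 / r < 1 := by rw [div_lt_one hr0]; exact hr
  have hγ' : 0 < 1 - 2 / r := by linarith
  set p := r / (r - 1) with hp
  -- This radius balances the near and the far part: both become multiples of α^(1/(r-1)) X^(1-2/r).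
  set R := X / α ^ p with hR
  have hR0 : 0 < R := by positivity
  set k1 : ℝ → ℝ≥0∞ := fun x ↦ if |x| ≤ R then ENNReal.ofReal (|x| ^ (-(2 / r))) else 0 with hk1
  set k2 : ℝ → ℝ≥0∞ := fun x ↦ if R < |x| then ENNReal.ofReal (|x| ^ (-(2 / r))) else 0 with hk2
  have hk1m : Measurable k1 := Measurable.ite (measurableSet_le (by fun_prop) measurable_const)
    (by fun_prop) measurable_const
  have hk2m : Measurable k2 := Measurable.ite (measurableSet_lt measurable_const (by fun_prop))
    (by fun_prop) measurable_const
  have hpt : ∀ s, (if a s ≤ α then ENNReal.ofReal (|t - s| ^ (-(2 / r)) * a s) else 0) ≤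
      k1 (t - s) * ENNReal.ofReal α + ((fun s ↦ k2 (t - s)) * fun s ↦ ENNReal.ofReal (a s)) s := by
    intro s
    split_ifs with h
    · rw [ENNReal.ofReal_mul (by positivity)]
      simp only [hk1, hk2, Pi.mul_apply]
      by_cases hs : |t - s| ≤ R
      · rw [if_pos hs, if_neg (not_lt.2 hs), zero_mul, add_zero]
        gcongr
      · rw [if_neg hs, if_pos (not_le.1 hs), zero_mul, zero_add]
    · exact zero_le
  have hconj : r.HolderConjugate p := by
    rw [Real.holderConjugate_iff]
    refine ⟨by linarith, ?_⟩
    rw [hp]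
    field_simp
    ring
  refine (lintegral_mono hpt).trans ?_
  rw [lintegral_add_left (by fun_prop), lintegral_mul_const _ (by fun_prop),
    lintegral_sub_left_eq_self k1 t, lintegral_abs_rpow_le hγ hR0]
  refine (add_le_add_right (ENNReal.lintegral_mul_le_Lp_mul_Lq volume hconj
    (by fun_prop) (by fun_prop)) _).trans ?_
  rw [lintegral_sub_left_eq_self (fun x ↦ k2 x ^ r) t]
  have e1 : ∫⁻ x, k2 x ^ r = ENNReal.ofReal (2 / R) := by
    rw [← lintegral_abs_rpow_gt hR0]
    refine lintegral_congr fun x ↦ ?_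
    simp only [hk2]
    split_ifs with h
    · have hx := hR0.trans h
      rw [ENNReal.ofReal_rpow_of_pos (by positivity), ← Real.rpow_mul hx.le]
      congr 2
      field_simp
    · exact ENNReal.zero_rpow_of_pos hr0
  have e2 : ∫⁻ s, ENNReal.ofReal (a s) ^ p = ENNReal.ofReal X := by
    rw [← haX]
    refine lintegral_congr fun s ↦ ?_
    rw [ENNReal.ofReal_rpow_of_nonneg (ha0 s) (by positivity)]
  rw [e1, e2, ENNReal.ofReal_rpow_of_pos (by positivity), ENNReal.ofReal_rpow_of_pos hX,
    ← ENNReal.ofReal_mul (by positivity), ← ENNReal.ofReal_mul (by positivity),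
    ← ENNReal.ofReal_add (by positivity) (by positivity)]
  apply le_of_eq
  congr 1
  have f1 : R ^ (1 - 2 / r) * α = α ^ (1 / (r - 1)) * X ^ (1 - 2 / r) := by
    rw [hR, Real.div_rpow hX.le (by positivity), ← Real.rpow_mul hα.le]
    have : α = α ^ (1 / (r - 1)) * α ^ (p * (1 - 2 / r)) := by
      rw [← Real.rpow_add hα]
      nth_rw 1 [← Real.rpow_one α]
      congr 1
      rw [hp]
      field_simp
      ring
    nth_rw 2 [this]
    field_simp
  have f2 : (2 / R) ^ (1 / r) * X ^ (1 / p) =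
      2 ^ (1 / r) * (α ^ (1 / (r - 1)) * X ^ (1 - 2 / r)) := by
    rw [hR, div_div_eq_mul_div, mul_div_assoc, Real.mul_rpow (by norm_num) (by positivity),
      Real.div_rpow (by positivity) hX.le, ← Real.rpow_mul hα.le]
    have g1 : p * (1 / r) = 1 / (r - 1) := by rw [hp]; field_simp
    have g2 : X ^ (1 / p) = X ^ (1 - 2 / r) * X ^ (1 / r) := by
      rw [← Real.rpow_add hX]
      congr 1
      rw [hp]
      field_simp
      ring
    rw [g1, g2]
    field_simp
  rw [f2, mul_assoc, f1]
  ring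

/-- By symmetry only the pairs with a(s) ≤ a(t) matter. For these the sublevel bound at α = a(t),
multiplied by a(t), is a multiple of a(t)^{r'}, whose integral is X. Neither a maximal function nor
real interpolation is needed on the diagonal. -/
theorem lintegral_riesz_le (hr : 2 < r) (ha : Measurable a) (ha0 : ∀ t, 0 ≤ a t)
    (hX : 0 < X) (haX : ∫⁻ s, ENNReal.ofReal (a s ^ (r / (r - 1))) = ENNReal.ofReal X) :
    ∫⁻ t, ∫⁻ s, ENNReal.ofReal (|t - s| ^ (-(2 / r)) * a s * a t) ≤
      ENNReal.ofReal (2 * (2 / (1 - 2 / r) + 2 ^ (1 / r)) * X ^ (2 - 2 / r)) := by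
  have hr0 : 0 < r := by linarith
  have hr1 : 0 < r - 1 := by linarith
  have hγ : 2 / r < 1 := by rw [div_lt_one hr0]; exact hr
  have hγ' : 0 < 1 - 2 / r := by linarith
  set C := 2 / (1 - 2 / r) + 2 ^ (1 / r) with hC
  have hC0 : 0 < C := by positivity
  set k : ℝ → ℝ → ℝ≥0∞ := fun t s ↦
    if a s ≤ a t then ENNReal.ofReal (|t - s| ^ (-(2 / r)) * a s * a t) else 0 with hk
  have hkm : Measurable (Function.uncurry k) := by
    refine Measurable.ite (measurableSet_le (by fun_prop) (by fun_prop)) ?_ measurable_const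
    exact (((by fun_prop : Measurable fun z : ℝ × ℝ ↦ |z.1 - z.2|).pow_const _).mul
      (by fun_prop)).mul (by fun_prop) |>.ennreal_ofReal
  have hpt : ∀ t s, ENNReal.ofReal (|t - s| ^ (-(2 / r)) * a s * a t) ≤ k t s + k s t := by
    intro t s
    simp only [hk]
    rcases le_total (a s) (a t) with h | h
    · rw [if_pos h]
      exact le_self_add
    · rw [if_pos h, abs_sub_comm s t, mul_right_comm]
      exact le_add_self
  have hone : ∫⁻ t, ∫⁻ s, k t s ≤ ENNReal.ofReal (C * X ^ (2 - 2 / r)) := by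
    have hin : ∀ t, ∫⁻ s, k t s ≤
        ENNReal.ofReal (C * X ^ (1 - 2 / r)) * ENNReal.ofReal (a t ^ (r / (r - 1))) := by
      intro t
      rcases (ha0 t).eq_or_lt with h | h
      · simp [hk, ← h]
      · have := lintegral_riesz_sublevel_le hr ha ha0 hX haX t h
        calc ∫⁻ s, k t s = ∫⁻ s, (if a s ≤ a t then
              ENNReal.ofReal (|t - s| ^ (-(2 / r)) * a s) else 0) * ENNReal.ofReal (a t) := by
              refine lintegral_congr fun s ↦ ?_
              simp only [hk]
              split_ifs
              · rw [← ENNReal.ofReal_mul]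
                exact mul_nonneg (by positivity) (ha0 s)
              · simp
          _ = (∫⁻ s, if a s ≤ a t then
              ENNReal.ofReal (|t - s| ^ (-(2 / r)) * a s) else 0) * ENNReal.ofReal (a t) :=
              lintegral_mul_const' _ _ ENNReal.ofReal_ne_top
          _ ≤ _ := mul_le_mul_left this _
          _ = _ := by
              rw [← ENNReal.ofReal_mul (by positivity), ← ENNReal.ofReal_mul (by positivity)]
              congr 1
              have : a t ^ (r / (r - 1)) = a t ^ (1 / (r - 1)) * a t := by
                rw [← Real.rpow_add_one h.ne']
                congr 1
                field_simp
                ring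
              rw [this]
              ring
    refine (lintegral_mono hin).trans ?_
    rw [lintegral_const_mul _ (ha.pow_const _).ennreal_ofReal, haX,
      ← ENNReal.ofReal_mul (by positivity)]
    apply le_of_eq
    congr 1
    rw [mul_assoc, ← Real.rpow_add_one hX.ne']
    ring_nf
  calc _ ≤ ∫⁻ t, ∫⁻ s, (k t s + k s t) := lintegral_mono fun t ↦ lintegral_mono fun s ↦ hpt t s
    _ = (∫⁻ t, ∫⁻ s, k t s) + ∫⁻ t, ∫⁻ s, k s t := by
        rw [← lintegral_add_left hkm.lintegral_prod_right]
        refine lintegral_congr fun t ↦ ?_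
        exact lintegral_add_left
          (hkm.comp (measurable_const.prodMk measurable_id) : Measurable (k t)) _
    _ = (∫⁻ t, ∫⁻ s, k t s) + ∫⁻ t, ∫⁻ s, k t s := by
        congr 1
        exact lintegral_lintegral_swap (f := fun t s ↦ k s t)
          (hkm.comp measurable_swap).aemeasurable
    _ ≤ _ := by
        refine (add_le_add hone hone).trans_eq ?_
        rw [← ENNReal.ofReal_add (by positivity) (by positivity)]
        congr 1
        ring

end

section

/-! ### Continuity in time -/

theorem UnitMultiplier.act_sub {d : ℕ} (m : UnitMultiplier d) (f g : L2 d) :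
    m.act (f - g) = m.act f - m.act g := by
  rw [eq_sub_iff_add_eq, ← act_add, sub_add_cancel]

theorem L2.norm_sq_eq {d : ℕ} (f : L2 d) : ‖f‖ ^ 2 = ∫ x, ‖f x‖ ^ 2 := by
  have h := inner_self_eq_norm_sq_to_K (𝕜 := ℂ) f
  rw [L2.inner_def] at h
  have h2 : ∫ x, inner ℂ (f x) (f x) = ((∫ x, ‖f x‖ ^ 2 : ℝ) : ℂ) := by
    rw [← integral_complex_ofReal]
    refine integral_congr_ae (Filter.Eventually.of_forall fun x ↦ ?_)
    change inner ℂ (f x) (f x) = ((‖f x‖ ^ 2 : ℝ) : ℂ)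
    rw [inner_self_eq_norm_sq_to_K]
    push_cast
    rfl
  rw [h2] at h
  have h3 : ((∫ x, ‖f x‖ ^ 2 : ℝ) : ℂ) = ((‖f‖ ^ 2 : ℝ) : ℂ) := by
    rw [h]
    push_cast
    rfl
  exact (Complex.ofReal_injective h3).symm

theorem L2.integrable_norm_sq {d : ℕ} (f : L2 d) : Integrable fun x ↦ ‖f x‖ ^ 2 :=
  (memLp_two_iff_integrable_sq_norm (Lp.aestronglyMeasurable f)).1 (Lp.memLp f)

section Flow

variable {d : ℕ} [NeZero d]

theorem continuous_phase_time (ζ : Space d) : Continuous fun t ↦ phase t ζ := by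
  unfold phase
  fun_prop

/-- Dominated convergence for ‖(phase t - phase s) g‖², with majorant 4|g|². -/
theorem continuous_phaseMultiplier_act (g : L2 d) :
    Continuous fun t ↦ (phaseMultiplier t).act g := by
  rw [continuous_iff_continuousAt]
  intro s
  have hc : Continuous fun t ↦ ∫ ζ, ‖(phase t ζ - phase s ζ) * g ζ‖ ^ 2 := by
    refine continuous_of_dominated (bound := fun ζ ↦ 4 * ‖g ζ‖ ^ 2) (fun t ↦ ?_) (fun t ↦ ?_)
      ((L2.integrable_norm_sq g).const_mul 4) (Filter.Eventually.of_forall fun ζ ↦ ?_)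
    · exact ((((continuous_phase t).sub (continuous_phase s)).aestronglyMeasurable.mul
        (Lp.aestronglyMeasurable g)).norm.pow 2)
    · refine Filter.Eventually.of_forall fun ζ ↦ ?_
      rw [Real.norm_of_nonneg (by positivity), norm_mul, mul_pow]
      have : ‖phase t ζ - phase s ζ‖ ≤ 2 := by
        refine (norm_sub_le _ _).trans ?_
        rw [norm_phase, norm_phase]
        norm_num
      gcongr
      nlinarith [norm_nonneg (phase t ζ - phase s ζ)]
    · exact (((continuous_phase_time ζ).sub continuous_const).mul continuous_const).norm.pow 2
  have hn : ∀ t, ‖(phaseMultiplier t).act g - (phaseMultiplier s).act g‖ ^ 2 =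
      ∫ ζ, ‖(phase t ζ - phase s ζ) * g ζ‖ ^ 2 := by
    intro t
    rw [L2.norm_sq_eq]
    apply integral_congr_ae
    filter_upwards [Lp.coeFn_sub ((phaseMultiplier t).act g) ((phaseMultiplier s).act g),
      (phaseMultiplier t).coeFn_act g, (phaseMultiplier s).coeFn_act g] with ζ h1 h2 h3
    rw [h1, Pi.sub_apply, h2, h3, sub_mul]
    rfl
  rw [ContinuousAt, tendsto_iff_norm_sub_tendsto_zero]
  have h0 := hc.tendsto s
  simp only [sub_self, zero_mul, norm_zero, ne_eq, OfNat.ofNat_ne_zero, not_false_eq_true,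
    zero_pow, integral_zero] at h0
  simp only [← hn] at h0
  have := h0.sqrt
  simpa [Real.sqrt_sq] using this

theorem Continuous.phaseMultiplier_act {h : ℝ → L2 d} (hh : Continuous h) :
    Continuous fun t ↦ (phaseMultiplier t).act (h t) := by
  rw [continuous_iff_continuousAt]
  intro s
  rw [ContinuousAt, tendsto_iff_norm_sub_tendsto_zero]
  have h1 := tendsto_iff_norm_sub_tendsto_zero.1 (hh.tendsto s)
  have h2 := tendsto_iff_norm_sub_tendsto_zero.1 ((continuous_phaseMultiplier_act (h s)).tendsto s)
  refine squeeze_zero (fun t ↦ norm_nonneg _) (fun t ↦ ?_) (by simpa using h1.add h2)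
  calc _ = ‖(phaseMultiplier t).act (h t - h s) +
        ((phaseMultiplier t).act (h s) - (phaseMultiplier s).act (h s))‖ := by
        rw [UnitMultiplier.act_sub]; congr 1; abel
    _ ≤ _ := (norm_add_le _ _).trans (add_le_add_left (UnitMultiplier.norm_act_le _ _) _)

end Flow

/-! ### The duality map of `L^q`, cut off at a height -/

/-- Bernoulli's inequality at x/y - 1, multiplied by y^p. -/
theorem rpow_sub_rpow_le {p x y : ℝ} (hp : 1 ≤ p) (hx : 0 ≤ x) (hxy : x ≤ y) :
    y ^ p - x ^ p ≤ p * y ^ (p - 1) * (y - x) := by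
  rcases (hx.trans hxy).eq_or_lt with h | hy
  · have : x = y := by linarith
    simp [this]
  have h := one_add_mul_self_le_rpow_one_add (s := x / y - 1) (by
    have : 0 ≤ x / y := by positivity
    linarith) hp
  rw [add_sub_cancel, Real.div_rpow hx hy.le, le_div_iff₀ (by positivity)] at h
  have e : y ^ p = y ^ (p - 1) * y := by rw [← Real.rpow_add_one hy.ne']; simp
  have : (1 + p * (x / y - 1)) * y ^ p = y ^ p + p * y ^ (p - 1) * (x - y) := by
    rw [e]
    field_simp
  linarith

/-- The map `z ↦ |z|^κ z`, with `|z|` replaced by `B` above height `B` in the first factor. -/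
def truncPow (κ B : ℝ) (z : ℂ) : ℂ := ((min ‖z‖ B ^ κ : ℝ) : ℂ) * z

/-- The cut-off makes the duality map z ↦ |z|^κ z globally Lipschitz, so that it acts continuously
on L² and the dual functions below depend continuously on time. When the smaller modulus is at least
`B`, both factors equal B^κ; otherwise their difference is controlled by the preceding inequality
with exponent κ + 1. -/
theorem lipschitzWith_truncPow {κ B : ℝ} (hκ : 0 < κ) (hB : 0 < B) :
    LipschitzWith (Real.toNNReal ((κ + 2) * B ^ κ)) (truncPow κ B) := by
  have hC : 0 ≤ (κ + 2) * B ^ κ := by positivity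
  have key : ∀ a b : ℂ, ‖a‖ ≤ ‖b‖ →
      ‖truncPow κ B b - truncPow κ B a‖ ≤ (κ + 2) * B ^ κ * ‖b - a‖ := by
    intro a b hab
    set x := min ‖a‖ B with hx
    set y := min ‖b‖ B with hy
    have hx0 : 0 ≤ x := le_min (norm_nonneg _) hB.le
    have hxy : x ≤ y := min_le_min_right _ hab
    have hyB : y ≤ B := min_le_right _ _
    have hy0 : 0 ≤ y := hx0.trans hxy
    have e : truncPow κ B b - truncPow κ B a =
        ((y ^ κ : ℝ) : ℂ) * (b - a) + ((y ^ κ - x ^ κ : ℝ) : ℂ) * a := by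
      simp only [truncPow, ← hx, ← hy]
      push_cast
      ring
    have hmono : x ^ κ ≤ y ^ κ := Real.rpow_le_rpow hx0 hxy hκ.le
    have h2 : (y ^ κ - x ^ κ) * ‖a‖ ≤ (κ + 1) * B ^ κ * ‖b - a‖ := by
      rcases le_total B ‖a‖ with h | h
      · have hxB : x = B := min_eq_right h
        have hyB' : y = B := min_eq_right (h.trans hab)
        rw [hxB, hyB', sub_self, zero_mul]
        positivity
      · have hxa : x = ‖a‖ := min_eq_left h
        rw [← hxa]
        have h3 := rpow_sub_rpow_le (p := κ + 1) (by linarith) hx0 hxy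
        rw [add_sub_cancel_right, Real.rpow_add_one' hx0 (by linarith),
          Real.rpow_add_one' hy0 (by linarith)] at h3
        have h4 : y - x ≤ ‖b - a‖ := by
          have : y ≤ ‖b‖ := min_le_left _ _
          have := norm_sub_norm_le b a
          rw [hxa]
          linarith
        calc (y ^ κ - x ^ κ) * x ≤ y ^ κ * y - x ^ κ * x := by
              have : y ^ κ * x ≤ y ^ κ * y := by gcongr
              linarith
          _ ≤ (κ + 1) * y ^ κ * (y - x) := h3
          _ ≤ (κ + 1) * B ^ κ * ‖b - a‖ := by
              have : y ^ κ ≤ B ^ κ := Real.rpow_le_rpow hy0 hyB hκ.le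
              have : 0 ≤ y - x := by linarith
              gcongr
    rw [e]
    refine (norm_add_le _ _).trans ?_
    rw [norm_mul, norm_mul, Complex.norm_real, Complex.norm_real,
      Real.norm_of_nonneg (by positivity), Real.norm_of_nonneg (by linarith)]
    have : y ^ κ * ‖b - a‖ ≤ B ^ κ * ‖b - a‖ := by gcongr
    linarith
  apply LipschitzWith.of_dist_le_mul
  intro a b
  rw [Real.coe_toNNReal _ hC, dist_eq_norm, dist_eq_norm]
  rcases le_total ‖a‖ ‖b‖ with h | h
  · rw [norm_sub_rev, norm_sub_rev a b]
    exact key a b h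
  · exact key b a h

theorem truncPow_zero (κ B : ℝ) : truncPow κ B 0 = 0 := by simp [truncPow]

theorem truncPow_of_norm_le {κ B : ℝ} {z : ℂ} (hz : ‖z‖ ≤ B) :
    truncPow κ B z = ((‖z‖ ^ κ : ℝ) : ℂ) * z := by
  rw [truncPow, min_eq_left hz]

end

/-! ### The `T T*` argument -/

theorem enorm_inner_le {d : ℕ} {q : ℝ} (hq : 1 < q) (f g : L2 d) :
    ‖inner ℂ f g‖ₑ ≤ (∫⁻ x, ENNReal.ofReal (‖f x‖ ^ q)) ^ (1 / q) *
      (∫⁻ x, ENNReal.ofReal (‖g x‖ ^ (q / (q - 1)))) ^ ((q - 1) / q) := by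
  have hq1 : 0 < q - 1 := by linarith
  have hconj : q.HolderConjugate (q / (q - 1)) := by
    rw [Real.holderConjugate_iff]
    refine ⟨hq, ?_⟩
    field_simp
    ring
  rw [L2.inner_def]
  refine (enorm_integral_le_lintegral_enorm _).trans ?_
  have h := ENNReal.lintegral_mul_le_Lp_mul_Lq volume hconj
    (f := fun x ↦ ENNReal.ofReal ‖f x‖) (g := fun x ↦ ENNReal.ofReal ‖g x‖)
    (Lp.stronglyMeasurable f).norm.measurable.ennreal_ofReal.aemeasurable
    (Lp.stronglyMeasurable g).norm.measurable.ennreal_ofReal.aemeasurable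
  have e : 1 / (q / (q - 1)) = (q - 1) / q := by field_simp
  rw [e] at h
  simp only [ENNReal.ofReal_rpow_of_nonneg (norm_nonneg _) (show 0 ≤ q by linarith),
    ENNReal.ofReal_rpow_of_nonneg (norm_nonneg _) (show 0 ≤ q / (q - 1) by positivity)] at h
  refine le_trans (lintegral_mono fun x ↦ ?_) h
  rw [Pi.mul_apply, ← ENNReal.ofReal_mul (norm_nonneg _), ← ofReal_norm]
  apply ENNReal.ofReal_le_ofReal
  exact norm_inner_le_norm (f x) (g x)

theorem lintegral_ofReal_norm_rpow {d : ℕ} {q : ℝ} (hq : 0 < q) (f : L2 d) :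
    eLpNorm f (ENNReal.ofReal q) volume =
      (∫⁻ x, ENNReal.ofReal (‖f x‖ ^ q)) ^ (1 / q) := by
  rw [eLpNorm_eq_lintegral_rpow_enorm_toReal (ENNReal.ofReal_pos.2 hq).ne' ENNReal.ofReal_ne_top,
    ENNReal.toReal_ofReal hq.le]
  congr 1
  refine lintegral_congr fun x ↦ ?_
  rw [← ofReal_norm, ENNReal.ofReal_rpow_of_nonneg (norm_nonneg _) hq.le]

/-- The constant of `lintegral_riesz_le`. -/
def rieszConst (r : ℝ) : ℝ := 2 * (2 / (1 - 2 / r) + 2 ^ (1 / r))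

theorem rieszConst_pos {r : ℝ} (hr : 2 < r) : 0 < rieszConst r := by
  have hγ : 2 / r < 1 := by rw [div_lt_one (by linarith)]; exact hr
  have hγ' : 0 < 1 - 2 / r := by linarith
  unfold rieszConst
  positivity

/-- A curve `t ↦ F t` whose pairing kernel `⟨T (t - s) F s, F t⟩` is dominated by
`|t - s| ^ (-2 / r)`: bound for its integral in time. -/
theorem norm_integral_sq_le {r A X : ℝ} (hr : 2 < r) (hA : 0 < A) (hX : 0 < X) {d : ℕ}
    {W : ℝ → L2 d}
    (hW : Continuous W) {b : ℝ → ℝ} (hb : Continuous b) (hb0 : ∀ t, 0 < b t)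
    (hbX : ∫⁻ t in Set.Icc (0 : ℝ) 1, ENNReal.ofReal (b t ^ (r / (r - 1))) = ENNReal.ofReal X)
    (hk : ∀ t s, t ≠ s → ‖inner ℂ (W s) (W t)‖ₑ ≤
      ENNReal.ofReal (A * |t - s| ^ (-(2 / r)) * b s * b t)) :
    ‖∫ t in Set.Icc (0 : ℝ) 1, W t‖ ^ 2 ≤ A * rieszConst r * X ^ (2 - 2 / r) := by
  set μ : Measure ℝ := volume.restrict (Set.Icc (0 : ℝ) 1) with hμ
  have hWi : Integrable W μ := hW.continuousOn.integrableOn_compact isCompact_Icc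
  set V := ∫ t, W t ∂μ with hV
  have hr1 : 0 < r - 1 := by linarith
  have hrpos := rieszConst_pos hr
  have hm : MeasurableSet (Set.Icc (0 : ℝ) 1) := measurableSet_Icc
  -- Extension by zero, since the Riesz inequality is stated on the whole line.
  set a : ℝ → ℝ := (Set.Icc (0 : ℝ) 1).indicator b with ha
  have ham : Measurable a := hb.measurable.indicator hm
  have ha0 : ∀ t, 0 ≤ a t := fun t ↦ Set.indicator_nonneg (fun t _ ↦ (hb0 t).le) t
  have haX : ∫⁻ s, ENNReal.ofReal (a s ^ (r / (r - 1))) = ENNReal.ofReal X := by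
    rw [← hbX, ← lintegral_indicator hm]
    refine lintegral_congr fun s ↦ ?_
    by_cases hs : s ∈ Set.Icc (0 : ℝ) 1
    · rw [ha, Set.indicator_of_mem hs, Set.indicator_of_mem hs]
    · rw [ha, Set.indicator_of_notMem hs, Set.indicator_of_notMem hs, Real.zero_rpow (by positivity),
        ENNReal.ofReal_zero]
  have hin : ∀ t, ‖inner ℂ V (W t)‖ₑ ≤ ∫⁻ s, ‖inner ℂ (W s) (W t)‖ₑ ∂μ := by
    intro t
    have e : inner ℂ (W t) V = ∫ s, inner ℂ (W t) (W s) ∂μ := (integral_inner hWi (W t)).symm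
    have e2 : ‖inner ℂ V (W t)‖ₑ = ‖inner ℂ (W t) V‖ₑ := by
      rw [← ofReal_norm, ← ofReal_norm, norm_inner_symm]
    rw [e2, e]
    refine (enorm_integral_le_lintegral_enorm _).trans_eq (lintegral_congr fun s ↦ ?_)
    rw [← ofReal_norm, ← ofReal_norm, norm_inner_symm]
  have hVV : ENNReal.ofReal (‖V‖ ^ 2) ≤ ∫⁻ t, ∫⁻ s, ‖inner ℂ (W s) (W t)‖ₑ ∂μ ∂μ := by
    have e : inner ℂ V V = ∫ t, inner ℂ V (W t) ∂μ := (integral_inner hWi V).symm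
    have e2 : ENNReal.ofReal (‖V‖ ^ 2) = ‖inner ℂ V V‖ₑ := by
      rw [← ofReal_norm, inner_self_eq_norm_sq_to_K]
      simp
    rw [e2, e]
    exact (enorm_integral_le_lintegral_enorm _).trans (lintegral_mono hin)
  have hfin : ENNReal.ofReal (‖V‖ ^ 2) ≤ ENNReal.ofReal (A * rieszConst r * X ^ (2 - 2 / r)) := by
    refine hVV.trans ?_
    calc ∫⁻ t, ∫⁻ s, ‖inner ℂ (W s) (W t)‖ₑ ∂μ ∂μ
        ≤ ∫⁻ t, ∫⁻ s, ENNReal.ofReal (A * |t - s| ^ (-(2 / r)) * b s * b t) ∂μ ∂μ := by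
          refine lintegral_mono fun t ↦ lintegral_mono_ae ?_
          have : ∀ᵐ s ∂μ, s ≠ t := by
            rw [hμ]
            exact ae_restrict_of_ae (Measure.ae_ne volume t)
          filter_upwards [this] with s hs
          exact hk t s hs.symm
      _ = ∫⁻ t, ∫⁻ s, ENNReal.ofReal A * ENNReal.ofReal (|t - s| ^ (-(2 / r)) * a s * a t) := by
          rw [hμ, ← lintegral_indicator hm]
          refine lintegral_congr fun t ↦ ?_
          by_cases ht : t ∈ Set.Icc (0 : ℝ) 1
          · rw [Set.indicator_of_mem ht, ← lintegral_indicator hm]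
            refine lintegral_congr fun s ↦ ?_
            by_cases hs : s ∈ Set.Icc (0 : ℝ) 1
            · rw [Set.indicator_of_mem hs, ha, Set.indicator_of_mem hs, Set.indicator_of_mem ht,
                ← ENNReal.ofReal_mul hA.le]
              congr 1
              ring
            · rw [Set.indicator_of_notMem hs, ha, Set.indicator_of_notMem hs]
              simp
          · rw [Set.indicator_of_notMem ht, ha]
            simp [Set.indicator_of_notMem ht]
      _ = ENNReal.ofReal A * ∫⁻ t, ∫⁻ s, ENNReal.ofReal (|t - s| ^ (-(2 / r)) * a s * a t) := by
          simp_rw [lintegral_const_mul' _ _ ENNReal.ofReal_ne_top]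
      _ ≤ ENNReal.ofReal A * ENNReal.ofReal (rieszConst r * X ^ (2 - 2 / r)) := by
          gcongr
          exact lintegral_riesz_le hr ham ha0 hX haX
      _ = _ := by rw [← ENNReal.ofReal_mul hA.le, mul_assoc]
  exact (ENNReal.ofReal_le_ofReal_iff (by positivity)).1 hfin

/-- The T T* identity: the two backward evolutions combine into one for time t - s, and the cut-off
enters as m times its conjugate. Dispersive bounds are therefore needed only for this composite
multiplier. -/
theorem inner_flow_eq {d : ℕ} [NeZero d] (m : UnitMultiplier d) (F₁ F₂ : L2 d) (s t : ℝ) :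
    inner ℂ (m.conj.act ((phaseMultiplier (-s)).act (𝓕 F₁)))
      (m.conj.act ((phaseMultiplier (-t)).act (𝓕 F₂))) =
    inner ℂ (((phaseMultiplier (t - s)).comp (m.comp m.conj)).op F₁) F₂ := by
  rw [UnitMultiplier.op, UnitMultiplier.inner_fourierInv, UnitMultiplier.act_act,
    UnitMultiplier.act_act, ← inner_conj_symm, UnitMultiplier.inner_act_left, inner_conj_symm,
    ← inner_conj_symm, UnitMultiplier.act_act]
  rw [inner_conj_symm]
  congr 2
  ext ζ
  simp only [UnitMultiplier.comp, UnitMultiplier.conj, phaseMultiplier, map_mul, conj_phase,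
    Complex.conj_conj, neg_neg, sub_eq_add_neg, phase_add]
  ring

/-! ### Dual functions and the Strichartz estimate from dispersion -/

section

variable {d : ℕ}

/-- The cut-off at `B` is inactive on values of modulus at most `B`, so the pairing is the integral
of |v|^{q-2} |v|². It is finite because |v|^q ≤ B^{q-2} |v|². -/
theorem inner_truncPow {q B : ℝ} (hq : 2 < q) (hB : 0 < B) (v : L2 d) (hv : ∀ᵐ x, ‖v x‖ ≤ B) :
    Integrable (fun x ↦ ‖v x‖ ^ q) ∧
    inner ℂ v ((lipschitzWith_truncPow (show 0 < q - 2 by linarith) hB).compLp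
      (truncPow_zero _ _) v) = ((∫ x, ‖v x‖ ^ q : ℝ) : ℂ) := by
  have hae : ∀ᵐ x, inner ℂ (v x) (((lipschitzWith_truncPow (show 0 < q - 2 by linarith) hB).compLp
      (truncPow_zero _ _) v) x) = ((‖v x‖ ^ q : ℝ) : ℂ) := by
    filter_upwards [hv, (lipschitzWith_truncPow (show 0 < q - 2 by linarith) hB).coeFn_compLp
      (truncPow_zero _ _) v] with x hx h1
    rw [h1, Function.comp_apply, truncPow_of_norm_le hx]
    simp only [RCLike.inner_apply]
    rw [mul_assoc, Complex.mul_conj, Complex.normSq_eq_norm_sq, ← Complex.ofReal_mul]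
    congr 1
    rw [← Real.rpow_natCast, ← Real.rpow_add' (norm_nonneg _) (by push_cast; linarith)]
    congr 1
    push_cast
    ring
  constructor
  · refine ((L2.integrable_norm_sq v).const_mul (B ^ (q - 2))).mono'
      ((Lp.stronglyMeasurable v).norm.measurable.pow_const q).aestronglyMeasurable ?_
    filter_upwards [hv] with x hx
    rw [Real.norm_of_nonneg (by positivity)]
    have e : ‖v x‖ ^ q = ‖v x‖ ^ (q - 2) * ‖v x‖ ^ 2 := by
      rw [← Real.rpow_natCast, ← Real.rpow_add' (norm_nonneg _) (by push_cast; linarith)]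
      congr 1
      push_cast
      ring
    rw [e]
    have : ‖v x‖ ^ (q - 2) ≤ B ^ (q - 2) :=
      Real.rpow_le_rpow (norm_nonneg _) hx (by linarith)
    gcongr
  · rw [L2.inner_def, integral_congr_ae hae, integral_complex_ofReal]

theorem lintegral_truncPow {q B : ℝ} (hq : 2 < q) (hB : 0 < B) (v : L2 d)
    (hv : ∀ᵐ x, ‖v x‖ ≤ B) {c : ℝ} (hc : 0 < c) :
    ∫⁻ x, ENNReal.ofReal (‖((c : ℂ) •
      (lipschitzWith_truncPow (show 0 < q - 2 by linarith) hB).compLp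
      (truncPow_zero _ _) v : L2 d) x‖ ^ (q / (q - 1))) =
    ENNReal.ofReal (c ^ (q / (q - 1)) * ∫ x, ‖v x‖ ^ q) := by
  have hq1 : 0 < q - 1 := by linarith
  have hi := (inner_truncPow hq hB v hv).1
  rw [← integral_const_mul, ofReal_integral_eq_lintegral_ofReal (hi.const_mul _)
    (Filter.Eventually.of_forall fun x ↦ by positivity)]
  apply lintegral_congr_ae
  filter_upwards [hv, (lipschitzWith_truncPow (show 0 < q - 2 by linarith) hB).coeFn_compLp
    (truncPow_zero _ _) v, Lp.coeFn_smul (c : ℂ)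
    ((lipschitzWith_truncPow (show 0 < q - 2 by linarith) hB).compLp (truncPow_zero _ _) v)]
    with x hx h1 h2
  rw [h2, Pi.smul_apply, h1, Function.comp_apply, truncPow_of_norm_le hx, norm_smul, norm_mul,
    Complex.norm_real, Complex.norm_real, Real.norm_of_nonneg hc.le,
    Real.norm_of_nonneg (by positivity), Real.mul_rpow hc.le (by positivity),
    ← Real.rpow_add_one' (norm_nonneg _) (by linarith), ← Real.rpow_mul (norm_nonneg _)]
  congr 3
  field_simp
  ring

variable [NeZero d]

theorem inner_flow_left (m : UnitMultiplier d) (g F : L2 d) (t : ℝ) :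
    inner ℂ (𝓕⁻ ((phaseMultiplier t).act (m.act g)) : L2 d) F =
      inner ℂ g (m.conj.act ((phaseMultiplier (-t)).act (𝓕 F))) := by
  have : (phaseMultiplier t).conj = phaseMultiplier (d := d) (-t) := by
    ext ζ
    simp [UnitMultiplier.conj, phaseMultiplier, conj_phase]
  rw [UnitMultiplier.inner_fourierInv, UnitMultiplier.inner_act_left,
    UnitMultiplier.inner_act_left, this]

set_option maxHeartbeats 1000000 in
-- The hypothesis `hdisp` is the L^{q'} to L^q bound with constant A|t|^(-2/r), raised to the power
-- q. The proof tests v(t) against the extremal dual function F(t) = n(t)^((r-q)/q) |v|^{q-2} v,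
-- where n(t) = ‖v(t)‖_q^q. With X the r-th power of the mixed norm, X = ⟨g, ∫ W⟩ ≤ ‖g‖ ‖∫ W‖, and
-- the T T* bound gives ‖∫ W‖² ≤ A · rieszConst r · X^{2-2/r}. The bound `B` does not enter the
-- estimate; it makes the cut-off of the duality map harmless and every quantity finite.
theorem strichartz_of_dispersive {q r A : ℝ} (hq : 2 < q) (hr : 2 < r) (hA : 0 < A)
    (m : UnitMultiplier d)
    (hdisp : ∀ t ≠ 0, ∀ F : L2 d,
      ∫⁻ x, ENNReal.ofReal (‖((phaseMultiplier t).comp (m.comp m.conj)).op F x‖ ^ q) ≤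
        ENNReal.ofReal ((A * |t| ^ (-(2 / r))) ^ q) *
          (∫⁻ x, ENNReal.ofReal (‖F x‖ ^ (q / (q - 1)))) ^ (q - 1))
    (g : L2 d) {B : ℝ}
    (hbd : ∀ t, ∀ᵐ x, ‖(𝓕⁻ ((phaseMultiplier t).act (m.act g)) : L2 d) x‖ ≤ B) :
    strichartzNorm (ENNReal.ofReal r) (ENNReal.ofReal q)
      (fun t ↦ (𝓕⁻ ((phaseMultiplier t).act (m.act g)) : L2 d)) ≤
      ENNReal.ofReal ((A * rieszConst r) ^ (1 / 2 : ℝ) * ‖g‖) := by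
  wlog hB : 0 < B generalizing B
  · refine this (B := max B 1) (fun t ↦ ?_) (by positivity)
    filter_upwards [hbd t] with x hx
    exact hx.trans (le_max_left _ _)
  have hq1 : 0 < q - 1 := by linarith
  have hr1 : 0 < r - 1 := by linarith
  have hrc := rieszConst_pos hr
  set v : ℝ → L2 d := fun t ↦ 𝓕⁻ ((phaseMultiplier t).act (m.act g)) with hv
  have hvc : Continuous v :=
    (Lp.fourierTransformₗᵢ (Space d) ℂ).symm.continuous.comp
      (continuous_phaseMultiplier_act (m.act g))
  set Ψ := (lipschitzWith_truncPow (show 0 < q - 2 by linarith) hB).compLp (truncPow_zero _ _)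
    (E := ℂ) (p := 2) (μ := (volume : Measure (Space d))) with hΨ
  have hΨc : Continuous Ψ := LipschitzWith.continuous_compLp _ _
  set n : ℝ → ℝ := fun t ↦ ∫ x, ‖v t x‖ ^ q with hn
  have hin : ∀ t, inner ℂ (v t) (Ψ (v t)) = (n t : ℂ) := fun t ↦
    (inner_truncPow hq hB (v t) (hbd t)).2
  have hint : ∀ t, Integrable (fun x ↦ ‖v t x‖ ^ q) := fun t ↦
    (inner_truncPow hq hB (v t) (hbd t)).1
  have hnc : Continuous n := by
    have : n = fun t ↦ (inner ℂ (v t) (Ψ (v t))).re := by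
      ext t
      rw [hin, Complex.ofReal_re]
    rw [this]
    exact Complex.continuous_re.comp (hvc.inner (hΨc.comp hvc))
  have hn0 : ∀ t, 0 ≤ n t := fun t ↦ integral_nonneg fun x ↦ by positivity
  have hnorm : strichartzNorm (ENNReal.ofReal r) (ENNReal.ofReal q) v =
      (∫⁻ t in Set.Icc (0 : ℝ) 1, ENNReal.ofReal (n t ^ (r / q))) ^ (1 / r) := by
    rw [strichartzNorm, eLpNorm_eq_lintegral_rpow_enorm_toReal
      (ENNReal.ofReal_pos.2 (by linarith)).ne' ENNReal.ofReal_ne_top,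
      ENNReal.toReal_ofReal (by linarith)]
    congr 1
    refine lintegral_congr fun t ↦ ?_
    rw [enorm_eq_self, lintegral_ofReal_norm_rpow (by linarith),
      ← ofReal_integral_eq_lintegral_ofReal (hint t)
        (Filter.Eventually.of_forall fun x ↦ by positivity), ← ENNReal.rpow_mul,
      ENNReal.ofReal_rpow_of_nonneg (hn0 t) (by positivity)]
    congr 2
    ring
  have hXi : Integrable (fun t ↦ n t ^ (r / q)) (volume.restrict (Set.Icc (0 : ℝ) 1)) :=
    ((hnc.rpow_const fun t ↦ Or.inr (by positivity)).continuousOn).integrableOn_compact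
      isCompact_Icc
  set X := ∫ t in Set.Icc (0 : ℝ) 1, n t ^ (r / q) with hX
  have hXe : ∫⁻ t in Set.Icc (0 : ℝ) 1, ENNReal.ofReal (n t ^ (r / q)) = ENNReal.ofReal X :=
    (ofReal_integral_eq_lintegral_ofReal hXi
      (Filter.Eventually.of_forall fun t ↦ Real.rpow_nonneg (hn0 t) _)).symm
  have hX0 : 0 ≤ X := integral_nonneg fun t ↦ Real.rpow_nonneg (hn0 t) _
  rw [hnorm, hXe, ENNReal.ofReal_rpow_of_nonneg hX0 (by positivity)]
  apply ENNReal.ofReal_le_ofReal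
  rcases hX0.eq_or_lt with hXz | hXpos
  · rw [← hXz, Real.zero_rpow (by positivity)]
    positivity
  -- The exponent (r-q)/q may be negative, so continuity of F needs n never to vanish. As the phases
  -- have modulus one, v vanishes at one time only if it vanishes at all times, and then X = 0.
  have hnpos : ∀ t, 0 < n t := by
    have hnz : ∀ t, n t = 0 → m.act g = 0 := by
      intro t ht
      have h1 := (integral_eq_zero_iff_of_nonneg (fun x ↦ by positivity) (hint t)).1 ht
      have h2 : v t = 0 := by
        apply Lp.ext
        filter_upwards [h1, Lp.coeFn_zero ℂ 2 (volume : Measure (Space d))] with x hx h0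
        rw [h0, Pi.zero_apply]
        simpa using (Real.rpow_eq_zero (norm_nonneg _) (by linarith)).1 hx
      have h3 : (phaseMultiplier t).act (m.act g) = 0 := by
        rw [← norm_eq_zero, ← UnitMultiplier.norm_fourierInv]
        exact norm_eq_zero.2 h2
      apply Lp.ext
      filter_upwards [(phaseMultiplier t).coeFn_act (m.act g),
        Lp.coeFn_zero ℂ 2 (volume : Measure (Space d))] with x hx h0
      rw [h3, h0] at hx
      rw [h0, Pi.zero_apply]
      have hne : phase t x ≠ 0 := by
        rw [← norm_ne_zero_iff, norm_phase]
        exact one_ne_zero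
      exact (mul_eq_zero.1 hx.symm).resolve_left hne
    intro t
    refine (hn0 t).lt_of_ne' fun ht ↦ ?_
    have hz := hnz t ht
    have hall : ∀ s, n s = 0 := by
      intro s
      have hvs : v s = 0 := by
        simp only [hv, hz]
        rw [← norm_eq_zero, UnitMultiplier.norm_fourierInv]
        exact le_antisymm ((UnitMultiplier.norm_act_le _ _).trans_eq norm_zero) (norm_nonneg _)
      have := hin s
      rw [hvs, inner_zero_left] at this
      exact_mod_cast this.symm
    rw [hX] at hXpos
    simp only [hall] at hXpos
    rw [Real.zero_rpow (by positivity)] at hXpos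
    simp at hXpos
  set c : ℝ → ℝ := fun t ↦ n t ^ ((r - q) / q) with hc
  have hcpos : ∀ t, 0 < c t := fun t ↦ Real.rpow_pos_of_pos (hnpos t) _
  have hcc : Continuous c := hnc.rpow_const fun t ↦ Or.inl (hnpos t).ne'
  set F : ℝ → L2 d := fun t ↦ (c t : ℂ) • Ψ (v t) with hF
  have hFc : Continuous F := (Complex.continuous_ofReal.comp hcc).smul (hΨc.comp hvc)
  -- This is the L^{q'} norm of F(t), and its power r/(r-1) is n^{r/q}, the integrand of X.
  set b : ℝ → ℝ := fun t ↦ n t ^ ((r - 1) / q) with hb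
  have hbc : Continuous b := hnc.rpow_const fun t ↦ Or.inl (hnpos t).ne'
  have hbpos : ∀ t, 0 < b t := fun t ↦ Real.rpow_pos_of_pos (hnpos t) _
  have hFb : ∀ t, ∫⁻ x, ENNReal.ofReal (‖F t x‖ ^ (q / (q - 1))) =
      ENNReal.ofReal (b t ^ (q / (q - 1))) := by
    intro t
    rw [hF]
    refine (lintegral_truncPow hq hB (v t) (hbd t) (hcpos t)).trans ?_
    congr 1
    change c t ^ (q / (q - 1)) * n t = b t ^ (q / (q - 1))
    rw [hc, hb]
    simp only
    rw [← Real.rpow_mul (hnpos t).le, ← Real.rpow_mul (hnpos t).le,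
      ← Real.rpow_add_one (hnpos t).ne']
    congr 1
    field_simp
    ring
  set W : ℝ → L2 d := fun t ↦ m.conj.act ((phaseMultiplier (-t)).act (𝓕 (F t))) with hW
  have hWc : Continuous W := by
    have h1 : Continuous fun t ↦ (phaseMultiplier (-t)).act (𝓕 (F t) : L2 d) := by
      have h0 : Continuous fun t ↦ (𝓕 (F (-t)) : L2 d) :=
        (Lp.fourierTransformₗᵢ (Space d) ℂ).continuous.comp (hFc.comp continuous_neg)
      have := (Continuous.phaseMultiplier_act h0).comp continuous_neg
      simpa [Function.comp_def] using this
    have h2 : LipschitzWith 1 m.conj.act := LipschitzWith.of_dist_le_mul fun f g ↦ by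
      rw [dist_eq_norm, dist_eq_norm, ← UnitMultiplier.act_sub, NNReal.coe_one, one_mul]
      exact UnitMultiplier.norm_act_le _ _
    exact h2.continuous.comp h1
  have hgW : ∀ t, inner ℂ g (W t) = ((n t ^ (r / q) : ℝ) : ℂ) := by
    intro t
    have h1 : inner ℂ (v t) (F t) = ((n t ^ (r / q) : ℝ) : ℂ) := by
      rw [hF]
      simp only
      rw [inner_smul_right, hin, ← Complex.ofReal_mul, hc]
      simp only
      rw [← Real.rpow_add_one (hnpos t).ne']
      congr 2
      field_simp
      ring
    rw [← h1, hv]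
    simp only
    exact (inner_flow_left m g (F t) t).symm
  have hkern : ∀ t s, t ≠ s → ‖inner ℂ (W s) (W t)‖ₑ ≤
      ENNReal.ofReal (A * |t - s| ^ (-(2 / r)) * b s * b t) := by
    intro t s hts
    rw [hW]
    simp only
    rw [inner_flow_eq]
    refine (enorm_inner_le (q := q) (by linarith) _ _).trans ?_
    have hk0 : 0 < |t - s| := abs_pos.2 (sub_ne_zero.2 hts)
    have := hdisp (t - s) (sub_ne_zero.2 hts) (F s)
    rw [hFb] at this
    refine (mul_le_mul_left (ENNReal.rpow_le_rpow this (by positivity)) _).trans ?_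
    rw [hFb]
    have p1 : 0 < A * |t - s| ^ (-(2 / r)) := by positivity
    rw [ENNReal.ofReal_rpow_of_pos (Real.rpow_pos_of_pos (hbpos s) _), ← ENNReal.ofReal_mul
      (by positivity), ENNReal.ofReal_rpow_of_nonneg
      (mul_nonneg (by positivity) (Real.rpow_nonneg (Real.rpow_nonneg (hbpos s).le _) _))
      (by positivity), ENNReal.ofReal_rpow_of_pos (Real.rpow_pos_of_pos (hbpos t) _),
      ← ENNReal.ofReal_mul (Real.rpow_nonneg (mul_nonneg (by positivity)
        (Real.rpow_nonneg (Real.rpow_nonneg (hbpos s).le _) _)) _)]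
    apply ENNReal.ofReal_le_ofReal
    apply le_of_eq
    rw [← Real.rpow_mul (hbpos s).le, ← Real.rpow_mul (hbpos t).le,
      Real.mul_rpow (by positivity) (Real.rpow_nonneg (hbpos s).le _), ← Real.rpow_mul p1.le,
      ← Real.rpow_mul (hbpos s).le]
    have e1 : q * (1 / q) = 1 := by field_simp
    have e2 : q / (q - 1) * (q - 1) * (1 / q) = 1 := by field_simp
    have e3 : q / (q - 1) * ((q - 1) / q) = 1 := by field_simp
    rw [e1, e2, e3]
    simp
  have hbX : ∫⁻ t in Set.Icc (0 : ℝ) 1, ENNReal.ofReal (b t ^ (r / (r - 1))) =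
      ENNReal.ofReal X := by
    rw [← hXe]
    refine lintegral_congr fun t ↦ ?_
    rw [hb]
    simp only
    rw [← Real.rpow_mul (hnpos t).le]
    congr 2
    field_simp
  have hVsq := norm_integral_sq_le hr hA hXpos hWc hbc hbpos hbX hkern
  have hWi : Integrable W (volume.restrict (Set.Icc (0 : ℝ) 1)) :=
    hWc.continuousOn.integrableOn_compact isCompact_Icc
  have hXV : X ≤ ‖g‖ * ‖∫ t in Set.Icc (0 : ℝ) 1, W t‖ := by
    have e : inner ℂ g (∫ t in Set.Icc (0 : ℝ) 1, W t) = (X : ℂ) := by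
      rw [← integral_inner hWi]
      simp only [hgW]
      rw [integral_complex_ofReal]
    have := norm_inner_le_norm (𝕜 := ℂ) g (∫ t in Set.Icc (0 : ℝ) 1, W t)
    rwa [e, Complex.norm_real, Real.norm_of_nonneg hX0] at this
  have hX2 : X ^ 2 ≤ ‖g‖ ^ 2 * (A * rieszConst r * X ^ (2 - 2 / r)) := by
    calc X ^ 2 ≤ (‖g‖ * ‖∫ t in Set.Icc (0 : ℝ) 1, W t‖) ^ 2 := by gcongr
      _ = ‖g‖ ^ 2 * ‖∫ t in Set.Icc (0 : ℝ) 1, W t‖ ^ 2 := by ring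
      _ ≤ _ := by gcongr
  -- Division of `hX2` by X^{2-2/r}, legitimate because X is a positive real number.
  have hX3 : (X ^ (1 / r)) ^ 2 ≤ ((A * rieszConst r) ^ (1 / 2 : ℝ) * ‖g‖) ^ 2 := by
    have e1 : X ^ 2 = (X ^ (1 / r)) ^ 2 * X ^ (2 - 2 / r) := by
      rw [← Real.rpow_natCast, ← Real.rpow_natCast, ← Real.rpow_mul hX0, ← Real.rpow_add hXpos]
      congr 1
      push_cast
      ring
    have e2 : ((A * rieszConst r) ^ (1 / 2 : ℝ) * ‖g‖) ^ 2 = A * rieszConst r * ‖g‖ ^ 2 := by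
      rw [mul_pow, ← Real.rpow_natCast, ← Real.rpow_mul (by positivity)]
      norm_num
    rw [e2]
    rw [e1] at hX2
    refine le_of_mul_le_mul_right ?_ (Real.rpow_pos_of_pos hXpos (2 - 2 / r))
    linarith
  exact (pow_le_pow_iff_left₀ (by positivity) (by positivity) two_ne_zero).1 hX3

end

/-! ### From kernel decay to Strichartz estimates -/

section

/-- `strichartz_of_dispersive` with the decay of the kernel as hypothesis. -/
theorem strichartz_of_kernel {d : ℕ} [NeZero d] {q r K : ℝ} (hq : 2 < q) (hr : 2 < r) (hK : 0 < K)
    (m : UnitMultiplier d)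
    (hker : ∀ t ≠ 0, ∀ h : L2 d, Integrable h →
      ∀ᵐ x, ‖((phaseMultiplier t).comp (m.comp m.conj)).op h x‖ ≤
        K * |t| ^ (-(2 * q / (r * (q - 2)))) * ∫ y, ‖h y‖)
    (g : L2 d) {B : ℝ}
    (hbd : ∀ t, ∀ᵐ x, ‖(𝓕⁻ ((phaseMultiplier t).act (m.act g)) : L2 d) x‖ ≤ B) :
    strichartzNorm (ENNReal.ofReal r) (ENNReal.ofReal q)
      (fun t ↦ (𝓕⁻ ((phaseMultiplier t).act (m.act g)) : L2 d)) ≤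
      ENNReal.ofReal (((4 * q / (q - 2) * 2 ^ (q - 2)) ^ (1 / q) * rieszConst r) ^ (1 / 2 : ℝ) *
        K ^ ((1 / 2 - 1 / q : ℝ)) * ‖g‖) := by
  have hq2 : 0 < q - 2 := by linarith
  have hrc := rieszConst_pos hr
  set c := 4 * q / (q - 2) * 2 ^ (q - 2) with hc
  have hc0 : 0 < c := by positivity
  set A := c ^ (1 / q) * K ^ (1 - 2 / q) with hA
  have hA0 : 0 < A := by positivity
  refine (strichartz_of_dispersive hq hr hA0 m (fun t ht F ↦ ?_) g hbd).trans_eq ?_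
  · have ht' : 0 < |t| := abs_pos.2 ht
    refine (lintegral_rpow_le_of_norm_le ((phaseMultiplier t).comp (m.comp m.conj)).op
      (UnitMultiplier.op_add _) (UnitMultiplier.norm_op_le _) (by positivity) (hker t ht) hq
      F).trans_eq ?_
    congr 2
    change c * _ = _
    rw [hA, Real.mul_rpow (by positivity) (by positivity), Real.mul_rpow (by positivity)
      (by positivity), Real.mul_rpow (by positivity) (by positivity), ← Real.rpow_mul hc0.le,
      ← Real.rpow_mul hK.le, ← Real.rpow_mul ht'.le, ← Real.rpow_mul ht'.le,
      one_div_mul_cancel (by linarith), Real.rpow_one]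
    have e1 : (1 - 2 / q) * q = q - 2 := by field_simp
    -- The decay exponent of the kernel is chosen so that interpolation, which raises it to the
    -- power 1 - 2/q, leaves exactly |t|^(-2/r).
    have e2 : -(2 * q / (r * (q - 2))) * (q - 2) = -(2 / r) * q := by field_simp
    rw [e1, e2, mul_assoc c]
  · congr 2
    rw [hA, mul_right_comm, Real.mul_rpow (by positivity) (by positivity), ← Real.rpow_mul hK.le]
    congr 2
    ring

/-! ### The splitting of the frequency variable -/

variable {n : ℕ}

/-- The frequency with first coordinate `ξ` and remaining coordinates `η`. -/
def consSpace (ξ : ℝ) (η : Space n) : Space (n + 1) :=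
  WithLp.toLp 2 (Fin.cons ξ (WithLp.ofLp η))

/-- The coordinates of nonzero index. -/
def tailSpace (x : Space (n + 1)) : Space n := WithLp.toLp 2 (fun i ↦ x i.succ)

theorem norm_consSpace_sq (ξ : ℝ) (η : Space n) : ‖consSpace ξ η‖ ^ 2 = ξ ^ 2 + ‖η‖ ^ 2 := by
  rw [EuclideanSpace.norm_sq_eq, EuclideanSpace.norm_sq_eq, Fin.sum_univ_succ]
  simp [consSpace]

theorem inner_consSpace (ξ : ℝ) (η : Space n) (x : Space (n + 1)) :
    inner ℝ (consSpace ξ η) x = ξ * x 0 + inner ℝ (tailSpace x) η := by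
  rw [PiLp.inner_apply, PiLp.inner_apply, Fin.sum_univ_succ]
  simp [consSpace, tailSpace, mul_comm]

theorem measurePreserving_consSpace :
    MeasurePreserving (fun z : ℝ × Space n ↦ consSpace z.1 z.2) := by
  have h1 := (volume_preserving_piFinSuccAbove (fun _ : Fin (n + 1) ↦ ℝ) 0).symm
  have h2 : MeasurePreserving (Prod.map id WithLp.ofLp : ℝ × Space n → ℝ × (Fin n → ℝ)) :=
    (MeasurePreserving.id volume).prod (PiLp.volume_preserving_ofLp (Fin n))
  have h3 := (PiLp.volume_preserving_toLp (Fin (n + 1))).comp (h1.comp h2)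
  convert h3 using 1
  ext z i
  refine Fin.cases ?_ (fun j ↦ ?_) i <;> simp [consSpace, MeasurableEquiv.piFinSuccAbove]

theorem measurableEmbedding_consSpace :
    MeasurableEmbedding (fun z : ℝ × Space n ↦ consSpace z.1 z.2) := by
  let h2 := (MeasurableEquiv.refl ℝ).prodCongr
    (MeasurableEquiv.toLp 2 (Fin n → ℝ)).symm
  have h3 := ((h2.trans (MeasurableEquiv.piFinSuccAbove (fun _ : Fin (n + 1) ↦ ℝ) 0).symm).trans
    (MeasurableEquiv.toLp 2 (Fin (n + 1) → ℝ))).measurableEmbedding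
  convert h3 using 1
  ext z i
  refine Fin.cases ?_ (fun j ↦ ?_) i <;>
    simp [consSpace, MeasurableEquiv.piFinSuccAbove, MeasurableEquiv.prodCongr, h2]

theorem integral_consSpace (f : Space (n + 1) → ℂ) :
    ∫ z : ℝ × Space n, f (consSpace z.1 z.2) = ∫ ζ, f ζ :=
  measurePreserving_consSpace.integral_comp measurableEmbedding_consSpace f

theorem integrable_consSpace_iff (f : Space (n + 1) → ℂ) :
    Integrable (fun z : ℝ × Space n ↦ f (consSpace z.1 z.2)) ↔ Integrable f :=
  measurePreserving_consSpace.integrable_comp_emb measurableEmbedding_consSpace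

/-! ### The kernel -/

/-- The inverse Fourier transform, with respect to all but the first coordinate, of the multiplier
of the flow times the Gaussian `exp (-ε |2πη|²)`. -/
def partialKernel (n : ℕ) (t ε : ℝ) (x : Space (n + 1)) (ξ : ℝ) : ℂ :=
  (Real.pi / ((2 * Real.pi : ℝ) ^ 2 * (ε - 2 * Real.pi * t * ξ * Complex.I)) : ℂ) ^ (n / 2 : ℂ) *
    Complex.exp (-(‖tailSpace x‖ ^ 2 : ℝ) / (4 * (ε - 2 * Real.pi * t * ξ * Complex.I)))

theorem integrable_phase_gaussian {χ : ℝ → ℝ} (hχ : Integrable χ) {ε : ℝ} (hε : 0 < ε) (t : ℝ) :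
    Integrable fun z : ℝ × Space n ↦ phase t (consSpace z.1 z.2) *
      ((χ z.1 : ℂ) * (Real.exp (-(ε * (2 * Real.pi * ‖z.2‖) ^ 2)) : ℂ)) := by
  have h2 : Integrable fun η : Space n ↦ (Real.exp (-(ε * (2 * Real.pi * ‖η‖) ^ 2)) : ℂ) := by
    have := GaussianFourier.integrable_cexp_neg_mul_sq_norm_add (V := Space n)
      (b := ((ε * (2 * Real.pi) ^ 2 : ℝ) : ℂ)) (by rw [Complex.ofReal_re]; positivity) 0 0
    refine this.congr (Filter.Eventually.of_forall fun η ↦ ?_)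
    simp only
    rw [Complex.ofReal_exp]
    congr 1
    push_cast
    ring
  refine (hχ.ofReal.mul_prod h2).bdd_mul (c := 1) ?_
    (Filter.Eventually.of_forall fun z ↦ (norm_phase _ _).le)
  exact ((continuous_phase t).measurable.comp
    measurePreserving_consSpace.measurable).aestronglyMeasurable

/-- For fixed ξ the exponent is quadratic in η with complex coefficient -(2π)²(ε - 2πitξ), so Fubini
and the Gaussian integral evaluate all variables but the first. Only the cubic phase in ξ and the
cut-off χ remain. -/
theorem fourierInv_phase_gaussian {χ : ℝ → ℝ} (hχ : Integrable χ) {ε : ℝ} (hε : 0 < ε) (t : ℝ)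
    {f : Space (n + 1) → ℂ}
    (hf : ∀ ξ η, f (consSpace ξ η) = phase t (consSpace ξ η) *
      ((χ ξ : ℂ) * (Real.exp (-(ε * (2 * Real.pi * ‖η‖) ^ 2)) : ℂ))) (x : Space (n + 1)) :
    𝓕⁻ f x = ∫ ξ, Complex.exp ((2 * Real.pi * ξ * x 0 + t * (2 * Real.pi * ξ) ^ 3 : ℝ) *
      Complex.I) * (χ ξ : ℂ) * partialKernel n t ε x ξ := by
  rw [Real.fourierInv_eq', ← integral_consSpace]
  simp only [hf, smul_eq_mul]
  have hi : Integrable fun z : ℝ × Space n ↦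
      Complex.exp (↑(2 * Real.pi * inner ℝ (consSpace z.1 z.2) x) * Complex.I) *
      (phase t (consSpace z.1 z.2) *
      ((χ z.1 : ℂ) * (Real.exp (-(ε * (2 * Real.pi * ‖z.2‖) ^ 2)) : ℂ))) := by
    refine (integrable_phase_gaussian hχ hε t).bdd_mul (c := 1) ?_
      (Filter.Eventually.of_forall fun z ↦ (Complex.norm_exp_ofReal_mul_I _).le)
    exact ((by fun_prop : Continuous fun ζ : Space (n + 1) ↦
      Complex.exp (↑(2 * Real.pi * inner ℝ ζ x) * Complex.I)).measurable.comp
      measurePreserving_consSpace.measurable).aestronglyMeasurable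
  rw [Measure.volume_eq_prod, integral_prod _ hi]
  congr 1
  ext ξ
  set b : ℂ := (2 * Real.pi : ℝ) ^ 2 * (ε - 2 * Real.pi * t * ξ * Complex.I) with hb
  have hbre : 0 < b.re := by
    have : b = ((2 * Real.pi) ^ 2 * ε : ℝ) + (-((2 * Real.pi) ^ 2 * (2 * Real.pi * t * ξ)) : ℝ) *
        Complex.I := by
      rw [hb]; push_cast; ring
    rw [this]
    simp only [Complex.add_re, Complex.ofReal_re, Complex.mul_re, Complex.I_re, Complex.I_im,
      Complex.ofReal_im]
    have : 0 < (2 * Real.pi) ^ 2 * ε := by positivity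
    linarith
  have key := GaussianFourier.integral_cexp_neg_mul_sq_norm_add hbre (2 * Real.pi * Complex.I)
    (tailSpace x)
  calc _ = ∫ η : Space n, Complex.exp ((2 * Real.pi * ξ * x 0 + t * (2 * Real.pi * ξ) ^ 3 : ℝ) *
      Complex.I) * (χ ξ : ℂ) *
        Complex.exp (-b * ‖η‖ ^ 2 + 2 * Real.pi * Complex.I * (inner ℝ (tailSpace x) η : ℝ)) := by
        congr 1
        ext η
        rw [inner_consSpace, phase, symbol, mul_pow, norm_consSpace_sq]
        have e0 : (consSpace ξ η : Space (n + 1)) 0 = ξ := by simp [consSpace]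
        rw [e0, Complex.ofReal_exp]
        have : ∀ a b c k : ℂ, Complex.exp a * (Complex.exp b * (k * Complex.exp c)) =
            k * Complex.exp (a + b + c) := by
          intro a b c k
          rw [Complex.exp_add, Complex.exp_add]; ring
        have this' : ∀ a c k : ℂ, Complex.exp a * k * Complex.exp c =
            k * Complex.exp (a + c) := by
          intro a c k
          rw [Complex.exp_add]; ring
        rw [this, this']
        congr 2
        rw [hb]
        push_cast
        ring
    _ = _ := by
        rw [integral_const_mul, key, partialKernel]
        congr 2
        · rw [finrank_euclideanSpace_fin]
        · congr 1
          have hb0 : (ε - 2 * Real.pi * t * ξ * Complex.I : ℂ) ≠ 0 := by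
            intro h
            rw [hb, h, mul_zero] at hbre
            simp at hbre
          have hpi : (Real.pi : ℂ) ≠ 0 := by exact_mod_cast Real.pi_ne_zero
          rw [hb, mul_pow, Complex.I_sq]
          push_cast
          field_simp

/-- The exponential has modulus at most one because ε - 2πitξ has positive real part; the bound is
the modulus of the prefactor. -/
theorem norm_partialKernel_le {t ε : ℝ} (hε : 0 < ε) (x : Space (n + 1)) (ξ : ℝ) :
    ‖partialKernel n t ε x ξ‖ ≤
      (1 / (4 * Real.pi)) ^ (n / 2 : ℝ) * (ε ^ 2 + (2 * Real.pi * t * ξ) ^ 2) ^ (-(n / 4 : ℝ)) := by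
  set w : ℂ := ε - 2 * Real.pi * t * ξ * Complex.I with hw
  have hwe : w = (ε : ℝ) + (-(2 * Real.pi * t * ξ) : ℝ) * Complex.I := by
    rw [hw]; push_cast; ring
  have hre : w.re = ε := by rw [hwe]; simp
  have him : w.im = -(2 * Real.pi * t * ξ) := by rw [hwe]; simp
  have hns : ‖w‖ = (ε ^ 2 + (2 * Real.pi * t * ξ) ^ 2) ^ (1 / 2 : ℝ) := by
    rw [← Real.sqrt_eq_rpow, Complex.norm_def, Complex.normSq_apply, hre, him]
    congr 1
    ring
  have hs : 0 < ε ^ 2 + (2 * Real.pi * t * ξ) ^ 2 := by positivity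
  rw [partialKernel, norm_mul, ← hw]
  have e1 : ‖Complex.exp (-(‖tailSpace x‖ ^ 2 : ℝ) / (4 * w))‖ ≤ 1 := by
    rw [Complex.norm_exp, Real.exp_le_one_iff, neg_div, Complex.neg_re, neg_nonpos,
      Complex.div_re]
    have : (4 * w).re = 4 * ε := by rw [← hre]; simp
    rw [this, Complex.ofReal_im, Complex.ofReal_re, zero_mul, zero_div, add_zero]
    exact div_nonneg (by positivity) (Complex.normSq_nonneg _)
  have e2 : ((n : ℂ) / 2) = ((n / 2 : ℝ) : ℂ) := by push_cast; rfl
  rw [e2, Complex.norm_cpow_real, norm_div, norm_mul, hns]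
  refine (mul_le_of_le_one_right (by positivity) e1).trans (le_of_eq ?_)
  have e3 : ‖(Real.pi : ℂ)‖ = Real.pi := by
    rw [Complex.norm_real, Real.norm_of_nonneg Real.pi_pos.le]
  have e4 : ‖(((2 * Real.pi : ℝ) : ℂ) ^ 2)‖ = (2 * Real.pi) ^ 2 := by
    rw [norm_pow, Complex.norm_real, Real.norm_of_nonneg (by positivity)]
  rw [e3, e4]
  have e5 : Real.pi / ((2 * Real.pi) ^ 2 * (ε ^ 2 + (2 * Real.pi * t * ξ) ^ 2) ^ (1 / 2 : ℝ)) =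
      1 / (4 * Real.pi) * (ε ^ 2 + (2 * Real.pi * t * ξ) ^ 2) ^ (-(1 / 2) : ℝ) := by
    rw [Real.rpow_neg hs.le]
    field_simp
    norm_num
  rw [e5, Real.mul_rpow (by positivity) (by positivity), ← Real.rpow_mul hs.le]
  congr 2
  ring

end

section

/-! ### The Gaussian cut-off -/

/-- The multiplier `exp (-ε |2πζ|² / 2)`. -/
def gaussMultiplier (d : ℕ) {ε : ℝ} (hε : 0 < ε) : UnitMultiplier d where
  toFun ζ := (Real.exp (-(ε * (2 * Real.pi * ‖ζ‖) ^ 2) / 2) : ℂ)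
  measurable := by fun_prop
  norm_le_one ζ := by
    rw [Complex.norm_real, Real.norm_of_nonneg (Real.exp_pos _).le, Real.exp_le_one_iff]
    have : 0 ≤ ε * (2 * Real.pi * ‖ζ‖) ^ 2 := by positivity
    linarith

theorem integrable_comp_abs {f : ℝ → ℝ} (hf : Measurable f) (h0 : ∀ x, 0 < x → 0 ≤ f x)
    (h00 : 0 ≤ f 0) (hi : IntegrableOn f (Set.Ioi 0)) : Integrable fun x ↦ f |x| := by
  refine ⟨(hf.comp measurable_norm).aestronglyMeasurable, ?_⟩
  rw [hasFiniteIntegral_iff_ofReal (Filter.Eventually.of_forall fun x ↦ ?_),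
    lintegral_comp_abs_eq (fun x ↦ ENNReal.ofReal (f x))]
  · refine ENNReal.mul_lt_top (by simp) ?_
    have := hi.2
    rwa [hasFiniteIntegral_iff_ofReal] at this
    filter_upwards [ae_restrict_mem measurableSet_Ioi] with x hx
    exact h0 x hx
  · rcases (abs_nonneg x).eq_or_lt with h | h
    · change 0 ≤ f |x|
      rw [← h]; exact h00
    · exact h0 _ h

variable {n : ℕ}

theorem gauss_symbol_consSpace {ε : ℝ} (hε : 0 < ε) (t : ℝ) (ξ : ℝ) (η : Space n) :
    ((phaseMultiplier t).comp ((gaussMultiplier (n + 1) hε).comp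
      (gaussMultiplier (n + 1) hε).conj)).toFun (consSpace ξ η) = phase t (consSpace ξ η) *
      ((Real.exp (-(ε * (2 * Real.pi * ξ) ^ 2)) : ℝ) *
        (Real.exp (-(ε * (2 * Real.pi * ‖η‖) ^ 2)) : ℂ)) := by
  simp only [UnitMultiplier.comp, UnitMultiplier.conj, phaseMultiplier, gaussMultiplier]
  rw [Complex.conj_ofReal, ← Complex.ofReal_mul, ← Complex.ofReal_mul, ← Real.exp_add,
    ← Real.exp_add, mul_pow, norm_consSpace_sq]
  congr 3
  ring

theorem integrable_gauss_one {ε : ℝ} (hε : 0 < ε) :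
    Integrable fun ξ : ℝ ↦ Real.exp (-(ε * (2 * Real.pi * ξ) ^ 2)) := by
  have := integrable_exp_neg_mul_sq (b := ε * (2 * Real.pi) ^ 2) (by positivity)
  refine this.congr (Filter.Eventually.of_forall fun ξ ↦ ?_)
  simp only
  congr 1
  ring

theorem integrable_gauss_symbol {ε : ℝ} (hε : 0 < ε) (t : ℝ) :
    Integrable ((phaseMultiplier t).comp ((gaussMultiplier (n + 1) hε).comp
      (gaussMultiplier (n + 1) hε).conj)).toFun := by
  rw [← integrable_consSpace_iff]
  refine (integrable_phase_gaussian (n := n) (integrable_gauss_one hε) hε t).congr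
    (Filter.Eventually.of_forall fun z ↦ ?_)
  exact (gauss_symbol_consSpace hε t z.1 z.2).symm

/-- Absolute values are taken in ξ, so no oscillation in the first variable is used. This suffices
except on the edge a + b = 1/2 in dimension three. -/
theorem norm_gauss_kernel_le {ε : ℝ} (hε : 0 < ε) (t : ℝ) (x : Space (n + 1))
    {k : ℝ → ℝ} (hk : Integrable k)
    (hle : ∀ᵐ ξ : ℝ, Real.exp (-(ε * (2 * Real.pi * ξ) ^ 2)) *
      (ε ^ 2 + (2 * Real.pi * t * ξ) ^ 2) ^ (-(n / 4 : ℝ)) ≤ k ξ) :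
    ‖𝓕⁻ ((phaseMultiplier t).comp ((gaussMultiplier (n + 1) hε).comp
      (gaussMultiplier (n + 1) hε).conj)).toFun x‖ ≤
      (1 / (4 * Real.pi)) ^ (n / 2 : ℝ) * ∫ ξ, k ξ := by
  rw [fourierInv_phase_gaussian (integrable_gauss_one hε) hε t (gauss_symbol_consSpace hε t),
    ← integral_const_mul]
  refine norm_integral_le_of_norm_le (hk.const_mul _) ?_
  filter_upwards [hle] with ξ hξ
  rw [norm_mul, norm_mul, Complex.norm_exp_ofReal_mul_I, one_mul, Complex.norm_real,
    Real.norm_of_nonneg (Real.exp_pos _).le]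
  calc _ ≤ Real.exp (-(ε * (2 * Real.pi * ξ) ^ 2)) * ((1 / (4 * Real.pi)) ^ (n / 2 : ℝ) *
        (ε ^ 2 + (2 * Real.pi * t * ξ) ^ 2) ^ (-(n / 4 : ℝ))) := by
        gcongr
        exact norm_partialKernel_le hε x ξ
    _ = (1 / (4 * Real.pi)) ^ (n / 2 : ℝ) * (Real.exp (-(ε * (2 * Real.pi * ξ) ^ 2)) *
        (ε ^ 2 + (2 * Real.pi * t * ξ) ^ 2) ^ (-(n / 4 : ℝ))) := by ring
    _ ≤ _ := by gcongr

/-- Part of the decay of the prefactor is traded for |tξ|^(-σ), which is integrable at ξ = 0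
precisely because σ < 1; the Gaussian gives integrability at infinity. The power of ε comes from the
rest of the prefactor and from the rescaling of ξ. -/
theorem exists_gauss_kernel_bound_of_lt (hn : 2 ≤ n) {σ : ℝ} (hσ0 : 0 ≤ σ) (hσ : σ < 1) :
    ∃ K > 0, ∀ {ε : ℝ} (hε : 0 < ε) (t : ℝ), t ≠ 0 → ∀ x : Space (n + 1),
      ‖𝓕⁻ ((phaseMultiplier t).comp ((gaussMultiplier (n + 1) hε).comp
        (gaussMultiplier (n + 1) hε).conj)).toFun x‖ ≤
      K * ε ^ (-((n + 1 : ℝ) / 2 - 3 * σ / 2)) * |t| ^ (-σ) := by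
  have hn' : (2 : ℝ) ≤ n := by exact_mod_cast hn
  set f : ℝ → ℝ := fun v ↦ v ^ (-σ) * Real.exp (-((2 * Real.pi) ^ 2) * v ^ 2) with hf
  have hfi : Integrable fun v ↦ f |v| := by
    refine integrable_comp_abs (by fun_prop) (fun x hx ↦ by positivity) (by positivity) ?_
    exact integrableOn_rpow_mul_exp_neg_mul_sq (by positivity) (by linarith)
  have hf0 : 0 ≤ ∫ v, f |v| := integral_nonneg fun v ↦ by positivity
  refine ⟨(1 / (4 * Real.pi)) ^ (n / 2 : ℝ) * (2 * Real.pi) ^ (-σ) * ((∫ v, f |v|) + 1),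
    by positivity, fun {ε} hε t ht x ↦ ?_⟩
  have ht' : 0 < |t| := abs_pos.2 ht
  have hsq : 0 < ε ^ (1 / 2 : ℝ) := by positivity
  set k : ℝ → ℝ := fun ξ ↦ ε ^ (-(n / 2 - σ) + σ / 2 : ℝ) * (2 * Real.pi * |t|) ^ (-σ) *
    f |ε ^ (1 / 2 : ℝ) * ξ| with hk
  have hki : Integrable k := (hfi.comp_mul_left' hsq.ne').const_mul _
  refine (norm_gauss_kernel_le hε t x hki ?_).trans ?_
  · filter_upwards [Measure.ae_ne volume (0 : ℝ)] with ξ hξ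
    have hξ' : 0 < |ξ| := abs_pos.2 hξ
    have hs : 0 < 2 * Real.pi * |t| * |ξ| := by positivity
    have hsq' : (2 * Real.pi * t * ξ) ^ 2 = (2 * Real.pi * |t| * |ξ|) ^ 2 := by
      simp only [mul_pow, sq_abs]
    rw [hsq']
    set w := 2 * Real.pi * |t| * |ξ| with hw
    have hsum : 0 < ε ^ 2 + w ^ 2 := by positivity
    -- The exponent -n/4 is divided into -(n/4 - σ/2), spent on ε², and -σ/2, spent on w². The first
    -- is nonpositive since n ≥ 2 and σ < 1.
    have e1 : (ε ^ 2 + w ^ 2) ^ (-(n / 4 : ℝ)) ≤ ε ^ (-(n / 2 - σ) : ℝ) * w ^ (-σ) := by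
      have : (-(n / 4 : ℝ)) = -(n / 4 - σ / 2) + -(σ / 2) := by ring
      rw [this, Real.rpow_add hsum]
      have a1 : ε ^ (-(n / 2 - σ) : ℝ) = (ε ^ 2) ^ (-(n / 4 - σ / 2) : ℝ) := by
        rw [← Real.rpow_natCast, ← Real.rpow_mul hε.le]; congr 1; push_cast; ring
      have a2 : w ^ (-σ) = (w ^ 2) ^ (-(σ / 2)) := by
        rw [← Real.rpow_natCast, ← Real.rpow_mul hs.le]; congr 1; push_cast; ring
      rw [a1, a2]
      gcongr ?_ * ?_
      · exact Real.rpow_le_rpow_of_nonpos (by positivity) (by nlinarith [sq_nonneg w]) (by linarith)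
      · exact Real.rpow_le_rpow_of_nonpos (by positivity) (by nlinarith [sq_nonneg ε]) (by linarith)
    refine (mul_le_mul_of_nonneg_left e1 (Real.exp_pos _).le).trans (le_of_eq ?_)
    simp only [hk, hf]
    have e2 : Real.exp (-(ε * (2 * Real.pi * ξ) ^ 2)) =
        Real.exp (-((2 * Real.pi) ^ 2) * |ε ^ (1 / 2 : ℝ) * ξ| ^ 2) := by
      congr 1
      have : (ε ^ (1 / 2 : ℝ)) ^ 2 = ε := by
        rw [← Real.rpow_natCast, ← Real.rpow_mul hε.le]
        norm_num
      rw [sq_abs, mul_pow (ε ^ (1 / 2 : ℝ)), this]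
      ring
    rw [e2, abs_mul, abs_of_pos hsq, hw, Real.mul_rpow (by positivity) hξ'.le,
      Real.mul_rpow hsq.le hξ'.le, ← Real.rpow_mul hε.le]
    have e3 : ε ^ (-(n / 2 - σ) + σ / 2 : ℝ) * ε ^ (1 / 2 * -σ) = ε ^ (-(n / 2 - σ) : ℝ) := by
      rw [← Real.rpow_add hε]; congr 1; ring
    rw [← e3]
    ring
  · rw [hk, integral_const_mul,
      Measure.integral_comp_mul_left (fun v ↦ f |v|) (ε ^ (1 / 2 : ℝ)), smul_eq_mul,
      abs_of_pos (inv_pos.2 hsq), ← Real.rpow_neg hε.le, Real.mul_rpow (by positivity) ht'.le]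
    have e4 : ε ^ (-((n + 1 : ℝ) / 2 - 3 * σ / 2)) =
        ε ^ (-(n / 2 - σ) + σ / 2 : ℝ) * ε ^ (-(1 / 2) : ℝ) := by
      rw [← Real.rpow_add hε]; congr 1; ring
    rw [e4]
    have : (∫ v, f |v|) ≤ (∫ v, f |v|) + 1 := by linarith
    calc _ = (1 / (4 * Real.pi)) ^ (n / 2 : ℝ) * (2 * Real.pi) ^ (-σ) * (∫ v, f |v|) *
        (ε ^ (-(n / 2 - σ) + σ / 2 : ℝ) * ε ^ (-(1 / 2) : ℝ)) * |t| ^ (-σ) := by ring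
      _ ≤ _ := by gcongr

/-- For n ≥ 3 the prefactor (1 + v²)^(-n/4) is itself integrable on the line, so the Gaussian in ξ
is discarded, and rescaling v = 2πtξ/ε produces 1/|t|. For n = 2 this integral diverges
logarithmically. -/
theorem exists_gauss_kernel_bound_one (hn : 3 ≤ n) :
    ∃ K > 0, ∀ {ε : ℝ} (hε : 0 < ε) (t : ℝ), t ≠ 0 → ∀ x : Space (n + 1),
      ‖𝓕⁻ ((phaseMultiplier t).comp ((gaussMultiplier (n + 1) hε).comp
        (gaussMultiplier (n + 1) hε).conj)).toFun x‖ ≤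
      K * ε ^ (-((n + 1 : ℝ) / 2 - 3 * 1 / 2)) * |t| ^ (-1 : ℝ) := by
  have hn' : (3 : ℝ) ≤ n := by exact_mod_cast hn
  set f : ℝ → ℝ := fun v ↦ (1 + v ^ 2) ^ (-(n / 4 : ℝ)) with hf
  have hfi : Integrable f := by
    have := integrable_rpow_neg_one_add_norm_sq (E := ℝ) (μ := volume) (r := n / 2)
      (by rw [Module.finrank_self]; push_cast; linarith)
    refine this.congr (Filter.Eventually.of_forall fun v ↦ ?_)
    simp only [hf, Real.norm_eq_abs, sq_abs]
    congr 1
    ring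
  have hf0 : 0 ≤ ∫ v, f v := integral_nonneg fun v ↦ by positivity
  refine ⟨(1 / (4 * Real.pi)) ^ (n / 2 : ℝ) * (2 * Real.pi)⁻¹ * ((∫ v, f v) + 1),
    by positivity, fun {ε} hε t ht x ↦ ?_⟩
  have ht' : 0 < |t| := abs_pos.2 ht
  set k : ℝ → ℝ := fun ξ ↦ ε ^ (-(n / 2) : ℝ) * f (2 * Real.pi * t / ε * ξ) with hk
  have hne : 2 * Real.pi * t / ε ≠ 0 := by
    have := Real.pi_pos
    positivity
  have hki : Integrable k := (hfi.comp_mul_left' hne).const_mul _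
  refine (norm_gauss_kernel_le hε t x hki (Filter.Eventually.of_forall fun ξ ↦ ?_)).trans ?_
  · have h1 : Real.exp (-(ε * (2 * Real.pi * ξ) ^ 2)) ≤ 1 := by
      rw [Real.exp_le_one_iff, neg_nonpos]; positivity
    refine (mul_le_of_le_one_left (by positivity) h1).trans (le_of_eq ?_)
    simp only [hk, hf]
    have e1 : ε ^ 2 + (2 * Real.pi * t * ξ) ^ 2 =
        ε ^ 2 * (1 + (2 * Real.pi * t / ε * ξ) ^ 2) := by field_simp
    rw [e1, Real.mul_rpow (by positivity) (by positivity), ← Real.rpow_natCast ε 2,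
      ← Real.rpow_mul hε.le]
    congr 2
    push_cast
    ring
  · rw [hk, integral_const_mul, Measure.integral_comp_mul_left f, smul_eq_mul]
    have e4 : ε ^ (-((n + 1 : ℝ) / 2 - 3 * 1 / 2)) = ε ^ (-(n / 2) : ℝ) * ε := by
      rw [← Real.rpow_add_one hε.ne']; congr 1; ring
    have e5 : |(2 * Real.pi * t / ε)⁻¹| = (2 * Real.pi)⁻¹ * ε * |t| ^ (-1 : ℝ) := by
      rw [abs_inv, abs_div, abs_mul, abs_of_pos hε, abs_of_pos (by positivity : 0 < 2 * Real.pi),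
        Real.rpow_neg_one]
      field_simp
    rw [e4, e5]
    have : (∫ v, f v) ≤ (∫ v, f v) + 1 := by linarith
    calc _ = (1 / (4 * Real.pi)) ^ (n / 2 : ℝ) * (2 * Real.pi)⁻¹ * (∫ v, f v) *
        (ε ^ (-(n / 2) : ℝ) * ε) * |t| ^ (-1 : ℝ) := by ring
      _ ≤ _ := by gcongr

end

/-! ### Frequency-localized estimates -/

/-- Cauchy--Schwarz on the ball of radius l/(2π), whose volume is a multiple of l^d. -/
theorem exists_integral_norm_le (d : ℕ) [NeZero d] : ∃ C > 0, ∀ l > 0, ∀ g : L2 d,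
    (∀ᵐ ζ, l < 2 * Real.pi * ‖ζ‖ → g ζ = 0) →
      Integrable g ∧ ∫ ζ, ‖g ζ‖ ≤ C * l ^ (d / 2 : ℝ) * ‖g‖ := by
  set V := (volume (Metric.ball (0 : Space d) 1)).toReal with hV
  -- The summand 1 only makes the constant visibly positive.
  refine ⟨((1 / (2 * Real.pi)) ^ d * V) ^ (1 / 2 : ℝ) + 1, by positivity, fun l hl g hg ↦ ?_⟩
  set S : Set (Space d) := Metric.closedBall 0 (l / (2 * Real.pi)) with hS
  have hSm : MeasurableSet S := measurableSet_closedBall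
  have hg' : ∀ᵐ ζ, ζ ∉ S → g ζ = 0 := by
    filter_upwards [hg] with ζ h hζ
    apply h
    rw [hS, mem_closedBall_zero_iff, not_le, div_lt_iff₀ (by positivity)] at hζ
    linarith
  have hvol : volume S = ENNReal.ofReal (l ^ d * ((1 / (2 * Real.pi)) ^ d * V)) := by
    rw [hS, Measure.addHaar_closedBall _ _ (by positivity), finrank_euclideanSpace_fin,
      ← ENNReal.ofReal_toReal (measure_ball_lt_top (x := (0 : Space d)) (r := 1)).ne,
      ← ENNReal.ofReal_mul (by positivity), ← hV]
    congr 1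
    ring
  have hle : eLpNorm g 1 volume ≤
      ENNReal.ofReal (((1 / (2 * Real.pi)) ^ d * V) ^ (1 / 2 : ℝ) * l ^ (d / 2 : ℝ) * ‖g‖) := by
    have e1 : eLpNorm g 1 volume = eLpNorm g 1 (volume.restrict S) := by
      rw [← eLpNorm_indicator_eq_eLpNorm_restrict hSm]
      apply eLpNorm_congr_ae
      filter_upwards [hg'] with ζ h
      by_cases hζ : ζ ∈ S
      · rw [Set.indicator_of_mem hζ]
      · rw [Set.indicator_of_notMem hζ, h hζ]
    rw [e1]
    refine (eLpNorm_le_eLpNorm_mul_rpow_measure_univ (p := 1) (q := 2) (by norm_num)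
      (Lp.aestronglyMeasurable g).restrict).trans ?_
    rw [Measure.restrict_apply_univ, hvol]
    have e2 : eLpNorm g 2 (volume.restrict S) ≤ ENNReal.ofReal ‖g‖ := by
      refine (eLpNorm_mono_measure _ Measure.restrict_le_self).trans_eq ?_
      rw [ofReal_norm, Lp.enorm_def]
    refine (mul_le_mul_left e2 _).trans (le_of_eq ?_)
    rw [ENNReal.ofReal_rpow_of_nonneg (by positivity) (by norm_num),
      ← ENNReal.ofReal_mul (norm_nonneg _)]
    congr 1
    have : (1 / (1 : ℝ≥0∞).toReal - 1 / (2 : ℝ≥0∞).toReal) = (1 / 2 : ℝ) := by norm_num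
    rw [this, Real.mul_rpow (by positivity) (by positivity), ← Real.rpow_natCast l d,
      ← Real.rpow_mul hl.le]
    ring_nf
  have hi : Integrable g := by
    rw [← memLp_one_iff_integrable]
    exact ⟨Lp.aestronglyMeasurable g, hle.trans_lt ENNReal.ofReal_lt_top⟩
  refine ⟨hi, ?_⟩
  rw [eLpNorm_one_eq_lintegral_enorm, ← ofReal_integral_norm_eq_lintegral_enorm hi,
    ENNReal.ofReal_le_ofReal_iff (by positivity)] at hle
  refine hle.trans ?_
  gcongr
  linarith

theorem norm_flow_le_integral {d : ℕ} [NeZero d] (g : L2 d) (hg : Integrable g) (t : ℝ) :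
    ∀ᵐ x, ‖(𝓕⁻ ((phaseMultiplier t).act g) : L2 d) x‖ ≤ ∫ ζ, ‖g ζ‖ := by
  have hn : (fun ζ ↦ ‖(phaseMultiplier t).act g ζ‖) =ᵐ[volume] fun ζ ↦ ‖g ζ‖ := by
    filter_upwards [(phaseMultiplier t).coeFn_act g] with ζ h
    rw [h, norm_mul]
    simp [phaseMultiplier, norm_phase]
  have hi : Integrable ((phaseMultiplier t).act g) :=
    (integrable_norm_iff (Lp.aestronglyMeasurable _)).1 (hg.norm.congr hn.symm)
  filter_upwards [fourierInv_ae_eq _ hi] with x hx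
  rw [hx, ← integral_congr_ae hn, Real.fourierInv_eq']
  refine (norm_integral_le_integral_norm _).trans_eq ?_
  congr 1
  ext ζ
  rw [norm_smul, Complex.norm_exp_ofReal_mul_I, one_mul]

/-- The inverse of `gaussMultiplier` on the ball `ε |2πζ|² ≤ 1`, normalized. -/
def gaussInverse (d : ℕ) (ε : ℝ) : UnitMultiplier d where
  toFun ζ := ((Set.Iic (1 : ℝ)).indicator (fun a ↦ Real.exp (a / 2 - 1 / 2))
    (ε * (2 * Real.pi * ‖ζ‖) ^ 2) : ℝ)
  measurable := by
    have : Measurable ((Set.Iic (1 : ℝ)).indicator (fun a ↦ Real.exp (a / 2 - 1 / 2))) :=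
      Measurable.indicator (by fun_prop) measurableSet_Iic
    fun_prop
  norm_le_one ζ := by
    rw [Complex.norm_real]
    by_cases h : ε * (2 * Real.pi * ‖ζ‖) ^ 2 ∈ Set.Iic (1 : ℝ)
    · rw [Set.indicator_of_mem h, Real.norm_of_nonneg (Real.exp_pos _).le, Real.exp_le_one_iff]
      have : ε * (2 * Real.pi * ‖ζ‖) ^ 2 ≤ 1 := h
      linarith
    · rw [Set.indicator_of_notMem h, norm_zero]
      exact zero_le_one

/-- A function supported where the Gaussian is bounded below is the Gaussian times another L²
function of comparable norm. The factor exp(-1/2) is what keeps the inverse bounded by one. -/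
theorem gauss_act_inverse {d : ℕ} {ε : ℝ} (hε : 0 < ε) (g : L2 d)
    (hg : ∀ᵐ ζ, 1 < ε * (2 * Real.pi * ‖ζ‖) ^ 2 → g ζ = 0) :
    (gaussMultiplier d hε).act ((gaussInverse d ε).act g) = (Real.exp (-(1 / 2)) : ℂ) • g := by
  apply Lp.ext
  filter_upwards [hg, (gaussMultiplier d hε).coeFn_act ((gaussInverse d ε).act g),
    (gaussInverse d ε).coeFn_act g, Lp.coeFn_smul (Real.exp (-(1 / 2)) : ℂ) g] with ζ h h1 h2 h3
  rw [h1, h2, h3, Pi.smul_apply, smul_eq_mul]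
  by_cases hζ : ε * (2 * Real.pi * ‖ζ‖) ^ 2 ∈ Set.Iic (1 : ℝ)
  · simp only [gaussMultiplier, gaussInverse]
    rw [Set.indicator_of_mem hζ, ← mul_assoc, ← Complex.ofReal_mul, ← Real.exp_add]
    congr 3
    ring
  · rw [h (not_le.1 hζ), mul_zero, mul_zero, mul_zero]

theorem act_smul {d : ℕ} (m : UnitMultiplier d) (c : ℂ) (g : L2 d) :
    m.act (c • g) = c • m.act g := by
  apply Lp.ext
  filter_upwards [m.coeFn_act (c • g), m.coeFn_act g, Lp.coeFn_smul c g,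
    Lp.coeFn_smul c (m.act g)] with ζ h1 h2 h3 h4
  rw [h1, h3, h4, Pi.smul_apply, Pi.smul_apply, h2, smul_eq_mul, smul_eq_mul]
  ring

/-- The Gaussian cut-off at scale ε = l^(-2) is comparable to one on the support of `g`, so it can
be inserted at the cost of a constant. The power of ε in the kernel bound, raised to 1/2 - 1/q,
becomes the stated power of `l`. The hypothesis `hqr` says σ < 1, or σ = 1 with n ≥ 3. -/
theorem exists_localized_strichartz {n : ℕ} (hn : 2 ≤ n) {q r : ℝ} (hq : 2 < q) (hr : 2 < r)
    (hqr : 2 * q / (r * (q - 2)) < 1 ∨ 2 * q / (r * (q - 2)) = 1 ∧ 3 ≤ n) :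
    ∃ C > 0, ∀ l > 0, ∀ g : L2 (n + 1), (∀ᵐ ζ, l < 2 * Real.pi * ‖ζ‖ → g ζ = 0) →
      strichartzNorm (ENNReal.ofReal r) (ENNReal.ofReal q)
        (fun t ↦ (𝓕⁻ ((phaseMultiplier t).act g) : L2 (n + 1))) ≤
      ENNReal.ofReal (C * l ^ ((n + 1 : ℝ) * (1 / 2 - 1 / q) - 3 / r) * ‖g‖) := by
  have hq2 : 0 < q - 2 := by linarith
  have hrc := rieszConst_pos hr
  obtain ⟨C₁, hC₁, h1⟩ := exists_integral_norm_le (n + 1)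
  set σ := 2 * q / (r * (q - 2)) with hσ
  have hσ0 : 0 ≤ σ := by positivity
  have hker : ∃ K > 0, ∀ {ε : ℝ} (hε : 0 < ε) (t : ℝ), t ≠ 0 → ∀ x : Space (n + 1),
      ‖𝓕⁻ ((phaseMultiplier t).comp ((gaussMultiplier (n + 1) hε).comp
        (gaussMultiplier (n + 1) hε).conj)).toFun x‖ ≤
      K * ε ^ (-((n + 1 : ℝ) / 2 - 3 * σ / 2)) * |t| ^ (-σ) := by
    rcases hqr with h | ⟨h, h3⟩
    · exact exists_gauss_kernel_bound_of_lt hn hσ0 h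
    · rw [h]
      exact exists_gauss_kernel_bound_one h3
  obtain ⟨K, hK, hker⟩ := hker
  set D := ((4 * q / (q - 2) * 2 ^ (q - 2)) ^ (1 / q) * rieszConst r) ^ (1 / 2 : ℝ) with hD
  have hD0 : 0 < D := by positivity
  refine ⟨D * K ^ ((1 / 2 - 1 / q : ℝ)) * Real.exp (1 / 2), by positivity, fun l hl g hg ↦ ?_⟩
  have hε : 0 < l ^ (-2 : ℝ) := by positivity
  have hg' : ∀ᵐ ζ, 1 < l ^ (-2 : ℝ) * (2 * Real.pi * ‖ζ‖) ^ 2 → g ζ = 0 := by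
    filter_upwards [hg] with ζ h hζ
    apply h
    rw [Real.rpow_neg hl.le, Real.rpow_two, inv_mul_eq_div, one_lt_div (by positivity)] at hζ
    exact lt_of_pow_lt_pow_left₀ 2 (by positivity) hζ
  set G := gaussMultiplier (n + 1) hε with hG
  set g' : L2 (n + 1) := (Real.exp (1 / 2) : ℂ) • (gaussInverse (n + 1) (l ^ (-2 : ℝ))).act g
    with hg'def
  have hGg : G.act g' = g := by
    rw [hg'def, act_smul, hG, gauss_act_inverse hε g hg', smul_smul, ← Complex.ofReal_mul,
      ← Real.exp_add]
    simp
  have hgn : ‖g'‖ ≤ Real.exp (1 / 2) * ‖g‖ := by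
    rw [hg'def, norm_smul, Complex.norm_real, Real.norm_of_nonneg (Real.exp_pos _).le]
    gcongr
    exact UnitMultiplier.norm_act_le _ _
  have := strichartz_of_kernel hq hr (K := K * (l ^ (-2 : ℝ)) ^ (-((n + 1 : ℝ) / 2 - 3 * σ / 2)))
    (by positivity) G (fun t ht h hh ↦
      UnitMultiplier.norm_op_le_of_kernel _ (integrable_gauss_symbol hε t) (hker hε t ht) h hh) g'
    (B := ∫ ζ, ‖g ζ‖) (by
      rw [hGg]
      exact norm_flow_le_integral g (h1 l hl g hg).1)
  rw [hGg] at this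
  refine this.trans (ENNReal.ofReal_le_ofReal ?_)
  rw [← hD, Real.mul_rpow hK.le (by positivity), ← Real.rpow_mul hl.le, ← Real.rpow_mul hl.le]
  have e1 : -2 * -((n + 1 : ℝ) / 2 - 3 * σ / 2) * (1 / 2 - 1 / q) =
      (n + 1 : ℝ) * (1 / 2 - 1 / q) - 3 / r := by
    rw [hσ]
    field_simp
  rw [e1]
  calc _ ≤ D * (K ^ (1 / 2 - 1 / q : ℝ) * l ^ ((n + 1 : ℝ) * (1 / 2 - 1 / q) - 3 / r)) *
        (Real.exp (1 / 2) * ‖g‖) := by gcongr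
    _ = _ := by ring

/-- At each time |v|^q ≤ B^{q-2} |v|² with `B` the sup bound for localized frequencies, and the flow
does not increase the L² norm. -/
theorem exists_localized_sup {d : ℕ} [NeZero d] {q : ℝ} (hq : 2 < q) :
    ∃ C > 0, ∀ l > 0, ∀ g : L2 d, (∀ᵐ ζ, l < 2 * Real.pi * ‖ζ‖ → g ζ = 0) →
      strichartzNorm ∞ (ENNReal.ofReal q)
        (fun t ↦ (𝓕⁻ ((phaseMultiplier t).act g) : L2 d)) ≤
      ENNReal.ofReal (C * l ^ (d * (1 / 2 - 1 / q) : ℝ) * ‖g‖) := by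
  obtain ⟨C, hC, h1⟩ := exists_integral_norm_le d
  refine ⟨C ^ (1 - 2 / q), by positivity, fun l hl g hg ↦ ?_⟩
  obtain ⟨hi, hile⟩ := h1 l hl g hg
  rw [strichartzNorm, eLpNorm_exponent_top]
  refine eLpNormEssSup_le_of_ae_enorm_bound (Filter.Eventually.of_forall fun t ↦ ?_)
  rw [enorm_eq_self]
  set v : L2 d := 𝓕⁻ ((phaseMultiplier t).act g) with hv
  have hvn : ‖v‖ ≤ ‖g‖ := by
    rw [hv, UnitMultiplier.norm_fourierInv]
    exact UnitMultiplier.norm_act_le _ _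
  set B := C * l ^ (d / 2 : ℝ) * ‖g‖ with hB
  have hB0 : 0 ≤ B := by positivity
  have hvb : ∀ᵐ x, ‖v x‖ ≤ B := by
    filter_upwards [norm_flow_le_integral g hi t] with x hx
    exact hx.trans hile
  rw [lintegral_ofReal_norm_rpow (by linarith)]
  have hint : ∫⁻ x, ENNReal.ofReal (‖v x‖ ^ q) ≤ ENNReal.ofReal (B ^ (q - 2) * ‖g‖ ^ 2) := by
    calc _ ≤ ∫⁻ x, ENNReal.ofReal (B ^ (q - 2) * ‖v x‖ ^ 2) := by
          apply lintegral_mono_ae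
          filter_upwards [hvb] with x hx
          apply ENNReal.ofReal_le_ofReal
          have e : ‖v x‖ ^ q = ‖v x‖ ^ (q - 2) * ‖v x‖ ^ 2 := by
            rw [← Real.rpow_natCast, ← Real.rpow_add' (norm_nonneg _) (by push_cast; linarith)]
            congr 1
            push_cast
            ring
          rw [e]
          have := Real.rpow_le_rpow (norm_nonneg _) hx (by linarith : 0 ≤ q - 2)
          gcongr
      _ = ENNReal.ofReal (B ^ (q - 2) * ‖v‖ ^ 2) := by
          rw [L2.norm_sq_eq, ← integral_const_mul, ofReal_integral_eq_lintegral_ofReal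
            ((L2.integrable_norm_sq v).const_mul _)
            (Filter.Eventually.of_forall fun x ↦ by positivity)]
      _ ≤ _ := by
          apply ENNReal.ofReal_le_ofReal
          gcongr
  refine (ENNReal.rpow_le_rpow hint (by positivity)).trans ?_
  rw [ENNReal.ofReal_rpow_of_nonneg (by positivity) (by positivity)]
  apply ENNReal.ofReal_le_ofReal
  apply le_of_eq
  rcases (norm_nonneg g).eq_or_lt with h0 | h0
  · rw [← h0]
    simp only [ne_eq, OfNat.ofNat_ne_zero, not_false_eq_true, zero_pow, mul_zero]
    exact Real.zero_rpow (by positivity)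
  rw [hB, ← Real.rpow_natCast ‖g‖ 2, Real.mul_rpow (by positivity) h0.le,
    Real.mul_rpow hC.le (by positivity), mul_assoc, mul_assoc, ← Real.rpow_add h0,
    Real.mul_rpow (by positivity) (by positivity), Real.mul_rpow (by positivity) (by positivity),
    ← Real.rpow_mul hC.le, ← Real.rpow_mul hl.le, ← Real.rpow_mul hl.le, ← Real.rpow_mul h0.le,
    mul_assoc]
  have e1 : (q - 2) * (1 / q) = 1 - 2 / q := by field_simp
  have e2 : (d / 2 : ℝ) * (1 - 2 / q) = d * (1 / 2 - 1 / q) := by ring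
  have e3 : (q - 2 + (2 : ℕ)) * (1 / q) = 1 := by push_cast; field_simp; ring
  rw [e1, e2, e3, Real.rpow_one, mul_assoc]

section

/-! ### A bilinear summation argument -/

/-- The exponents of Hölder's inequality `L^{p₁} × L^{p₂} → L^p`, all finite or all infinite. -/
def IsHolder (p p₁ p₂ : ℝ≥0∞) : Prop :=
  (p = ∞ ∧ p₁ = ∞ ∧ p₂ = ∞) ∨ ∃ x y z : ℝ, p = ENNReal.ofReal x ∧ p₁ = ENNReal.ofReal y ∧
    p₂ = ENNReal.ofReal z ∧ 0 < x ∧ 0 < y ∧ 0 < z ∧ 1 / x = 1 / y + 1 / z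

section Holder

variable {α : Type*} [MeasurableSpace α] {μ : Measure α}

theorem eLpNorm_mul_le_of_isHolder {p p₁ p₂ : ℝ≥0∞} (h : IsHolder p p₁ p₂) {a b : α → ℝ≥0∞}
    (ha : AEMeasurable a μ) (hb : AEMeasurable b μ) :
    eLpNorm (fun x ↦ a x * b x) p μ ≤ eLpNorm a p₁ μ * eLpNorm b p₂ μ := by
  rcases h with ⟨rfl, rfl, rfl⟩ | ⟨x, y, z, rfl, rfl, rfl, hx, hy, hz, hxyz⟩
  · simp only [eLpNorm_exponent_top, eLpNormEssSup, enorm_eq_self]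
    exact ENNReal.essSup_mul_le a b
  · rw [eLpNorm_eq_lintegral_rpow_enorm_toReal (ENNReal.ofReal_pos.2 hx).ne' ENNReal.ofReal_ne_top,
      eLpNorm_eq_lintegral_rpow_enorm_toReal (ENNReal.ofReal_pos.2 hy).ne' ENNReal.ofReal_ne_top,
      eLpNorm_eq_lintegral_rpow_enorm_toReal (ENNReal.ofReal_pos.2 hz).ne' ENNReal.ofReal_ne_top,
      ENNReal.toReal_ofReal hx.le, ENNReal.toReal_ofReal hy.le, ENNReal.toReal_ofReal hz.le]
    simp only [enorm_eq_self]
    refine ENNReal.lintegral_Lp_mul_le_Lq_mul_Lr hx ?_ hxyz μ ha hb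
    rw [← one_div_lt_one_div hy hx, hxyz]
    have : 0 < 1 / z := by positivity
    linarith

/-- The square of an L^{2p} norm is the L^p norm of the square; Minkowski (hence p ≥ 1) and Hölder
do the rest. It is used once in space and once in time. The indices min and max let the lower and
the higher frequency be measured in different spaces. -/
theorem eLpNorm_sq_le_sum {p p₁ p₂ : ℝ≥0∞} (hp : 1 ≤ p) (h : IsHolder p p₁ p₂)
    {f : α → ℝ≥0∞} {a b : ℕ → α → ℝ≥0∞} (ha : ∀ i, AEMeasurable (a i) μ)
    (hb : ∀ i, AEMeasurable (b i) μ) (J : ℕ)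
    (hf : ∀ᵐ x ∂μ, f x ^ 2 ≤
      ∑ i ∈ Finset.range J, ∑ k ∈ Finset.range J, a (min i k) x * b (max i k) x) :
    eLpNorm f (p * 2) μ ^ 2 ≤ ∑ i ∈ Finset.range J, ∑ k ∈ Finset.range J,
      eLpNorm (a (min i k)) p₁ μ * eLpNorm (b (max i k)) p₂ μ := by
  have h1 : eLpNorm f (p * 2) μ ^ 2 = eLpNorm (fun x ↦ f x ^ 2) p μ := by
    have := eLpNorm_enorm_rpow (p := p) (μ := μ) f (q := 2) two_pos
    simp only [enorm_eq_self, ENNReal.rpow_ofNat, ENNReal.ofReal_ofNat] at this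
    exact this.symm
  have hm : ∀ i k, AEMeasurable (fun x ↦ a (min i k) x * b (max i k) x) μ :=
    fun i k ↦ (ha _).mul (hb _)
  rw [h1]
  have h2 : eLpNorm (fun x ↦ f x ^ 2) p μ ≤ eLpNorm (∑ i ∈ Finset.range J,
      ∑ k ∈ Finset.range J, fun x ↦ a (min i k) x * b (max i k) x) p μ := by
    apply eLpNorm_mono_enorm_ae
    filter_upwards [hf] with x hx
    simpa [Finset.sum_apply] using hx
  refine h2.trans ((eLpNorm_sum_le (fun i _ ↦ ?_) hp).trans ?_)
  · exact (Finset.aemeasurable_sum _ fun k _ ↦ hm i k).aestronglyMeasurable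
  · refine Finset.sum_le_sum fun i _ ↦ ?_
    refine (eLpNorm_sum_le (fun k _ ↦ (hm i k).aestronglyMeasurable) hp).trans ?_
    exact Finset.sum_le_sum fun k _ ↦ eLpNorm_mul_le_of_isHolder h (ha _) (hb _)

end Holder

/-- On each side of `i` the distances to `i` are distinct, so each side is dominated by a full
geometric series. -/
theorem sum_geometric_dist_le {ρ : ℝ} (h0 : 0 ≤ ρ) (h1 : ρ < 1) (i J : ℕ) :
    ∑ k ∈ Finset.range J, ρ ^ (max i k - min i k) ≤ 2 * (1 - ρ)⁻¹ := by
  have hs := summable_geometric_of_lt_one h0 h1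
  have hle : ∀ (S : Finset ℕ) (e : ℕ → ℕ), Set.InjOn e S → ∑ k ∈ S, ρ ^ e k ≤ (1 - ρ)⁻¹ := by
    intro S e he
    rw [← Finset.sum_image (g := e) (f := fun m ↦ ρ ^ m) he, ← tsum_geometric_of_lt_one h0 h1]
    exact hs.sum_le_tsum _ fun m _ ↦ by positivity
  rw [← Finset.sum_filter_add_sum_filter_not _ (fun k ↦ k ≤ i), two_mul]
  refine add_le_add (hle _ _ ?_) (hle _ _ ?_)
  · intro k hk l hl hkl
    simp only [Finset.coe_filter, Finset.mem_range, Set.mem_ofPred_eq] at hk hl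
    simp only at hkl
    omega
  · intro k hk l hl hkl
    simp only [Finset.coe_filter, Finset.mem_range, Set.mem_ofPred_eq] at hk hl
    simp only at hkl
    omega

/-- Schur's test for a symmetric kernel: c i c k is at most the mean of the two squares, and the row
sums are bounded. -/
theorem sum_sum_geometric_le {ρ : ℝ} (h0 : 0 ≤ ρ) (h1 : ρ < 1) (c : ℕ → ℝ) (J : ℕ) :
    ∑ i ∈ Finset.range J, ∑ k ∈ Finset.range J, ρ ^ (max i k - min i k) * (c i * c k) ≤
      2 * (1 - ρ)⁻¹ * ∑ i ∈ Finset.range J, c i ^ 2 := by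
  have hpt : ∀ i k, ρ ^ (max i k - min i k) * (c i * c k) ≤
      (ρ ^ (max i k - min i k) * c i ^ 2 + ρ ^ (max k i - min k i) * c k ^ 2) / 2 := by
    intro i k
    rw [max_comm k i, min_comm k i]
    have : 0 ≤ ρ ^ (max i k - min i k) := by positivity
    nlinarith [mul_nonneg this (sq_nonneg (c i - c k))]
  have hone : ∑ i ∈ Finset.range J, ∑ k ∈ Finset.range J, ρ ^ (max i k - min i k) * c i ^ 2 ≤
      2 * (1 - ρ)⁻¹ * ∑ i ∈ Finset.range J, c i ^ 2 := by
    rw [Finset.mul_sum]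
    refine Finset.sum_le_sum fun i _ ↦ ?_
    rw [← Finset.sum_mul]
    exact mul_le_mul_of_nonneg_right (sum_geometric_dist_le h0 h1 i J) (sq_nonneg _)
  calc _ ≤ ∑ i ∈ Finset.range J, ∑ k ∈ Finset.range J,
        (ρ ^ (max i k - min i k) * c i ^ 2 + ρ ^ (max k i - min k i) * c k ^ 2) / 2 :=
        Finset.sum_le_sum fun i _ ↦ Finset.sum_le_sum fun k _ ↦ hpt i k
    _ = ((∑ i ∈ Finset.range J, ∑ k ∈ Finset.range J, ρ ^ (max i k - min i k) * c i ^ 2) +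
        ∑ i ∈ Finset.range J, ∑ k ∈ Finset.range J, ρ ^ (max i k - min i k) * c i ^ 2) / 2 := by
        simp_rw [← Finset.sum_div, Finset.sum_add_distrib]
        congr 2
        exact Finset.sum_comm
    _ ≤ _ := by linarith

/-! ### Frequency cut-offs -/

/-- The indicator function of a set as a multiplier. -/
def indicatorMultiplier {d : ℕ} {S : Set (Space d)} (hS : MeasurableSet S) : UnitMultiplier d where
  toFun := S.indicator 1
  measurable := measurable_one.indicator hS
  norm_le_one ζ := by
    by_cases h : ζ ∈ S
    · simp [Set.indicator_of_mem h]
    · simp [Set.indicator_of_notMem h]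

theorem indicator_act_ae {d : ℕ} {S : Set (Space d)} (hS : MeasurableSet S) (g : L2 d) :
    (indicatorMultiplier hS).act g =ᵐ[volume] S.indicator g := by
  filter_upwards [(indicatorMultiplier hS).coeFn_act g] with ζ h
  rw [h]
  by_cases hζ : ζ ∈ S <;> simp [indicatorMultiplier, hζ]

/-- The dyadic partition of `[0, ∞)` into `[0, 1]` and the intervals `(2 ^ j, 2 ^ (j + 1)]`. -/
def dyadicInterval : ℕ → Set ℝ
  | 0 => Set.Iic 1
  | j + 1 => Set.Ioc (2 ^ j) (2 ^ (j + 1))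

theorem measurableSet_dyadicInterval (j : ℕ) : MeasurableSet (dyadicInterval j) := by
  cases j
  · exact measurableSet_Iic
  · exact measurableSet_Ioc

theorem sum_indicator_dyadicInterval (J : ℕ) (a : ℝ) (c : ℂ) :
    ∑ j ∈ Finset.range (J + 1), (dyadicInterval j).indicator (fun _ ↦ c) a =
      (Set.Iic ((2 : ℝ) ^ J)).indicator (fun _ ↦ c) a := by
  induction J with
  | zero => simp [dyadicInterval]
  | succ J ih =>
    rw [Finset.sum_range_succ, ih, dyadicInterval, ← Set.Iic_union_Ioc_eq_Iic
      (pow_le_pow_right₀ one_le_two (Nat.le_succ J) : (2 : ℝ) ^ J ≤ 2 ^ (J + 1)),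
      Set.indicator_union_of_disjoint]
    rw [Set.disjoint_left]
    intro x hx hx'
    exact absurd hx (not_le.2 hx'.1)

section

variable {d : ℕ}

/-- The shell of frequencies `ζ` with `|2πζ|` in the dyadic interval of index `j`. -/
def shell (d j : ℕ) : Set (Space d) := {ζ | 2 * Real.pi * ‖ζ‖ ∈ dyadicInterval j}

theorem measurableSet_shell (d j : ℕ) : MeasurableSet (shell d j) :=
  (by fun_prop : Measurable fun ζ : Space d ↦ 2 * Real.pi * ‖ζ‖) (measurableSet_dyadicInterval j)

/-- The ball of frequencies `ζ` with `|2πζ| ≤ 2 ^ J`. -/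
def freqBall (d J : ℕ) : Set (Space d) := {ζ | 2 * Real.pi * ‖ζ‖ ≤ 2 ^ J}

theorem measurableSet_freqBall (d J : ℕ) : MeasurableSet (freqBall d J) :=
  measurableSet_le (by fun_prop) measurable_const

theorem sum_shell_act (g : L2 d) (J : ℕ) :
    ∑ j ∈ Finset.range (J + 1), (indicatorMultiplier (measurableSet_shell d j)).act g =
      (indicatorMultiplier (measurableSet_freqBall d J)).act g := by
  apply Lp.ext
  have h1 : ∀ᵐ ζ, ∀ j, (indicatorMultiplier (measurableSet_shell d j)).act g ζ =
      (shell d j).indicator g ζ :=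
    ae_all_iff.2 fun j ↦ indicator_act_ae (measurableSet_shell d j) g
  filter_upwards [Lp.coeFn_finsetSum (Finset.range (J + 1))
    (fun j ↦ (indicatorMultiplier (measurableSet_shell d j)).act g), h1,
    indicator_act_ae (measurableSet_freqBall d J) g] with ζ h0 h1 h2
  rw [h0, h2, Finset.sum_apply]
  simp only [h1]
  exact sum_indicator_dyadicInterval J (2 * Real.pi * ‖ζ‖) (g ζ)

theorem two_pow_le_of_mem_dyadicInterval {j : ℕ} {a : ℝ} (ha : 0 ≤ a)
    (h : a ∈ dyadicInterval j) : ((2 : ℝ) ^ j) ^ 2 ≤ 4 * (1 + a ^ 2) := by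
  cases j with
  | zero => norm_num; nlinarith
  | succ j =>
    have : (2 : ℝ) ^ j < a := h.1
    have h2 : (0 : ℝ) < 2 ^ j := by positivity
    have e : (2 : ℝ) ^ (j + 1) = 2 * 2 ^ j := by ring
    rw [e]
    nlinarith

/-- On the shell of index j the Sobolev weight is at least 2^{js}/2^s, and the shells are disjoint.
-/
theorem sum_shell_norm_sq_le {s S : ℝ} (hs : 0 ≤ s) (u : L2 d)
    (hS : sobolevNorm s u = ENNReal.ofReal S) (hS0 : 0 ≤ S) (J : ℕ) :
    ∑ j ∈ Finset.range (J + 1),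
      (((2 : ℝ) ^ j) ^ s * ‖(indicatorMultiplier (measurableSet_shell d j)).act (𝓕 u)‖) ^ 2 ≤
      (2 ^ s * S) ^ 2 := by
  set g : L2 d := 𝓕 u with hg
  set w : Space d → ℝ := fun ζ ↦ (1 + (2 * Real.pi * ‖ζ‖) ^ 2) ^ (s / 2) with hw
  have hwm : Measurable w := by fun_prop
  have hmem : MemLp (fun ζ ↦ (w ζ : ℂ) * g ζ) 2 (volume : Measure (Space d)) := by
    refine ⟨(Complex.measurable_ofReal.comp hwm).aestronglyMeasurable.mul
      (Lp.aestronglyMeasurable g), ?_⟩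
    change sobolevNorm s u < ∞
    rw [hS]
    exact ENNReal.ofReal_lt_top
  set h : L2 d := hmem.toLp _ with hh
  have hhn : ‖h‖ = S := by
    rw [hh, Lp.norm_toLp]
    change (sobolevNorm s u).toReal = S
    rw [hS, ENNReal.toReal_ofReal hS0]
  have hterm : ∀ j, ((2 : ℝ) ^ j) ^ s *
      ‖(indicatorMultiplier (measurableSet_shell d j)).act g‖ ≤
      2 ^ s * ‖(indicatorMultiplier (measurableSet_shell d j)).act h‖ := by
    intro j
    have e1 : ‖((((2 : ℝ) ^ j) ^ s : ℝ) : ℂ) •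
        (indicatorMultiplier (measurableSet_shell d j)).act g‖ ≤
        ‖(((2 : ℝ) ^ s : ℝ) : ℂ) • (indicatorMultiplier (measurableSet_shell d j)).act h‖ := by
      apply Lp.norm_le_norm_of_ae_le
      filter_upwards [indicator_act_ae (measurableSet_shell d j) g,
        indicator_act_ae (measurableSet_shell d j) h, hmem.coeFn_toLp,
        Lp.coeFn_smul ((((2 : ℝ) ^ j) ^ s : ℝ) : ℂ)
          ((indicatorMultiplier (measurableSet_shell d j)).act g),
        Lp.coeFn_smul (((2 : ℝ) ^ s : ℝ) : ℂ)
          ((indicatorMultiplier (measurableSet_shell d j)).act h)] with ζ h1 h2 h3 h4 h5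
      rw [h4, h5, Pi.smul_apply, Pi.smul_apply, h1, h2]
      by_cases hζ : ζ ∈ shell d j
      · rw [Set.indicator_of_mem hζ, Set.indicator_of_mem hζ, h3, norm_smul, norm_smul, norm_mul,
          Complex.norm_real, Complex.norm_real, Complex.norm_real,
          Real.norm_of_nonneg (by positivity), Real.norm_of_nonneg (by positivity),
          Real.norm_of_nonneg (by positivity), ← mul_assoc]
        refine mul_le_mul_of_nonneg_right ?_ (norm_nonneg _)
        have hd := two_pow_le_of_mem_dyadicInterval (by positivity) hζ
        have hd2 := Real.rpow_le_rpow (by positivity) hd (by positivity : 0 ≤ s / 2)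
        rw [Real.mul_rpow (by norm_num) (by positivity), ← Real.rpow_natCast ((2 : ℝ) ^ j) 2,
          ← Real.rpow_mul (by positivity), show (4 : ℝ) = 2 ^ (2 : ℝ) by norm_num,
          ← Real.rpow_mul (by norm_num)] at hd2
        have e3 : ((2 : ℕ) : ℝ) * (s / 2) = s := by push_cast; ring
        have e4 : (2 : ℝ) * (s / 2) = s := by ring
        rw [e3, e4] at hd2
        exact hd2
      · rw [Set.indicator_of_notMem hζ, Set.indicator_of_notMem hζ]
        simp
    rwa [norm_smul, norm_smul, Complex.norm_real, Complex.norm_real,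
      Real.norm_of_nonneg (by positivity), Real.norm_of_nonneg (by positivity)] at e1
  have hsum : ∑ j ∈ Finset.range (J + 1),
      ‖(indicatorMultiplier (measurableSet_shell d j)).act h‖ ^ 2 ≤ S ^ 2 := by
    simp only [L2.norm_sq_eq]
    rw [← integral_finsetSum _ fun j _ ↦ L2.integrable_norm_sq _, ← hhn, L2.norm_sq_eq]
    refine integral_mono_ae (integrable_finsetSum _ fun j _ ↦ L2.integrable_norm_sq _)
      (L2.integrable_norm_sq _) ?_
    have h1 : ∀ᵐ ζ, ∀ j, (indicatorMultiplier (measurableSet_shell d j)).act h ζ =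
      (shell d j).indicator h ζ := ae_all_iff.2 fun j ↦ indicator_act_ae (measurableSet_shell d j) h
    filter_upwards [h1] with ζ h1
    simp only [h1]
    have e : ∀ j, ‖(shell d j).indicator h ζ‖ ^ 2 =
        ((dyadicInterval j).indicator (fun _ ↦ ((‖h ζ‖ ^ 2 : ℝ) : ℂ)) (2 * Real.pi * ‖ζ‖)).re := by
      intro j
      by_cases hζ : ζ ∈ shell d j
      · have hζ' : 2 * Real.pi * ‖ζ‖ ∈ dyadicInterval j := hζ
        rw [Set.indicator_of_mem hζ, Set.indicator_of_mem hζ', Complex.ofReal_re]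
      · have hζ' : 2 * Real.pi * ‖ζ‖ ∉ dyadicInterval j := hζ
        rw [Set.indicator_of_notMem hζ, Set.indicator_of_notMem hζ']
        simp
    simp only [e]
    rw [← Complex.re_sum, sum_indicator_dyadicInterval]
    by_cases hb : 2 * Real.pi * ‖ζ‖ ∈ Set.Iic ((2 : ℝ) ^ J)
    · rw [Set.indicator_of_mem hb, Complex.ofReal_re]
    · rw [Set.indicator_of_notMem hb, Complex.zero_re]
      positivity
  calc _ ≤ ∑ j ∈ Finset.range (J + 1),
        (2 ^ s * ‖(indicatorMultiplier (measurableSet_shell d j)).act h‖) ^ 2 :=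
        Finset.sum_le_sum fun j _ ↦ pow_le_pow_left₀ (by positivity) (hterm j) 2
    _ = (2 ^ s) ^ 2 * ∑ j ∈ Finset.range (J + 1),
        ‖(indicatorMultiplier (measurableSet_shell d j)).act h‖ ^ 2 := by
        rw [Finset.mul_sum]
        exact Finset.sum_congr rfl fun j _ ↦ mul_pow _ _ _
    _ ≤ (2 ^ s) ^ 2 * S ^ 2 := by gcongr
    _ = _ := by ring

end

end

section

/-! ### Lower semicontinuity of the norms -/

section

variable {d : ℕ}

/-- Sublevel sets are closed: an L² limit is an almost everywhere limit along a subsequence, to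
which Fatou applies. -/
theorem lowerSemicontinuous_eLpNorm (q : ℝ≥0∞) :
    LowerSemicontinuous fun v : L2 d ↦ eLpNorm v q volume := by
  rw [lowerSemicontinuous_iff_isClosed_preimage]
  intro y
  apply IsSeqClosed.isClosed
  intro v w hv hvw
  obtain ⟨φ, hφ, hae⟩ := (tendstoInMeasure_of_tendsto_Lp hvw).exists_seq_tendsto_ae
  refine (Lp.eLpNorm_lim_le_liminf_eLpNorm (fun n ↦ Lp.aestronglyMeasurable (v (φ n))) w
    hae).trans ?_
  refine Filter.liminf_le_of_le (by isBoundedDefault) fun b hb ↦ ?_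
  obtain ⟨n, hn⟩ := hb.exists
  exact hn.trans (hv (φ n))

/-- A curve continuous in L² need not have a continuous L^q norm, but lower semicontinuity gives the
measurability in time that Hölder and Fatou require. -/
theorem measurable_eLpNorm_curve (q : ℝ≥0∞) {v : ℝ → L2 d} (hv : Continuous v) :
    Measurable fun t ↦ eLpNorm (v t) q volume :=
  ((lowerSemicontinuous_eLpNorm q).comp hv).measurable

theorem eLpNorm_liminf_le {α : Type*} [MeasurableSpace α] {μ : Measure α} {r M : ℝ≥0∞}
    (hr : r ≠ 0) {f : ℕ → α → ℝ≥0∞} (hf : ∀ n, Measurable (f n)) (hM : ∀ n, eLpNorm (f n) r μ ≤ M) :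
    eLpNorm (fun x ↦ Filter.liminf (fun n ↦ f n x) Filter.atTop) r μ ≤ M := by
  rcases eq_or_ne r ∞ with rfl | hr'
  · simp only [eLpNorm_exponent_top] at hM ⊢
    refine eLpNormEssSup_le_of_ae_enorm_bound ?_
    have h : ∀ᵐ x ∂μ, ∀ n, f n x ≤ M := ae_all_iff.2 fun n ↦ by
      filter_upwards [enorm_ae_le_eLpNormEssSup (f n) μ] with x hx
      exact hx.trans (hM n)
    filter_upwards [h] with x hx
    rw [enorm_eq_self]
    refine Filter.liminf_le_of_le (by isBoundedDefault) fun b hb ↦ ?_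
    obtain ⟨n, hn⟩ := hb.exists
    exact hn.trans (hx n)
  · have hr0 : 0 < r.toReal := ENNReal.toReal_pos hr hr'
    simp only [eLpNorm_eq_lintegral_rpow_enorm_toReal hr hr', enorm_eq_self] at hM ⊢
    rw [one_div, ENNReal.rpow_inv_le_iff hr0]
    have h1 : ∀ x, Filter.liminf (fun n ↦ f n x) Filter.atTop ^ r.toReal =
        Filter.liminf (fun n ↦ f n x ^ r.toReal) Filter.atTop := fun x ↦
      (ENNReal.orderIsoRpow r.toReal hr0).liminf_apply
    simp only [h1]
    refine (lintegral_liminf_le fun n ↦ (hf n).pow_const _).trans ?_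
    refine Filter.liminf_le_of_le (by isBoundedDefault) fun b hb ↦ ?_
    obtain ⟨n, hn⟩ := hb.exists
    refine hn.trans ?_
    rw [← ENNReal.rpow_inv_le_iff hr0, ← one_div]
    exact hM n

/-- Fatou in space at each time, then in time. This removes the frequency truncations at the end of
the summation and in the endpoint case. -/
theorem strichartzNorm_le_of_tendsto {r q M : ℝ≥0∞} (hr : r ≠ 0)
    {v : ℕ → ℝ → L2 d} {w : ℝ → L2 d} (hv : ∀ n, Continuous (v n))
    (hvw : ∀ t, Filter.Tendsto (fun n ↦ v n t) Filter.atTop (nhds (w t)))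
    (hM : ∀ n, strichartzNorm r q (v n) ≤ M) : strichartzNorm r q w ≤ M := by
  refine le_trans ?_ (eLpNorm_liminf_le hr (fun n ↦ measurable_eLpNorm_curve q (hv n)) hM)
  refine eLpNorm_mono_enorm fun t ↦ ?_
  simp only [enorm_eq_self]
  have := (lowerSemicontinuous_eLpNorm q).lowerSemicontinuousAt (w t)
  refine (lowerSemicontinuousAt_iff_le_liminf.1 this).trans ?_
  exact Filter.liminf_le_liminf_of_le (hvw t)

theorem tendsto_act {m : ℕ → UnitMultiplier d} {f g : L2 d}
    (h : ∀ᵐ ζ, Filter.Tendsto (fun n ↦ (m n).toFun ζ * g ζ) Filter.atTop (nhds (f ζ))) :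
    Filter.Tendsto (fun n ↦ (m n).act g) Filter.atTop (nhds f) := by
  rw [tendsto_iff_norm_sub_tendsto_zero]
  have hsq : Filter.Tendsto (fun n ↦ ‖(m n).act g - f‖ ^ 2) Filter.atTop (nhds 0) := by
    simp only [L2.norm_sq_eq]
    have h0 : (0 : ℝ) = ∫ _ : Space d, (0 : ℝ) := by simp
    rw [h0]
    have h1 : ∀ᵐ ζ, ∀ n, ((m n).act g - f : L2 d) ζ = (m n).toFun ζ * g ζ - f ζ :=
      ae_all_iff.2 fun n ↦ by
        filter_upwards [Lp.coeFn_sub ((m n).act g) f, (m n).coeFn_act g] with ζ h1 h2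
        rw [h1, Pi.sub_apply, h2]
    refine tendsto_integral_of_dominated_convergence (fun ζ ↦ 2 * (‖g ζ‖ ^ 2 + ‖f ζ‖ ^ 2))
      (fun n ↦ (L2.integrable_norm_sq _).aestronglyMeasurable)
      (((L2.integrable_norm_sq g).add (L2.integrable_norm_sq f)).const_mul 2) (fun n ↦ ?_) ?_
    · filter_upwards [h1] with ζ h1
      rw [h1 n, Real.norm_of_nonneg (sq_nonneg _)]
      have h2 : ‖(m n).toFun ζ * g ζ - f ζ‖ ≤ ‖g ζ‖ + ‖f ζ‖ := by
        refine (norm_sub_le _ _).trans (add_le_add_left ?_ _)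
        rw [norm_mul]
        exact mul_le_of_le_one_left (norm_nonneg _) ((m n).norm_le_one ζ)
      exact (pow_le_pow_left₀ (norm_nonneg _) h2 2).trans (add_sq_le)
    · filter_upwards [h1, h] with ζ h1 h
      simp only [h1]
      have := ((h.sub_const (f ζ)).norm).pow 2
      simpa using this
  simpa using hsq.sqrt

theorem tendsto_indicator_act {S : ℕ → Set (Space d)} (hS : ∀ n, MeasurableSet (S n)) (g : L2 d)
    (h : ∀ᵐ ζ, ∀ᶠ n in Filter.atTop, ζ ∈ S n) :
    Filter.Tendsto (fun n ↦ (indicatorMultiplier (hS n)).act g) Filter.atTop (nhds g) := by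
  refine tendsto_act ?_
  filter_upwards [h] with ζ h
  refine tendsto_const_nhds.congr' ?_
  filter_upwards [h] with n hn
  simp [indicatorMultiplier, hn]

theorem eventually_mem_freqBall (ζ : Space d) : ∀ᶠ J in Filter.atTop, ζ ∈ freqBall d J :=
  (tendsto_pow_atTop_atTop_of_one_lt (one_lt_two : (1 : ℝ) < 2)).eventually_ge_atTop _

theorem enorm_sum_sq_le (z : ℕ → ℂ) (J : ℕ) :
    ‖∑ j ∈ Finset.range J, z j‖ₑ ^ 2 ≤
      ∑ i ∈ Finset.range J, ∑ k ∈ Finset.range J, ‖z (min i k)‖ₑ * ‖z (max i k)‖ₑ := by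
  calc _ ≤ (∑ j ∈ Finset.range J, ‖z j‖ₑ) ^ 2 := by
        gcongr
        exact enorm_sum_le _ _
    _ = _ := by
        rw [sq, Finset.sum_mul_sum]
        refine Finset.sum_congr rfl fun i _ ↦ Finset.sum_congr rfl fun k _ ↦ ?_
        rcases le_total i k with h | h
        · rw [min_eq_left h, max_eq_right h]
        · rw [min_eq_right h, max_eq_left h, mul_comm]

theorem strichartzNorm_sum_sq_le {p p₁ p₂ ρ ρ₁ ρ₂ : ℝ≥0∞} (hp : 1 ≤ p) (hρ : 1 ≤ ρ)
    (hx : IsHolder p p₁ p₂) (ht : IsHolder ρ ρ₁ ρ₂)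
    {v : ℕ → ℝ → L2 d} (hv : ∀ j, Continuous (v j)) (J : ℕ) :
    strichartzNorm (ρ * 2) (p * 2) (fun t ↦ ∑ j ∈ Finset.range J, v j t) ^ 2 ≤
      ∑ i ∈ Finset.range J, ∑ k ∈ Finset.range J,
        strichartzNorm ρ₁ p₁ (v (min i k)) * strichartzNorm ρ₂ p₂ (v (max i k)) := by
  refine eLpNorm_sq_le_sum hρ ht
    (a := fun j t ↦ eLpNorm (v j t) p₁ volume) (b := fun j t ↦ eLpNorm (v j t) p₂ volume)
    (fun j ↦ (measurable_eLpNorm_curve p₁ (hv j)).aemeasurable)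
    (fun j ↦ (measurable_eLpNorm_curve p₂ (hv j)).aemeasurable) J
    (Filter.Eventually.of_forall fun t ↦ ?_)
  have := eLpNorm_sq_le_sum hp hx (μ := (volume : Measure (Space d)))
    (f := fun x ↦ ‖(∑ j ∈ Finset.range J, v j t : L2 d) x‖ₑ)
    (a := fun j x ↦ ‖v j t x‖ₑ) (b := fun j x ↦ ‖v j t x‖ₑ)
    (fun j ↦ (Lp.aestronglyMeasurable (v j t)).enorm)
    (fun j ↦ (Lp.aestronglyMeasurable (v j t)).enorm) J (by
      filter_upwards [Lp.coeFn_finsetSum (Finset.range J) fun j ↦ v j t] with x hx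
      rw [hx, Finset.sum_apply]
      exact enorm_sum_sq_le (fun j ↦ v j t x) J)
  simpa only [eLpNorm_enorm] using this

theorem shell_act_eq_zero (g : L2 d) (j : ℕ) :
    ∀ᵐ ζ, (2 : ℝ) ^ j < 2 * Real.pi * ‖ζ‖ →
      (indicatorMultiplier (measurableSet_shell d j)).act g ζ = 0 := by
  filter_upwards [indicator_act_ae (measurableSet_shell d j) g] with ζ h hζ
  rw [h, Set.indicator_of_notMem]
  intro hmem
  have hmem' : 2 * Real.pi * ‖ζ‖ ∈ dyadicInterval j := hmem
  refine absurd hζ (not_lt.2 ?_)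
  cases j with
  | zero => simpa [dyadicInterval] using hmem'
  | succ j => exact hmem'.2

/-- The gain: giving the lower frequency the larger loss s + κ and the higher one s - κ leaves
2^(-κm), with m the gap between the frequencies. -/
theorem two_pow_rpow_mul (n m : ℕ) (s κ : ℝ) :
    ((2 : ℝ) ^ n) ^ (s + κ) * ((2 : ℝ) ^ (n + m)) ^ (s - κ) =
      ((2 : ℝ) ^ (-κ)) ^ m * (((2 : ℝ) ^ n) ^ s * ((2 : ℝ) ^ (n + m)) ^ s) := by
  simp only [← Real.rpow_natCast, ← Real.rpow_mul (zero_le_two (α := ℝ)),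
    ← Real.rpow_add (two_pos (α := ℝ))]
  congr 1
  push_cast
  ring

end

/-! ### Summation of the localized estimates -/

/-- The Strichartz estimate for data with frequencies in the ball of radius `l`, with a loss of
`l ^ s`. -/
def LocalizedStrichartz (d : ℕ) [NeZero d] (r q : ℝ≥0∞) (s : ℝ) : Prop :=
  ∃ C > 0, ∀ l > 0, ∀ g : L2 d, (∀ᵐ ζ, l < 2 * Real.pi * ‖ζ‖ → g ζ = 0) →
    strichartzNorm r q (fun t ↦ (𝓕⁻ ((phaseMultiplier t).act g) : L2 d)) ≤
      ENNReal.ofReal (C * l ^ s * ‖g‖)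

section

variable {d : ℕ} [NeZero d]

theorem continuous_flow (g : L2 d) :
    Continuous fun t ↦ (𝓕⁻ ((phaseMultiplier t).act g) : L2 d) :=
  (Lp.fourierTransformₗᵢ (Space d) ℂ).symm.continuous.comp (continuous_phaseMultiplier_act g)

theorem tendsto_flow {g : ℕ → L2 d} {h : L2 d} (hg : Filter.Tendsto g Filter.atTop (nhds h))
    (t : ℝ) : Filter.Tendsto (fun n ↦ (𝓕⁻ ((phaseMultiplier t).act (g n)) : L2 d)) Filter.atTop
      (nhds (𝓕⁻ ((phaseMultiplier t).act h))) := by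
  have h2 : LipschitzWith 1 (phaseMultiplier (d := d) t).act :=
    LipschitzWith.of_dist_le_mul fun f g ↦ by
      rw [dist_eq_norm, dist_eq_norm, ← UnitMultiplier.act_sub, NNReal.coe_one, one_mul]
      exact UnitMultiplier.norm_act_le _ _
  exact (((Lp.fourierTransformₗᵢ (Space d) ℂ).symm.continuous.comp h2.continuous).tendsto h).comp hg

theorem flow_sum (g : ℕ → L2 d) (S : Finset ℕ) (t : ℝ) :
    (𝓕⁻ ((phaseMultiplier t).act (∑ j ∈ S, g j)) : L2 d) =
      ∑ j ∈ S, (𝓕⁻ ((phaseMultiplier t).act (g j)) : L2 d) := by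
  have h0 : (phaseMultiplier (d := d) t).act 0 = 0 := by
    have := (phaseMultiplier (d := d) t).act_add 0 0
    simpa using this
  induction S using Finset.cons_induction with
  | empty =>
    rw [Finset.sum_empty, Finset.sum_empty, h0]
    exact (Lp.fourierTransformₗᵢ (Space d) ℂ).symm.map_zero
  | cons j S hj ih =>
    rw [Finset.sum_cons, Finset.sum_cons, UnitMultiplier.act_add, ← ih]
    exact (Lp.fourierTransformₗᵢ (Space d) ℂ).symm.map_add _ _

/-- Two localized estimates, at exponents whose reciprocals average to those of the target and with
losses s ± κ, imply the global one. The product of pieces i and k is bounded by a^{|i-k|} c_i c_k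
with a = 2^(-κ) < 1, and the sum of the c_i² is controlled by the square of the Sobolev norm. -/
theorem exists_strichartz_of_localized {p p₁ p₂ ρ ρ₁ ρ₂ : ℝ≥0∞} (hp : 1 ≤ p) (hρ : 1 ≤ ρ)
    (hx : IsHolder p p₁ p₂) (ht : IsHolder ρ ρ₁ ρ₂) {s κ : ℝ}
    (hs : 0 ≤ s) (hκ : 0 < κ) (h₁ : LocalizedStrichartz d ρ₁ p₁ (s + κ))
    (h₂ : LocalizedStrichartz d ρ₂ p₂ (s - κ)) :
    ∃ C : ℝ≥0, ∀ u : L2 d,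
      strichartzNorm (ρ * 2) (p * 2) (fun t ↦ U t u) ≤ C * sobolevNorm s u := by
  obtain ⟨C₁, hC₁, h₁⟩ := h₁
  obtain ⟨C₂, hC₂, h₂⟩ := h₂
  set a : ℝ := (2 : ℝ) ^ (-κ) with ha
  have ha0 : 0 < a := by positivity
  have ha1 : a < 1 := Real.rpow_lt_one_of_one_lt_of_neg one_lt_two (by linarith)
  have ha2 : 0 < 1 - a := by linarith
  set D : ℝ := C₁ * C₂ * (2 * (1 - a)⁻¹) with hD
  have hD0 : 0 < D := by positivity
  refine ⟨Real.toNNReal (Real.sqrt D * 2 ^ s), fun u ↦ ?_⟩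
  have hC0 : 0 < Real.sqrt D * 2 ^ s := by positivity
  -- Outside H^s the right side is infinite, because the constant is positive; with constant zero it
  -- would be 0 · ∞ = 0.
  rcases eq_or_ne (sobolevNorm s u) ∞ with hS | hS
  · rw [hS, ENNReal.mul_top]
    · exact le_top
    · simpa using hC0
  set S := (sobolevNorm s u).toReal with hSdef
  have hS0 : 0 ≤ S := ENNReal.toReal_nonneg
  have hSe : sobolevNorm s u = ENNReal.ofReal S := (ENNReal.ofReal_toReal hS).symm
  have hrhs : (Real.toNNReal (Real.sqrt D * 2 ^ s) : ℝ≥0∞) * sobolevNorm s u =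
      ENNReal.ofReal (Real.sqrt D * 2 ^ s * S) := by
    rw [hSe, ENNReal.ofReal_mul hC0.le]
    rfl
  rw [hrhs]
  set g : L2 d := 𝓕 u with hg
  set gj : ℕ → L2 d := fun j ↦ (indicatorMultiplier (measurableSet_shell d j)).act g with hgj
  set c : ℕ → ℝ := fun j ↦ ((2 : ℝ) ^ j) ^ s * ‖gj j‖ with hc
  refine strichartzNorm_le_of_tendsto (mul_ne_zero (zero_lt_one.trans_le hρ).ne' two_ne_zero)
    (v := fun J t ↦ 𝓕⁻ ((phaseMultiplier t).act
      ((indicatorMultiplier (measurableSet_freqBall d J)).act g)))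
    (fun J ↦ continuous_flow _) (fun t ↦ ?_) (fun J ↦ ?_)
  · exact tendsto_flow (tendsto_indicator_act (measurableSet_freqBall d) g
      (Filter.Eventually.of_forall eventually_mem_freqBall)) t
  have hfun : (fun t ↦ (𝓕⁻ ((phaseMultiplier t).act
      ((indicatorMultiplier (measurableSet_freqBall d J)).act g)) : L2 d)) =
      fun t ↦ ∑ j ∈ Finset.range (J + 1), (𝓕⁻ ((phaseMultiplier t).act (gj j)) : L2 d) := by
    ext1 t
    rw [← sum_shell_act, flow_sum]
  rw [hfun]
  have hsq := strichartzNorm_sum_sq_le hp hρ hx ht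
    (v := fun j t ↦ (𝓕⁻ ((phaseMultiplier t).act (gj j)) : L2 d))
    (fun j ↦ continuous_flow (gj j)) (J + 1)
  have hterm : ∀ i k, strichartzNorm ρ₁ p₁
      (fun t ↦ (𝓕⁻ ((phaseMultiplier t).act (gj (min i k))) : L2 d)) *
      strichartzNorm ρ₂ p₂ (fun t ↦ (𝓕⁻ ((phaseMultiplier t).act (gj (max i k))) : L2 d)) ≤
      ENNReal.ofReal (C₁ * C₂ * (a ^ (max i k - min i k) * (c i * c k))) := by
    intro i k
    refine (mul_le_mul' (h₁ (2 ^ min i k) (by positivity) _ (shell_act_eq_zero g _))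
      (h₂ (2 ^ max i k) (by positivity) _ (shell_act_eq_zero g _))).trans_eq ?_
    rw [← ENNReal.ofReal_mul (by positivity)]
    congr 1
    have hcc : c i * c k = c (min i k) * c (max i k) := by
      rcases le_total i k with h | h
      · rw [min_eq_left h, max_eq_right h]
      · rw [min_eq_right h, max_eq_left h, mul_comm]
    obtain ⟨m, hm⟩ := Nat.exists_eq_add_of_le (min_le_max : min i k ≤ max i k)
    rw [hcc, hm, Nat.add_sub_cancel_left, hc, ha]
    simp only
    set x := ‖gj (min i k)‖
    set y := ‖gj (min i k + m)‖
    calc _ = C₁ * C₂ * (((2 : ℝ) ^ min i k) ^ (s + κ) * ((2 : ℝ) ^ (min i k + m)) ^ (s - κ)) *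
          x * y := by ring
      _ = _ := by rw [two_pow_rpow_mul]; ring
  have hfin : strichartzNorm (ρ * 2) (p * 2) (fun t ↦ ∑ j ∈ Finset.range (J + 1),
      (𝓕⁻ ((phaseMultiplier t).act (gj j)) : L2 d)) ^ 2 ≤
      ENNReal.ofReal (Real.sqrt D * 2 ^ s * S) ^ 2 := by
    refine hsq.trans ((Finset.sum_le_sum fun i _ ↦ Finset.sum_le_sum fun k _ ↦ hterm i k).trans ?_)
    have hc0 : ∀ j, 0 ≤ c j := fun j ↦ by positivity
    have hnn : ∀ i k, 0 ≤ C₁ * C₂ * (a ^ (max i k - min i k) * (c i * c k)) := fun i k ↦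
      mul_nonneg (by positivity) (mul_nonneg (by positivity) (mul_nonneg (hc0 i) (hc0 k)))
    simp only [← ENNReal.ofReal_sum_of_nonneg fun k _ ↦ hnn _ k]
    rw [← ENNReal.ofReal_sum_of_nonneg fun i _ ↦ Finset.sum_nonneg fun k _ ↦ hnn i k,
      ← ENNReal.ofReal_pow (by positivity)]
    apply ENNReal.ofReal_le_ofReal
    simp only [← Finset.mul_sum]
    calc _ ≤ C₁ * C₂ * (2 * (1 - a)⁻¹ * ∑ i ∈ Finset.range (J + 1), c i ^ 2) := by
          gcongr
          exact sum_sum_geometric_le ha0.le ha1 c (J + 1)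
      _ ≤ C₁ * C₂ * (2 * (1 - a)⁻¹ * (2 ^ s * S) ^ 2) := by
          gcongr
          exact sum_shell_norm_sq_le hs u hSe hS0 J
      _ = _ := by
          rw [show (Real.sqrt D * 2 ^ s * S) ^ 2 = Real.sqrt D ^ 2 * (2 ^ s * S) ^ 2 by ring,
            Real.sq_sqrt hD0.le, hD]
          ring
  exact (ENNReal.pow_le_pow_left_iff two_ne_zero).1 hfin

end

end

/-! ### The global estimates away from the endpoint in dimension three -/

/-- In reciprocal exponents the decay σ is b/(1/2 - a), so σ < 1 and σ = 1 are the interior and the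
edge of the triangle. -/
theorem localizedStrichartz_inv {n : ℕ} (hn : 2 ≤ n) {a b : ℝ} (ha : 0 < a) (ha' : a < 1 / 2)
    (hb : 0 < b) (hab : a + b < 1 / 2 ∨ a + b = 1 / 2 ∧ 3 ≤ n) :
    LocalizedStrichartz (n + 1) (ENNReal.ofReal (1 / b)) (ENNReal.ofReal (1 / a))
      ((n + 1 : ℝ) * (1 / 2 - a) - 3 * b) := by
  have hb' : b < 1 / 2 := by rcases hab with h | h <;> linarith
  have hq : 2 < 1 / a := by rw [lt_div_iff₀ ha]; linarith
  have hr : 2 < 1 / b := by rw [lt_div_iff₀ hb]; linarith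
  have e : 2 * (1 / a) / (1 / b * (1 / a - 2)) = b / (1 / 2 - a) := by
    have h1 : 1 - 2 * a ≠ 0 := by linarith
    have h2 : 1 / 2 - a ≠ 0 := by linarith
    have h3 : 1 / a - 2 ≠ 0 := by linarith
    field_simp
  obtain ⟨C, hC, h⟩ := exists_localized_strichartz hn hq hr (by
    rw [e, div_lt_one (by linarith), div_eq_one_iff_eq (by linarith)]
    rcases hab with h | ⟨h, h'⟩
    · left; linarith
    · right; exact ⟨by linarith, h'⟩)
  refine ⟨C, hC, fun l hl g hg ↦ ?_⟩
  have := h l hl g hg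
  rwa [one_div_one_div, show (3 : ℝ) / (1 / b) = 3 * b by simp] at this

theorem isHolder_inv {a b c : ℝ} (ha : 0 < a) (hb : 0 < b) (hc : 0 < c) (h : c = a + b) :
    IsHolder (ENNReal.ofReal (1 / c)) (ENNReal.ofReal (1 / a)) (ENNReal.ofReal (1 / b)) :=
  Or.inr ⟨_, _, _, rfl, rfl, rfl, by positivity, by positivity, by positivity, by simpa using h⟩

theorem ofReal_inv_two_mul {a : ℝ} (ha : 0 < a) :
    ENNReal.ofReal (1 / (2 * a)) * 2 = ENNReal.ofReal (1 / a) := by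
  rw [show (2 : ℝ≥0∞) = ENNReal.ofReal 2 by simp, ← ENNReal.ofReal_mul (by positivity)]
  congr 1
  field_simp

theorem one_le_ofReal_inv_two_mul {a : ℝ} (ha : 0 < a) (ha' : a ≤ 1 / 2) :
    1 ≤ ENNReal.ofReal (1 / (2 * a)) := by
  rw [ENNReal.one_le_ofReal, le_div_iff₀ (by positivity)]
  linarith

/-- Inside the triangle there is room to move 1/q by ±δ with 1/r fixed, which changes the loss by
(n+1)δ. -/
theorem exists_strichartz_of_lt {n : ℕ} (hn : 2 ≤ n) {a b : ℝ} (ha : 0 < a) (hb : 0 < b)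
    (hab : a + b < 1 / 2) :
    ∃ C : ℝ≥0, ∀ u : L2 (n + 1),
      strichartzNorm (ENNReal.ofReal (1 / b)) (ENNReal.ofReal (1 / a)) (fun t ↦ U t u) ≤
        C * sobolevNorm ((n + 1 : ℝ) * (1 / 2 - a) - 3 * b) u := by
  obtain ⟨δ, hδ0, hδ⟩ : ∃ δ : ℝ, 0 < δ ∧ δ < min a (1 / 2 - a - b) :=
    exists_between (lt_min ha (by linarith))
  have hδ1 : δ < a := hδ.trans_le (min_le_left _ _)
  have hδ2 : δ < 1 / 2 - a - b := hδ.trans_le (min_le_right _ _)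
  have hn' : (2 : ℝ) ≤ n := by exact_mod_cast hn
  have h1 := localizedStrichartz_inv hn (a := a - δ) (b := b) (by linarith) (by linarith) hb
    (Or.inl (by linarith))
  have h2 := localizedStrichartz_inv hn (a := a + δ) (b := b) (by linarith) (by linarith) hb
    (Or.inl (by linarith))
  rw [← ofReal_inv_two_mul ha, ← ofReal_inv_two_mul hb]
  refine exists_strichartz_of_localized (κ := (n + 1) * δ)
    (one_le_ofReal_inv_two_mul ha (by linarith)) (one_le_ofReal_inv_two_mul hb (by linarith))
    (isHolder_inv (a := a - δ) (b := a + δ) (by linarith) (by linarith) (by linarith) (by ring))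
    (isHolder_inv (a := b) (b := b) hb hb (by linarith) (by ring)) ?_ (by positivity) ?_ ?_
  · nlinarith
  · convert h1 using 1
    ring
  · convert h2 using 1
    ring

/-- Moving along the edge a + b = 1/2 changes the loss by (n+1)δ - 3δ = (n-2)δ, which is positive
exactly when n ≥ 3. -/
theorem exists_strichartz_of_eq {n : ℕ} (hn : 3 ≤ n) {a b : ℝ} (ha : 0 < a) (hb : 0 < b)
    (hab : a + b = 1 / 2) :
    ∃ C : ℝ≥0, ∀ u : L2 (n + 1),
      strichartzNorm (ENNReal.ofReal (1 / b)) (ENNReal.ofReal (1 / a)) (fun t ↦ U t u) ≤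
        C * sobolevNorm ((n + 1 : ℝ) * (1 / 2 - a) - 3 * b) u := by
  obtain ⟨δ, hδ0, hδ⟩ : ∃ δ : ℝ, 0 < δ ∧ δ < min a b := exists_between (lt_min ha hb)
  have hδ1 : δ < a := hδ.trans_le (min_le_left _ _)
  have hδ2 : δ < b := hδ.trans_le (min_le_right _ _)
  have hn' : (3 : ℝ) ≤ n := by exact_mod_cast hn
  have h1 := localizedStrichartz_inv (n := n) (by omega) (a := a - δ) (b := b + δ) (by linarith)
    (by linarith) (by linarith) (Or.inr ⟨by linarith, hn⟩)
  have h2 := localizedStrichartz_inv (n := n) (by omega) (a := a + δ) (b := b - δ) (by linarith)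
    (by linarith) (by linarith) (Or.inr ⟨by linarith, hn⟩)
  rw [← ofReal_inv_two_mul ha, ← ofReal_inv_two_mul hb]
  refine exists_strichartz_of_localized (κ := (n - 2) * δ)
    (one_le_ofReal_inv_two_mul ha (by linarith)) (one_le_ofReal_inv_two_mul hb (by linarith))
    (isHolder_inv (a := a - δ) (b := a + δ) (by linarith) (by linarith) (by linarith) (by ring))
    (isHolder_inv (a := b + δ) (b := b - δ) (by linarith) (by linarith) (by linarith) (by ring))
    ?_ (mul_pos (by linarith) hδ0) ?_ ?_
  · nlinarith
  · convert h1 using 1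
    ring
  · convert h2 using 1
    ring

/-- The time exponent stays infinite and only 1/q moves. Both neighbours must lie strictly between 0
and 1/2, which excludes q = 2. -/
theorem exists_strichartz_top {d : ℕ} [NeZero d] {a : ℝ} (ha : 0 < a) (ha' : a < 1 / 2) :
    ∃ C : ℝ≥0, ∀ u : L2 d,
      strichartzNorm ∞ (ENNReal.ofReal (1 / a)) (fun t ↦ U t u) ≤
        C * sobolevNorm (d * (1 / 2 - a)) u := by
  obtain ⟨δ, hδ0, hδ⟩ : ∃ δ : ℝ, 0 < δ ∧ δ < min a (1 / 2 - a) :=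
    exists_between (lt_min ha (by linarith))
  have hδ1 : δ < a := hδ.trans_le (min_le_left _ _)
  have hδ2 : δ < 1 / 2 - a := hδ.trans_le (min_le_right _ _)
  have hloc : ∀ c : ℝ, 0 < c → c < 1 / 2 →
      LocalizedStrichartz d ∞ (ENNReal.ofReal (1 / c)) (d * (1 / 2 - c)) := by
    intro c hc hc'
    have hq : 2 < 1 / c := by rw [lt_div_iff₀ hc]; linarith
    have := exists_localized_sup (d := d) hq
    rwa [one_div_one_div] at this
  have hd : (0 : ℝ) < d := by exact_mod_cast Nat.pos_of_neZero d
  rw [← ofReal_inv_two_mul ha, ← ENNReal.top_mul (two_ne_zero : (2 : ℝ≥0∞) ≠ 0)]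
  refine exists_strichartz_of_localized (κ := d * δ)
    (one_le_ofReal_inv_two_mul ha (by linarith)) le_top
    (isHolder_inv (a := a - δ) (b := a + δ) (by linarith) (by linarith) (by linarith) (by ring))
    (Or.inl ⟨rfl, rfl, rfl⟩) (mul_nonneg hd.le (by linarith)) (by positivity) ?_ ?_
  · convert hloc (a - δ) (by linarith) (by linarith) using 1
    ring
  · convert hloc (a + δ) (by linarith) (by linarith) using 1
    ring

/-! ### Conservation of the L² norm: the vertex q = 2, r = ∞ -/

theorem sobolevNorm_zero {d : ℕ} (u : L2 d) : sobolevNorm 0 u = ENNReal.ofReal ‖u‖ := by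
  have h : ‖(𝓕 u : L2 d)‖ = ‖u‖ := (Lp.fourierTransformₗᵢ (Space d) ℂ).norm_map u
  rw [← h, ofReal_norm, Lp.enorm_def, sobolevNorm]
  simp

theorem strichartzNorm_top_two {d : ℕ} [NeZero d] (u : L2 d) :
    strichartzNorm ∞ 2 (fun t ↦ U t u) ≤ sobolevNorm 0 u := by
  rw [strichartzNorm, eLpNorm_exponent_top]
  refine eLpNormEssSup_le_of_ae_enorm_bound (Filter.Eventually.of_forall fun t ↦ ?_)
  rw [enorm_eq_self, ← Lp.enorm_def, ← ofReal_norm, sobolevNorm_zero]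
  apply ENNReal.ofReal_le_ofReal
  rw [U_eq_act, UnitMultiplier.norm_fourierInv]
  refine (UnitMultiplier.norm_act_le _ _).trans_eq ?_
  exact (Lp.fourierTransformₗᵢ (Space d) ℂ).norm_map u

section

/-! ### An oscillatory integral -/

/-- A monotone function crosses the level `c` once, and the interval is cut at the crossing. The
bounds are required on all initial and final intervals, so the crossing point need not be known. -/
theorem abs_integral_le_of_split {f g : ℝ → ℝ} {a b : ℝ} (hab : a ≤ b) (hg : Continuous g)
    (hf : Continuous f) (hm : MonotoneOn f (Set.Icc a b)) (c : ℝ) {M₁ M₂ : ℝ}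
    (hM₁ : 0 ≤ M₁) (hM₂ : 0 ≤ M₂)
    (h₁ : ∀ e, a ≤ e → e ≤ b → (∀ τ ∈ Set.Icc a e, f τ ≤ c) → |∫ τ in a..e, g τ| ≤ M₁)
    (h₂ : ∀ e, a ≤ e → e ≤ b → (∀ τ ∈ Set.Icc e b, c ≤ f τ) → |∫ τ in e..b, g τ| ≤ M₂) :
    |∫ τ in a..b, g τ| ≤ M₁ + M₂ := by
  have ha : a ∈ Set.Icc a b := Set.left_mem_Icc.2 hab
  have hb : b ∈ Set.Icc a b := Set.right_mem_Icc.2 hab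
  rcases le_total (f b) c with h | h
  · linarith [h₁ b hab le_rfl fun τ hτ ↦ (hm hτ hb hτ.2).trans h]
  rcases le_total c (f a) with h' | h'
  · linarith [h₂ a le_rfl hab fun τ hτ ↦ h'.trans (hm ha hτ hτ.1)]
  · obtain ⟨γ, hγ, rfl⟩ := intermediate_value_Icc hab hf.continuousOn ⟨h', h⟩
    rw [← intervalIntegral.integral_add_adjacent_intervals (hg.intervalIntegrable a γ)
      (hg.intervalIntegrable γ b)]
    refine (abs_add_le _ _).trans (add_le_add ?_ ?_)
    · exact h₁ γ hγ.1 hγ.2 fun τ hτ ↦ hm ⟨hτ.1, hτ.2.trans hγ.2⟩ hγ hτ.2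
    · exact h₂ γ hγ.1 hγ.2 fun τ hτ ↦ hm hγ ⟨hγ.1.trans hτ.1, hτ.2⟩ hτ.1

section

variable {φ G H : ℝ → ℝ} {a b L : ℝ}

/-- Van der Corput's first derivative test: integration by parts of sin φ = (G sin φ)/G gives two
boundary terms of size at most 1, and an integral of |H|/G², which telescopes to at most 1 as H has
one sign. -/
theorem abs_integral_sin_le_of_one_le (hφ : ∀ τ, HasDerivAt φ (G τ) τ)
    (hG : ∀ τ, HasDerivAt G (H τ) τ) (hH : Continuous H) (hab : a ≤ b)
    (h1 : ∀ τ ∈ Set.Icc a b, 1 ≤ G τ)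
    (hs : (∀ τ ∈ Set.Icc a b, 0 ≤ H τ) ∨ ∀ τ ∈ Set.Icc a b, H τ ≤ 0) :
    |∫ τ in a..b, Real.sin (φ τ)| ≤ 3 := by
  have hφc : Continuous φ := continuous_iff_continuousAt.2 fun τ ↦ (hφ τ).continuousAt
  have hGc : Continuous G := continuous_iff_continuousAt.2 fun τ ↦ (hG τ).continuousAt
  have hpos : ∀ τ ∈ Set.uIcc a b, 0 < G τ := fun τ hτ ↦
    zero_lt_one.trans_le (h1 τ (by rwa [Set.uIcc_of_le hab] at hτ))
  have ha := h1 a (Set.left_mem_Icc.2 hab)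
  have hb := h1 b (Set.right_mem_Icc.2 hab)
  have hHG : ContinuousOn (fun τ ↦ H τ / G τ ^ 2) (Set.uIcc a b) :=
    hH.continuousOn.div (hGc.pow 2).continuousOn fun τ hτ ↦ (pow_pos (hpos τ hτ) 2).ne'
  have hcHG : ContinuousOn (fun τ ↦ Real.cos (φ τ) * (H τ / G τ ^ 2)) (Set.uIcc a b) :=
    (Real.continuous_cos.comp hφc).continuousOn.mul hHG
  have hsin : Continuous fun τ ↦ Real.sin (φ τ) := Real.continuous_sin.comp hφc
  have e1 : ∫ τ in a..b, H τ / G τ ^ 2 = (G a)⁻¹ - (G b)⁻¹ := by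
    have := intervalIntegral.integral_eq_sub_of_hasDerivAt (f := fun τ ↦ -(G τ)⁻¹)
      (f' := fun τ ↦ H τ / G τ ^ 2) (a := a) (b := b) (fun τ hτ ↦ by
        exact ((hG τ).inv (hpos τ hτ).ne').neg.congr_deriv (by ring)) hHG.intervalIntegrable
    rw [this]
    ring
  have e2 : ∫ τ in a..b, (Real.sin (φ τ) + Real.cos (φ τ) * (H τ / G τ ^ 2)) =
      -(Real.cos (φ b) * (G b)⁻¹) + Real.cos (φ a) * (G a)⁻¹ := by
    have := intervalIntegral.integral_eq_sub_of_hasDerivAt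
      (f := fun τ ↦ -(Real.cos (φ τ) * (G τ)⁻¹))
      (f' := fun τ ↦ Real.sin (φ τ) + Real.cos (φ τ) * (H τ / G τ ^ 2)) (a := a) (b := b)
      (fun τ hτ ↦ by
        have hg0 := (hpos τ hτ).ne'
        refine ((hφ τ).cos.mul ((hG τ).inv hg0)).neg.congr_deriv ?_
        simp only [Pi.inv_apply]
        field_simp
        ring) (hsin.continuousOn.add hcHG).intervalIntegrable
    rw [this]
    ring
  rw [intervalIntegral.integral_add (hsin.intervalIntegrable a b) hcHG.intervalIntegrable] at e2
  have hia : 0 < (G a)⁻¹ ∧ (G a)⁻¹ ≤ 1 := ⟨by positivity, inv_le_one_of_one_le₀ ha⟩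
  have hib : 0 < (G b)⁻¹ ∧ (G b)⁻¹ ≤ 1 := ⟨by positivity, inv_le_one_of_one_le₀ hb⟩
  have e3 : |∫ τ in a..b, Real.cos (φ τ) * (H τ / G τ ^ 2)| ≤ 1 := by
    rcases hs with hs | hs
    · have := intervalIntegral.norm_integral_le_of_norm_le (μ := volume) hab
        (f := fun τ ↦ Real.cos (φ τ) * (H τ / G τ ^ 2)) (g := fun τ ↦ H τ / G τ ^ 2)
        (Filter.Eventually.of_forall fun τ hτ ↦ by
          have h0 : 0 ≤ H τ / G τ ^ 2 := div_nonneg (hs τ (Set.Ioc_subset_Icc_self hτ)) (sq_nonneg _)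
          rw [Real.norm_eq_abs, abs_mul, abs_of_nonneg h0]
          exact mul_le_of_le_one_left h0 (Real.abs_cos_le_one _)) hHG.intervalIntegrable
      rw [e1, Real.norm_eq_abs] at this
      linarith
    · have := intervalIntegral.norm_integral_le_of_norm_le (μ := volume) hab
        (f := fun τ ↦ Real.cos (φ τ) * (H τ / G τ ^ 2)) (g := fun τ ↦ -(H τ / G τ ^ 2))
        (Filter.Eventually.of_forall fun τ hτ ↦ by
          have h0 : H τ / G τ ^ 2 ≤ 0 :=
            div_nonpos_of_nonpos_of_nonneg (hs τ (Set.Ioc_subset_Icc_self hτ)) (sq_nonneg _)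
          rw [Real.norm_eq_abs, abs_mul, abs_of_nonpos h0]
          exact mul_le_of_le_one_left (by linarith) (Real.abs_cos_le_one _))
        hHG.neg.intervalIntegrable
      rw [intervalIntegral.integral_neg, e1, Real.norm_eq_abs] at this
      linarith
  have e4 : |Real.cos (φ b) * (G b)⁻¹| ≤ 1 := by
    rw [abs_mul, abs_of_pos hib.1]
    exact mul_le_one₀ (Real.abs_cos_le_one _) hib.1.le hib.2
  have e5 : |Real.cos (φ a) * (G a)⁻¹| ≤ 1 := by
    rw [abs_mul, abs_of_pos hia.1]
    exact mul_le_one₀ (Real.abs_cos_le_one _) hia.1.le hia.2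
  rw [abs_le] at *
  constructor <;> linarith

theorem integral_sin_neg (φ : ℝ → ℝ) (a b : ℝ) :
    |∫ τ in a..b, Real.sin (-φ τ)| = |∫ τ in a..b, Real.sin (φ τ)| := by
  simp only [Real.sin_neg]
  rw [intervalIntegral.integral_neg, abs_neg]

/-- G is increasing, so the interval splits into G ≤ -1, |G| ≤ 1 and G ≥ 1. The outer pieces cost 3
each, and `hstat` supplies the bound `L` near the stationary point. -/
theorem abs_integral_sin_le_of_nonneg (hφ : ∀ τ, HasDerivAt φ (G τ) τ)
    (hG : ∀ τ, HasDerivAt G (H τ) τ) (hH : Continuous H) (hab : a ≤ b)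
    (hs : ∀ τ ∈ Set.Icc a b, 0 ≤ H τ) (hL : 0 ≤ L)
    (hstat : ∀ c e, a ≤ c → c ≤ e → e ≤ b → (∀ τ ∈ Set.Icc c e, |G τ| ≤ 1) →
      |∫ τ in c..e, Real.sin (φ τ)| ≤ L) :
    |∫ τ in a..b, Real.sin (φ τ)| ≤ 6 + L := by
  have hφc : Continuous φ := continuous_iff_continuousAt.2 fun τ ↦ (hφ τ).continuousAt
  have hGc : Continuous G := continuous_iff_continuousAt.2 fun τ ↦ (hG τ).continuousAt
  have hsin : Continuous fun τ ↦ Real.sin (φ τ) := Real.continuous_sin.comp hφc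
  have hmono : MonotoneOn G (Set.Icc a b) := by
    refine monotoneOn_of_hasDerivWithinAt_nonneg (convex_Icc a b) hGc.continuousOn
      (fun τ _ ↦ (hG τ).hasDerivWithinAt) fun τ hτ ↦ ?_
    rw [interior_Icc] at hτ
    exact hs τ (Set.Ioo_subset_Icc_self hτ)
  refine (abs_integral_le_of_split hab hsin hGc hmono 1 (M₁ := 3 + L) (M₂ := 3) (by linarith)
    (by norm_num) (fun e hae heb h ↦ ?_) (fun e hae heb h ↦ ?_)).trans_eq (by ring)
  · refine abs_integral_le_of_split hae hsin hGc
      (hmono.mono (Set.Icc_subset_Icc_right heb)) (-1) (by norm_num) hL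
      (fun e' hae' he'e h' ↦ ?_) (fun e' hae' he'e h' ↦ ?_)
    · rw [← integral_sin_neg]
      exact abs_integral_sin_le_of_one_le (φ := fun τ ↦ -φ τ) (G := fun τ ↦ -G τ)
        (H := fun τ ↦ -H τ) (fun τ ↦ (hφ τ).neg) (fun τ ↦ (hG τ).neg) hH.neg hae'
        (fun τ hτ ↦ by linarith [h' τ hτ])
        (Or.inr fun τ hτ ↦ by linarith [hs τ ⟨hτ.1, hτ.2.trans (he'e.trans heb)⟩])
    · exact hstat e' e hae' he'e heb fun τ hτ ↦
        abs_le.2 ⟨h' τ hτ, h τ ⟨hae'.trans hτ.1, hτ.2⟩⟩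
  · exact abs_integral_sin_le_of_one_le hφ hG hH heb h
      (Or.inl fun τ hτ ↦ hs τ ⟨hae.trans hτ.1, hτ.2⟩)

theorem abs_integral_sin_le_of_nonpos (hφ : ∀ τ, HasDerivAt φ (G τ) τ)
    (hG : ∀ τ, HasDerivAt G (H τ) τ) (hH : Continuous H) (hab : a ≤ b)
    (hs : ∀ τ ∈ Set.Icc a b, H τ ≤ 0) (hL : 0 ≤ L)
    (hstat : ∀ c e, a ≤ c → c ≤ e → e ≤ b → (∀ τ ∈ Set.Icc c e, |G τ| ≤ 1) →
      |∫ τ in c..e, Real.sin (φ τ)| ≤ L) :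
    |∫ τ in a..b, Real.sin (φ τ)| ≤ 6 + L := by
  rw [← integral_sin_neg]
  refine abs_integral_sin_le_of_nonneg (φ := fun τ ↦ -φ τ) (G := fun τ ↦ -G τ)
    (H := fun τ ↦ -H τ) (fun τ ↦ (hφ τ).neg) (fun τ ↦ (hG τ).neg) hH.neg hab
    (fun τ hτ ↦ by linarith [hs τ hτ]) hL fun c e h1 h2 h3 h ↦ ?_
  rw [integral_sin_neg]
  exact hstat c e h1 h2 h3 fun τ hτ ↦ by simpa using h τ hτ

/-- H has the sign of the monotone function `h`, so it changes sign at most once, and the one-signed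
case applies on either side. -/
theorem abs_integral_sin_le_of_monotone {h : ℝ → ℝ} (hφ : ∀ τ, HasDerivAt φ (G τ) τ)
    (hG : ∀ τ, HasDerivAt G (H τ) τ) (hH : Continuous H) (hab : a ≤ b)
    (hh : Continuous h) (hm : MonotoneOn h (Set.Icc a b))
    (hHh : ∀ τ, H τ = Real.exp τ * h τ) (hL : 0 ≤ L)
    (hstat : ∀ c e, a ≤ c → c ≤ e → e ≤ b → (∀ τ ∈ Set.Icc c e, |G τ| ≤ 1) →
      |∫ τ in c..e, Real.sin (φ τ)| ≤ L) :
    |∫ τ in a..b, Real.sin (φ τ)| ≤ (6 + L) + (6 + L) := by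
  have hφc : Continuous φ := continuous_iff_continuousAt.2 fun τ ↦ (hφ τ).continuousAt
  refine abs_integral_le_of_split hab (Real.continuous_sin.comp hφc) hh hm 0 (by linarith)
    (by linarith) (fun e hae heb h0 ↦ ?_) (fun e hae heb h0 ↦ ?_)
  · refine abs_integral_sin_le_of_nonpos hφ hG hH hae (fun τ hτ ↦ ?_) hL
      fun c e' h1 h2 h3 ↦ hstat c e' h1 h2 (h3.trans heb)
    rw [hHh]
    exact mul_nonpos_of_nonneg_of_nonpos (Real.exp_pos τ).le (h0 τ hτ)
  · refine abs_integral_sin_le_of_nonneg hφ hG hH heb (fun τ hτ ↦ ?_) hL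
      fun c e' h1 h2 h3 ↦ hstat c e' (hae.trans h1) h2 h3
    rw [hHh]
    exact mul_nonneg (Real.exp_pos τ).le (h0 τ hτ)

end

theorem abs_integral_sin_comp_le_length {φ : ℝ → ℝ} {c e : ℝ} (h : c ≤ e) :
    |∫ τ in c..e, Real.sin (φ τ)| ≤ e - c := by
  have := intervalIntegral.norm_integral_le_of_norm_le_const (a := c) (b := e) (C := 1)
    (f := fun τ ↦ Real.sin (φ τ)) fun τ _ ↦ Real.abs_sin_le_one _
  rwa [Real.norm_eq_abs, abs_of_nonneg (sub_nonneg.2 h), one_mul] at this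

/-- The model phase is its own derivative. Where it is at most 1 in modulus, |sin| is bounded by
|x|e^τ, whose integral is at most its value at the right end. -/
theorem abs_integral_sin_mul_exp_le (x : ℝ) {a b : ℝ} (hab : a ≤ b) :
    |∫ τ in a..b, Real.sin (x * Real.exp τ)| ≤ 7 := by
  have hd : ∀ τ, HasDerivAt (fun τ ↦ x * Real.exp τ) (x * Real.exp τ) τ := fun τ ↦
    (Real.hasDerivAt_exp τ).const_mul x
  have hc : Continuous fun τ ↦ x * Real.exp τ := by fun_prop
  have hstat : ∀ c e, a ≤ c → c ≤ e → e ≤ b → (∀ τ ∈ Set.Icc c e, |x * Real.exp τ| ≤ 1) →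
      |∫ τ in c..e, Real.sin (x * Real.exp τ)| ≤ 1 := by
    intro c e _ hce _ h
    have := intervalIntegral.norm_integral_le_of_norm_le (μ := volume) hce
      (f := fun τ ↦ Real.sin (x * Real.exp τ)) (g := fun τ ↦ |x| * Real.exp τ)
      (Filter.Eventually.of_forall fun τ _ ↦ by
        rw [Real.norm_eq_abs]
        refine Real.abs_sin_le_abs.trans_eq ?_
        rw [abs_mul, Real.abs_exp]) 
      ((by fun_prop : Continuous fun τ ↦ |x| * Real.exp τ).intervalIntegrable _ _)
    rw [intervalIntegral.integral_const_mul, integral_exp, Real.norm_eq_abs] at this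
    have h2 := h e (Set.right_mem_Icc.2 hce)
    rw [abs_mul, Real.abs_exp] at h2
    have : 0 ≤ |x| * Real.exp c := by positivity
    linarith
  rcases le_total 0 x with hx | hx
  · exact (abs_integral_sin_le_of_nonneg hd hd hc hab (fun τ _ ↦ by positivity) zero_le_one
      hstat).trans_eq (by norm_num)
  · exact (abs_integral_sin_le_of_nonpos hd hd hc hab
      (fun τ _ ↦ mul_nonpos_of_nonpos_of_nonneg hx (Real.exp_pos τ).le) zero_le_one
      hstat).trans_eq (by norm_num)

/-- G - 8τ² is convex; comparing its midpoint value with the mean of its end values gives 2(e-c)² ≤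
2. -/
theorem length_le_of_second_deriv {G H K : ℝ → ℝ} (hG : ∀ τ, HasDerivAt G (H τ) τ)
    (hH : ∀ τ, HasDerivAt H (K τ) τ) {c e : ℝ} (hce : c ≤ e)
    (h1 : ∀ τ ∈ Set.Icc c e, |G τ| ≤ 1) (hK : ∀ τ ∈ Set.Icc c e, 16 ≤ K τ) : e - c ≤ 1 := by
  have hd1 : ∀ τ, HasDerivAt (fun τ ↦ G τ - 8 * τ ^ 2) (H τ - 16 * τ) τ := fun τ ↦ by
    refine ((hG τ).sub ((hasDerivAt_pow 2 τ).const_mul 8)).congr_deriv ?_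
    push_cast
    ring
  have hd2 : ∀ τ, HasDerivAt (fun τ ↦ H τ - 16 * τ) (K τ - 16) τ := fun τ ↦ by
    refine ((hH τ).sub ((hasDerivAt_id τ).const_mul 16)).congr_deriv ?_
    ring
  have hconv : ConvexOn ℝ (Set.Icc c e) fun τ ↦ G τ - 8 * τ ^ 2 := by
    refine convexOn_of_hasDerivWithinAt2_nonneg (convex_Icc c e)
      (continuous_iff_continuousAt.2 fun τ ↦ (hd1 τ).continuousAt).continuousOn
      (fun τ _ ↦ (hd1 τ).hasDerivWithinAt) (fun τ _ ↦ (hd2 τ).hasDerivWithinAt) fun τ hτ ↦ ?_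
    rw [interior_Icc] at hτ
    linarith [hK τ (Set.Ioo_subset_Icc_self hτ)]
  have hc := Set.left_mem_Icc.2 hce
  have he := Set.right_mem_Icc.2 hce
  have := hconv.2 hc he (by norm_num : (0 : ℝ) ≤ 1 / 2) (by norm_num : (0 : ℝ) ≤ 1 / 2)
    (by norm_num)
  simp only [smul_eq_mul] at this
  have hm := h1 (1 / 2 * c + 1 / 2 * e) ⟨by linarith, by linarith⟩
  have h2 := h1 c hc
  have h3 := h1 e he
  rw [abs_le] at hm h2 h3
  nlinarith

/-- G + τ decreases, so e - c is at most the drop G(c) - G(e) ≤ 2. -/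
theorem length_le_of_deriv {G H : ℝ → ℝ} (hG : ∀ τ, HasDerivAt G (H τ) τ) {c e : ℝ} (hce : c ≤ e)
    (h1 : ∀ τ ∈ Set.Icc c e, |G τ| ≤ 1) (hH : ∀ τ ∈ Set.Icc c e, H τ ≤ -1) : e - c ≤ 2 := by
  have hd : ∀ τ, HasDerivAt (fun τ ↦ G τ + τ) (H τ + 1) τ := fun τ ↦ (hG τ).add (hasDerivAt_id τ)
  have hanti : AntitoneOn (fun τ ↦ G τ + τ) (Set.Icc c e) := by
    refine antitoneOn_of_hasDerivWithinAt_nonpos (convex_Icc c e)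
      (continuous_iff_continuousAt.2 fun τ ↦ (hd τ).continuousAt).continuousOn
      (fun τ _ ↦ (hd τ).hasDerivWithinAt) fun τ hτ ↦ ?_
    rw [interior_Icc] at hτ
    linarith [hH τ (Set.Ioo_subset_Icc_self hτ)]
  have hc := Set.left_mem_Icc.2 hce
  have he := Set.right_mem_Icc.2 hce
  have := hanti hc he hce
  simp only at this
  have h2 := h1 c hc
  have h3 := h1 e he
  rw [abs_le] at h2 h3
  linarith

/-- H = φ'' is e^τ times an increasing function, so the derivative test applies once the set |φ'| ≤
1 is known to be short. That holds where te^{3τ} ≥ 1, by the third derivative, and where te^{3τ} ≤ 1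
but be^{-τ} ≥ 4, by the second. In the remaining range both terms are small and integrable, and φ is
compared with xe^τ. -/
theorem abs_integral_sin_phase_le (x : ℝ) {t b : ℝ} (ht : 0 < t) (hb : 0 ≤ b) {α β : ℝ}
    (hαβ : α ≤ β) :
    |∫ τ in α..β, Real.sin (x * Real.exp τ + t * Real.exp (3 * τ) - b * Real.exp (-τ))| ≤ 42 := by
  have d3 : ∀ (k τ : ℝ), HasDerivAt (fun τ ↦ k * Real.exp (3 * τ)) (3 * k * Real.exp (3 * τ)) τ :=
    fun k τ ↦ by
      refine ((((hasDerivAt_id τ).const_mul 3).exp).const_mul k).congr_deriv ?_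
      simp only [id]
      ring
  have d1 : ∀ (k τ : ℝ), HasDerivAt (fun τ ↦ k * Real.exp τ) (k * Real.exp τ) τ := fun k τ ↦
    (Real.hasDerivAt_exp τ).const_mul k
  have dn : ∀ (k τ : ℝ), HasDerivAt (fun τ ↦ k * Real.exp (-τ)) (-(k * Real.exp (-τ))) τ :=
    fun k τ ↦ by
      exact (((hasDerivAt_neg τ).exp).const_mul k).congr_deriv (by ring)
  set φ : ℝ → ℝ := fun τ ↦ x * Real.exp τ + t * Real.exp (3 * τ) - b * Real.exp (-τ) with hφ
  set G : ℝ → ℝ := fun τ ↦ x * Real.exp τ + 3 * t * Real.exp (3 * τ) + b * Real.exp (-τ) with hG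
  set H : ℝ → ℝ := fun τ ↦ x * Real.exp τ + 9 * t * Real.exp (3 * τ) - b * Real.exp (-τ) with hH
  set K : ℝ → ℝ := fun τ ↦ x * Real.exp τ + 27 * t * Real.exp (3 * τ) + b * Real.exp (-τ) with hK
  have hφd : ∀ τ, HasDerivAt φ (G τ) τ := fun τ ↦ by
    refine (((d1 x τ).add (d3 t τ)).sub (dn b τ)).congr_deriv ?_
    simp only [hG]
    ring
  have hGd : ∀ τ, HasDerivAt G (H τ) τ := fun τ ↦ by
    refine (((d1 x τ).add (d3 (3 * t) τ)).add (dn b τ)).congr_deriv ?_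
    simp only [hH]
    ring
  have hHd : ∀ τ, HasDerivAt H (K τ) τ := fun τ ↦ by
    refine (((d1 x τ).add (d3 (9 * t) τ)).sub (dn b τ)).congr_deriv ?_
    simp only [hK]
    ring
  have hHc : Continuous H := by fun_prop
  have hsin : Continuous fun τ ↦ Real.sin (φ τ) := by fun_prop
  set h : ℝ → ℝ := fun τ ↦ x + 9 * t * Real.exp (2 * τ) - b * Real.exp (-(2 * τ)) with hh
  have hhc : Continuous h := by fun_prop
  have hhm : Monotone h := fun τ σ hτσ ↦ by
    simp only [hh]
    gcongr
  have hHh : ∀ τ, H τ = Real.exp τ * h τ := fun τ ↦ by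
    simp only [hH, hh]
    rw [show 3 * τ = τ + 2 * τ by ring, show -τ = τ + -(2 * τ) by ring, Real.exp_add, Real.exp_add]
    ring
  have hBm : Monotone fun τ ↦ t * Real.exp (3 * τ) := fun τ σ hτσ ↦ by
    simp only
    gcongr
  have hDm : Monotone fun τ ↦ -(b * Real.exp (-τ)) := fun τ σ hτσ ↦ by
    simp only
    gcongr
  have hB0 : ∀ τ, 0 < t * Real.exp (3 * τ) := fun τ ↦ by positivity
  have hD0 : ∀ τ, 0 ≤ b * Real.exp (-τ) := fun τ ↦ by positivity
  -- Here 14 = 2(6 + 1), 16 = 2(6 + 2), and 12 bounds 7 + 4 + 1/3; the total is 16 + 12 + 14 = 42.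
  refine (abs_integral_le_of_split hαβ hsin (by fun_prop) (hBm.monotoneOn _) 1 (M₁ := 28)
    (M₂ := 14) (by norm_num) (by norm_num) (fun e hae heb hB ↦ ?_)
    (fun e hae heb hB ↦ ?_)).trans_eq (by norm_num)
  · refine (abs_integral_le_of_split hae hsin (by fun_prop) (hDm.monotoneOn _) (-4) (M₁ := 16)
      (M₂ := 12) (by norm_num) (by norm_num) (fun e' hae' he'e hD ↦ ?_)
      (fun e' hae' he'e hD ↦ ?_)).trans_eq (by norm_num)
    · refine (abs_integral_sin_le_of_monotone hφd hGd hHc hae' hhc (hhm.monotoneOn _) hHh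
        zero_le_two fun c k h1 h2 h3 hG1 ↦ ?_).trans_eq (by norm_num)
      refine (abs_integral_sin_comp_le_length h2).trans
        (length_le_of_deriv hGd h2 hG1 fun τ hτ ↦ ?_)
      have i1 := hB τ ⟨h1.trans hτ.1, hτ.2.trans (h3.trans he'e)⟩
      have i2 := hD τ ⟨h1.trans hτ.1, hτ.2.trans h3⟩
      have i3 := (abs_le.1 (hG1 τ hτ)).2
      simp only [hG, hH] at i1 i2 i3 ⊢
      linarith
    · have hB' : ∀ τ ∈ Set.Icc e' e, t * Real.exp (3 * τ) ≤ 1 := fun τ hτ ↦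
        hB τ ⟨hae'.trans hτ.1, hτ.2⟩
      -- Sine is 1-Lipschitz, so replacing φ by xe^τ costs at most the integral of te^{3τ} +
      -- be^{-τ}. This is at most 1/3 + 4 from the values at the ends.
      have hdiff := intervalIntegral.norm_integral_le_of_norm_le (μ := volume) he'e
        (f := fun τ ↦ Real.sin (φ τ) - Real.sin (x * Real.exp τ))
        (g := fun τ ↦ t * Real.exp (3 * τ) + b * Real.exp (-τ))
        (Filter.Eventually.of_forall fun τ _ ↦ by
          have := Real.lipschitzWith_sin.dist_le_mul (φ τ) (x * Real.exp τ)
          rw [NNReal.coe_one, one_mul, Real.dist_eq, Real.dist_eq] at this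
          rw [Real.norm_eq_abs]
          refine this.trans (abs_le.2 ⟨?_, ?_⟩) <;>
          · simp only [hφ]
            linarith [hB0 τ, hD0 τ])
        ((by fun_prop : Continuous fun τ ↦
          t * Real.exp (3 * τ) + b * Real.exp (-τ)).intervalIntegrable _ _)
      have hint : ∫ τ in e'..e, (t * Real.exp (3 * τ) + b * Real.exp (-τ)) =
          (t / 3 * Real.exp (3 * e) - b * Real.exp (-e)) -
          (t / 3 * Real.exp (3 * e') - b * Real.exp (-e')) := by
        refine intervalIntegral.integral_eq_sub_of_hasDerivAt
          (f := fun τ ↦ t / 3 * Real.exp (3 * τ) - b * Real.exp (-τ)) (fun τ _ ↦ ?_)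
          ((by fun_prop : Continuous fun τ ↦
            t * Real.exp (3 * τ) + b * Real.exp (-τ)).intervalIntegrable _ _)
        exact ((d3 (t / 3) τ).sub (dn b τ)).congr_deriv (by ring)
      rw [intervalIntegral.integral_sub (hsin.intervalIntegrable _ _)
        ((by fun_prop : Continuous fun τ ↦ Real.sin (x * Real.exp τ)).intervalIntegrable _ _),
        hint, Real.norm_eq_abs] at hdiff
      have i1 := hB' e (Set.right_mem_Icc.2 he'e)
      have i2 := hD e' (Set.left_mem_Icc.2 he'e)
      have i3 := abs_integral_sin_mul_exp_le x he'e
      have i4 := hB0 e'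
      have i5 := hD0 e
      rw [abs_le] at hdiff i3 ⊢
      constructor <;> linarith
  -- Here K = G + 24te^{3τ} ≥ -1 + 24, more than the 16 needed.
  · refine (abs_integral_sin_le_of_monotone hφd hGd hHc heb hhc (hhm.monotoneOn _) hHh
      zero_le_one fun c k h1 h2 h3 hG1 ↦ ?_).trans_eq (by norm_num)
    refine (abs_integral_sin_comp_le_length h2).trans
      (length_le_of_second_deriv hGd hHd h2 hG1 fun τ hτ ↦ ?_)
    have i1 := hB τ ⟨h1.trans hτ.1, hτ.2.trans h3⟩
    have i3 := (abs_le.1 (hG1 τ hτ)).1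
    simp only [hG, hK] at i1 i3 ⊢
    linarith

end

/-! ### The endpoint in dimension three -/

/-- Only the limiting kernel satisfies the good bound `M`. The uniform bound `B` may be large: it
serves only to pass to the limit under the integral, and does not enter the conclusion. -/
theorem UnitMultiplier.norm_op_le_of_tendsto_kernel {d : ℕ} {m : ℕ → UnitMultiplier d}
    {m' : UnitMultiplier d} (hm : ∀ n, Integrable (m n).toFun)
    (hlim : ∀ ζ, Filter.Tendsto (fun n ↦ (m n).toFun ζ) Filter.atTop (nhds (m'.toFun ζ)))
    {B M : ℝ} (hB : ∀ n x, ‖𝓕⁻ (m n).toFun x‖ ≤ B) {K : Space d → ℂ}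
    (hK : ∀ x, Filter.Tendsto (fun n ↦ 𝓕⁻ (m n).toFun x) Filter.atTop (nhds (K x)))
    (hM : ∀ x, ‖K x‖ ≤ M) (h : L2 d) (hh : Integrable h) :
    ∀ᵐ x, ‖m'.op h x‖ ≤ M * ∫ y, ‖h y‖ := by
  have hact : Filter.Tendsto (fun n ↦ (m n).act (𝓕 h)) Filter.atTop (nhds (m'.act (𝓕 h))) := by
    refine tendsto_act ?_
    filter_upwards [m'.coeFn_act (𝓕 h)] with ζ hζ
    rw [hζ]
    exact (hlim ζ).mul_const _
  have hop : Filter.Tendsto (fun n ↦ (m n).op h) Filter.atTop (nhds (m'.op h)) :=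
    ((Lp.fourierTransformₗᵢ (Space d) ℂ).symm.continuous.tendsto _).comp hact
  obtain ⟨φ, hφ, hae⟩ := (tendstoInMeasure_of_tendsto_Lp hop).exists_seq_tendsto_ae
  have hall : ∀ᵐ x, ∀ n, (m n).op h x = ∫ y, 𝓕⁻ (m n).toFun (x - y) * h y :=
    ae_all_iff.2 fun n ↦ (m n).op_ae_eq (hm n) h hh
  filter_upwards [hae, hall] with x hx hall
  have hdct : Filter.Tendsto (fun n ↦ ∫ y, 𝓕⁻ (m n).toFun (x - y) * h y) Filter.atTop
      (nhds (∫ y, K (x - y) * h y)) := by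
    refine tendsto_integral_of_dominated_convergence (fun y ↦ B * ‖h y‖) (fun n ↦ ?_)
      (hh.norm.const_mul B) (fun n ↦ Filter.Eventually.of_forall fun y ↦ ?_)
      (Filter.Eventually.of_forall fun y ↦ (hK (x - y)).mul_const _)
    · have hc : Continuous (𝓕⁻ (m n).toFun) := by
        have := (continuous_fourier_of_integrable (hm n)).comp continuous_neg
        refine this.congr fun z ↦ ?_
        rw [Function.comp_apply, ← Real.fourierInv_eq_fourier_neg]
      exact (hc.comp (continuous_const.sub continuous_id)).aestronglyMeasurable.mul
        (Lp.aestronglyMeasurable h)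
    · rw [norm_mul]
      exact mul_le_mul_of_nonneg_right (hB n _) (norm_nonneg _)
  have heq : m'.op h x = ∫ y, K (x - y) * h y := by
    simp only [hall] at hx
    exact tendsto_nhds_unique hx (hdct.comp hφ.tendsto_atTop)
  rw [heq, ← integral_const_mul]
  refine norm_integral_le_of_norm_le (hh.norm.const_mul M) (Filter.Eventually.of_forall fun y ↦ ?_)
  rw [norm_mul]
  exact mul_le_mul_of_nonneg_right (hM _) (norm_nonneg _)

/-- The coefficients t and b/t have the same sign, and the sine is odd, so t < 0 reduces to t > 0 on
changing the sign of the whole phase. -/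
theorem abs_integral_sin_phase_le_of_ne (x : ℝ) {t b : ℝ} (ht : t ≠ 0) (hb : 0 ≤ b) {α β : ℝ}
    (hαβ : α ≤ β) :
    |∫ τ in α..β, Real.sin (x * Real.exp τ + t * Real.exp (3 * τ) - b / t * Real.exp (-τ))| ≤
      42 := by
  rcases ht.lt_or_gt with h | h
  · rw [← integral_sin_neg]
    have := abs_integral_sin_phase_le (-x) (t := -t) (b := b / -t) (by linarith)
      (div_nonneg hb (by linarith)) hαβ
    convert this using 5
    rw [div_neg]
    ring
  · exact abs_integral_sin_phase_le x h (by positivity) hαβ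

/-- The substitution r = e^τ absorbs dr/r. -/
theorem abs_integral_sin_div_le (x : ℝ) {t b : ℝ} (ht : t ≠ 0) (hb : 0 ≤ b) {δ R : ℝ}
    (hδ : 0 < δ) (hR : δ ≤ R) :
    |∫ r in δ..R, Real.sin (x * r + t * r ^ 3 - b / t / r) / r| ≤ 42 := by
  have hR0 : 0 < R := hδ.trans_le hR
  have hcont : ContinuousOn (fun r : ℝ ↦ Real.sin (x * r + t * r ^ 3 - b / t / r) / r)
      (Real.exp '' Set.uIcc (Real.log δ) (Real.log R)) := by
    have h0 : ∀ r ∈ Real.exp '' Set.uIcc (Real.log δ) (Real.log R), r ≠ 0 := by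
      rintro _ ⟨τ, -, rfl⟩
      exact (Real.exp_pos τ).ne'
    refine ContinuousOn.div (Real.continuous_sin.comp_continuousOn ?_) continuousOn_id h0
    exact ContinuousOn.sub (by fun_prop) (continuousOn_const.div continuousOn_id h0)
  have := intervalIntegral.integral_comp_mul_deriv' (f := Real.exp) (f' := Real.exp)
    (g := fun r ↦ Real.sin (x * r + t * r ^ 3 - b / t / r) / r) (a := Real.log δ)
    (b := Real.log R) (fun τ _ ↦ Real.hasDerivAt_exp τ) Real.continuous_exp.continuousOn hcont
  rw [Real.exp_log hδ, Real.exp_log hR0] at this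
  rw [← this]
  convert abs_integral_sin_phase_le_of_ne x ht hb (Real.log_le_log hδ hR) using 4 with τ
  have e3 : Real.exp (3 * τ) = Real.exp τ ^ 3 := by rw [← Real.exp_nat_mul]; norm_num
  rw [Function.comp_apply, div_mul_cancel₀ _ (Real.exp_pos τ).ne', e3, Real.exp_neg]
  rfl

/-! ### The kernel cut off to a band of first frequencies -/

/-- The frequencies of the first variable between `δ` and `R`. -/
def band (δ R : ℝ) : Set ℝ := {ξ | |2 * Real.pi * ξ| ∈ Set.Icc δ R}

theorem measurableSet_band (δ R : ℝ) : MeasurableSet (band δ R) :=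
  (by fun_prop : Measurable fun ξ : ℝ ↦ |2 * Real.pi * ξ|) measurableSet_Icc

theorem integrable_indicator_band (δ R : ℝ) : Integrable ((band δ R).indicator (1 : ℝ → ℝ)) := by
  rw [integrable_indicator_iff (measurableSet_band δ R)]
  refine integrableOn_const (ne_top_of_le_ne_top
    (measure_Icc_lt_top (a := -(R / (2 * Real.pi))) (b := R / (2 * Real.pi))).ne
    (measure_mono fun ξ hξ ↦ ?_)) (by simp)
  have h2 : |2 * Real.pi * ξ| ≤ R := hξ.2
  rw [abs_mul, abs_of_pos (by positivity)] at h2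
  rw [Set.mem_Icc, ← abs_le, le_div_iff₀ (by positivity)]
  linarith

theorem partialKernel_two (t ε : ℝ) (x : Space (2 + 1)) (ξ : ℝ) :
    partialKernel 2 t ε x ξ =
      Real.pi / ((2 * Real.pi : ℝ) ^ 2 * (ε - 2 * Real.pi * t * ξ * Complex.I)) *
      Complex.exp (-(‖tailSpace x‖ ^ 2 : ℝ) / (4 * (ε - 2 * Real.pi * t * ξ * Complex.I))) := by
  rw [partialKernel, Nat.cast_ofNat, div_self two_ne_zero, Complex.cpow_one]

theorem partialKernel_two_zero {t ξ : ℝ} (ht : t ≠ 0) (hξ : ξ ≠ 0) (x : Space (2 + 1)) :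
    partialKernel 2 t 0 x ξ = Complex.I / (8 * Real.pi ^ 2 * t * ξ) *
      Complex.exp ((-(‖tailSpace x‖ ^ 2 / (8 * Real.pi * t * ξ)) : ℝ) * Complex.I) := by
  have ht' : (t : ℂ) ≠ 0 := by exact_mod_cast ht
  have hξ' : (ξ : ℂ) ≠ 0 := by exact_mod_cast hξ
  have hpi : (Real.pi : ℂ) ≠ 0 := by exact_mod_cast Real.pi_ne_zero
  have hI := Complex.I_ne_zero
  rw [partialKernel_two]
  congr 1
  · push_cast
    rw [zero_sub]
    field_simp
    rw [Complex.I_sq]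
    ring
  · congr 1
    push_cast
    rw [zero_sub]
    field_simp
    rw [Complex.I_sq]
    ring

/-- At ε = 0 the partial kernel is an imaginary multiple of 1/(tξ) times a unimodular factor with
phase odd in ξ. The symmetrized integrand is therefore real, and it is the sine integral in r =
2π|ξ|; the bound does not depend on the band. -/
theorem norm_integral_partialKernel_zero_le {t δ R : ℝ} (ht : t ≠ 0) (hδ : 0 < δ) (hR : δ ≤ R)
    (x : Space (2 + 1)) :
    ‖∫ ξ, Complex.exp ((2 * Real.pi * ξ * x 0 + t * (2 * Real.pi * ξ) ^ 3 : ℝ) *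
      Complex.I) * (((band δ R).indicator 1 ξ : ℝ) : ℂ) * partialKernel 2 t 0 x ξ‖ ≤ 2 / |t| := by
  set b := ‖tailSpace x‖ ^ 2 / 4 with hb
  set F : ℝ → ℂ := fun ξ ↦ Complex.exp ((2 * Real.pi * ξ * x 0 + t * (2 * Real.pi * ξ) ^ 3 : ℝ) *
      Complex.I) * (((band δ R).indicator 1 ξ : ℝ) : ℂ) * partialKernel 2 t 0 x ξ with hF
  set f : ℝ → ℝ := (Set.Icc δ R).indicator
    fun r ↦ Real.sin (x 0 * r + t * r ^ 3 - b / t / r) / r with hf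
  have ht' : (t : ℂ) ≠ 0 := by exact_mod_cast ht
  have hpi : (Real.pi : ℂ) ≠ 0 := by exact_mod_cast Real.pi_ne_zero
  have hsym : ∀ ξ, F ξ + F (-ξ) = ((-(1 / (2 * Real.pi * t)) * f |2 * Real.pi * ξ| : ℝ) : ℂ) := by
    intro ξ
    have hneg : -ξ ∈ band δ R ↔ ξ ∈ band δ R := by simp [band]
    by_cases hξ : ξ ∈ band δ R
    · have hξ0 : ξ ≠ 0 := by
        rintro rfl
        have h1 : δ ≤ |2 * Real.pi * 0| := hξ.1
        simp only [mul_zero, abs_zero] at h1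
        linarith
      have hξ' : (ξ : ℂ) ≠ 0 := by exact_mod_cast hξ0
      set Θ := 2 * Real.pi * ξ * x 0 + t * (2 * Real.pi * ξ) ^ 3 -
        ‖tailSpace x‖ ^ 2 / (8 * Real.pi * t * ξ) with hΘ
      have e1 : F ξ = Complex.I / (8 * Real.pi ^ 2 * t * ξ) * Complex.exp (Θ * Complex.I) := by
        rw [hF]
        simp only
        rw [Set.indicator_of_mem hξ, partialKernel_two_zero ht hξ0, Pi.one_apply,
          Complex.ofReal_one, mul_one, mul_left_comm, ← Complex.exp_add, ← add_mul,
          ← Complex.ofReal_add, ← sub_eq_add_neg]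
      have e2 : F (-ξ) =
          -(Complex.I / (8 * Real.pi ^ 2 * t * ξ)) * Complex.exp (-(Θ * Complex.I)) := by
        rw [hF]
        simp only
        rw [Set.indicator_of_mem (hneg.2 hξ), partialKernel_two_zero ht (neg_ne_zero.2 hξ0),
          Pi.one_apply, Complex.ofReal_one, mul_one, mul_left_comm, ← Complex.exp_add, ← add_mul,
          ← Complex.ofReal_add, ← neg_mul, ← Complex.ofReal_neg]
        congr 1
        · push_cast
          rw [mul_neg, div_neg]
        · congr 3
          rw [hΘ, mul_neg, mul_neg, div_neg]
          ring
      have e3 : f |2 * Real.pi * ξ| = Real.sin Θ / (2 * Real.pi * ξ) := by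
        have hΘ' : Θ = x 0 * (2 * Real.pi * ξ) + t * (2 * Real.pi * ξ) ^ 3 -
            b / t / (2 * Real.pi * ξ) := by
          rw [hΘ, hb]
          field_simp
          ring
        rw [hf, Set.indicator_of_mem (show |2 * Real.pi * ξ| ∈ Set.Icc δ R from hξ)]
        rcases abs_choice (2 * Real.pi * ξ) with h | h
        · rw [h, ← hΘ']
        · rw [h, div_neg, ← neg_div, ← Real.sin_neg, hΘ', div_neg]
          congr 2
          ring
      have e4 : ((Real.sin Θ : ℝ) : ℂ) =
          (Complex.exp (-(Θ * Complex.I)) - Complex.exp (Θ * Complex.I)) * Complex.I / 2 := by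
        rw [Complex.ofReal_sin, Complex.sin, neg_mul]
      rw [e1, e2, e3]
      push_cast
      rw [← Complex.ofReal_sin, e4]
      field_simp
      ring
    · have hnξ : -ξ ∉ band δ R := fun h ↦ hξ (hneg.1 h)
      rw [hF, hf, Set.indicator_of_notMem (show |2 * Real.pi * ξ| ∉ Set.Icc δ R from hξ)]
      simp only
      rw [Set.indicator_of_notMem hξ, Set.indicator_of_notMem hnξ]
      simp
  -- Integrability need not be proved: the integral of a non-integrable function is 0 by convention.
  by_cases hi : Integrable F
  · have h1 : 2 * ∫ ξ, F ξ = ((-(1 / (2 * Real.pi * t)) * ∫ ξ, f |2 * Real.pi * ξ| : ℝ) : ℂ) := by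
      rw [← integral_const_mul (-(1 / (2 * Real.pi * t))), ← integral_complex_ofReal, two_mul]
      simp only [← hsym]
      rw [integral_add hi hi.comp_neg, integral_neg_eq_self]
    have hsub : Set.Icc δ R ⊆ Set.Ioi 0 := fun r hr ↦ hδ.trans_le hr.1
    have h2 : ∫ ξ, f |2 * Real.pi * ξ| = 1 / Real.pi * ∫ r in δ..R,
        Real.sin (x 0 * r + t * r ^ 3 - b / t / r) / r := by
      rw [Measure.integral_comp_mul_left (fun r ↦ f |r|), integral_comp_abs, hf,
        setIntegral_indicator measurableSet_Icc, intervalIntegral.integral_of_le hR,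
        Set.inter_eq_right.2 hsub, integral_Icc_eq_integral_Ioc,
        abs_of_pos (by positivity), smul_eq_mul, ← mul_assoc]
      congr 1
      field_simp
    have h3 := abs_integral_sin_div_le (x 0) (b := b) ht (by positivity) hδ hR
    have h4 : 2 * ‖∫ ξ, F ξ‖ ≤ 1 / (2 * Real.pi * |t|) * (1 / Real.pi * 42) := by
      have := congrArg norm h1
      rw [norm_mul, Complex.norm_ofNat, h2, Complex.norm_real, Real.norm_eq_abs, abs_mul, abs_neg,
        abs_mul, abs_of_pos (show 0 < 1 / Real.pi by positivity), abs_div, abs_one, abs_mul,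
        abs_of_pos (show 0 < 2 * Real.pi by positivity)] at this
      rw [this]
      gcongr
    have h5 : 1 / (2 * Real.pi * |t|) * (1 / Real.pi * 42) ≤ 2 * (2 / |t|) := by
      have ht0 : 0 < |t| := abs_pos.2 ht
      have h6 := Real.pi_gt_three
      have h7 : 1 / (2 * Real.pi * |t|) * (1 / Real.pi * 42) = 21 / Real.pi ^ 2 / |t| := by
        field_simp
        norm_num
      rw [h7, ← mul_div_assoc]
      gcongr
      rw [div_le_iff₀ (by positivity)]
      nlinarith
    linarith
  · rw [integral_undef hi, norm_zero]
    positivity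

/-- The Gaussian in the frequencies of nonzero index, cut off to a band of first frequencies. -/
def bandGaussMultiplier (δ R : ℝ) {ε : ℝ} (hε : 0 < ε) : UnitMultiplier (2 + 1) where
  toFun ζ := (((band δ R).indicator 1 (ζ 0) : ℝ) : ℂ) *
    (Real.exp (-(ε * (2 * Real.pi * ‖tailSpace ζ‖) ^ 2)) : ℂ)
  measurable := by
    have h1 : Measurable fun ζ : Space (2 + 1) ↦ (band δ R).indicator (1 : ℝ → ℝ) (ζ 0) :=
      (measurable_one.indicator (measurableSet_band δ R)).comp (by fun_prop)
    have h2 : Measurable (tailSpace : Space (2 + 1) → Space 2) := by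
      unfold tailSpace
      fun_prop
    fun_prop
  norm_le_one ζ := by
    rw [norm_mul, Complex.norm_real, Complex.norm_real, Real.norm_of_nonneg (Real.exp_pos _).le]
    refine mul_le_one₀ ?_ (Real.exp_pos _).le (Real.exp_le_one_iff.2 ?_)
    · by_cases h : ζ 0 ∈ band δ R <;> simp [h]
    · have : 0 ≤ ε * (2 * Real.pi * ‖tailSpace ζ‖) ^ 2 := by positivity
      linarith

/-- The frequencies `ζ` with first coordinate in `band δ R`. -/
def bandSet (δ R : ℝ) : Set (Space (2 + 1)) := {ζ | ζ 0 ∈ band δ R}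

theorem measurableSet_bandSet (δ R : ℝ) : MeasurableSet (bandSet δ R) :=
  (by fun_prop : Measurable fun ζ : Space (2 + 1) ↦ ζ 0) (measurableSet_band δ R)

theorem tailSpace_consSpace {n : ℕ} (ξ : ℝ) (η : Space n) : tailSpace (consSpace ξ η) = η := by
  ext i
  simp [tailSpace, consSpace]

theorem bandGauss_symbol_consSpace (δ R : ℝ) {ε : ℝ} (hε : 0 < ε) (t ξ : ℝ) (η : Space 2) :
    ((phaseMultiplier t).comp (bandGaussMultiplier δ R hε)).toFun (consSpace ξ η) =
      phase t (consSpace ξ η) * ((((band δ R).indicator 1 ξ : ℝ) : ℂ) *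
        (Real.exp (-(ε * (2 * Real.pi * ‖η‖) ^ 2)) : ℂ)) := by
  simp only [UnitMultiplier.comp, phaseMultiplier, bandGaussMultiplier]
  rw [tailSpace_consSpace]
  simp [consSpace]

/-- A crude majorant that degenerates as δ → 0; it is used only for dominated convergence as ε → 0
with the band fixed. -/
theorem norm_partialKernel_two_le {t ε δ R ξ : ℝ} (ht : t ≠ 0) (hε : 0 < ε) (hδ : 0 < δ)
    (hξ : ξ ∈ band δ R) (x : Space (2 + 1)) : ‖partialKernel 2 t ε x ξ‖ ≤ 1 / (|t| * δ) := by
  refine (norm_partialKernel_le hε x ξ).trans ?_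
  have ht' : 0 < |t| := abs_pos.2 ht
  have h1 : (1 / (4 * Real.pi)) ^ ((2 : ℕ) / 2 : ℝ) ≤ 1 := by
    refine Real.rpow_le_one (by positivity) ?_ (by positivity)
    rw [div_le_one (by positivity)]
    linarith [Real.pi_gt_three]
  have h2 : (ε ^ 2 + (2 * Real.pi * t * ξ) ^ 2) ^ (-((2 : ℕ) / 4 : ℝ)) ≤ 1 / (|t| * δ) := by
    have h3 : (|t| * δ) ^ 2 ≤ ε ^ 2 + (2 * Real.pi * t * ξ) ^ 2 := by
      have h4 : |t| * δ ≤ |2 * Real.pi * t * ξ| := by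
        rw [show 2 * Real.pi * t * ξ = t * (2 * Real.pi * ξ) by ring, abs_mul]
        gcongr
        exact hξ.1
      have h5 := pow_le_pow_left₀ (by positivity) h4 2
      rw [sq_abs] at h5
      nlinarith [sq_nonneg ε]
    refine (Real.rpow_le_rpow_of_nonpos (by positivity) h3 (by norm_num)).trans_eq ?_
    rw [← Real.rpow_natCast, ← Real.rpow_mul (by positivity),
      show ((2 : ℕ) : ℝ) * -((2 : ℕ) / 4 : ℝ) = -1 by norm_num, Real.rpow_neg_one, one_div]
  calc _ ≤ 1 * (1 / (|t| * δ)) := by gcongr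
    _ = _ := one_mul _

theorem tendsto_partialKernel_two {t ξ : ℝ} (ht : t ≠ 0) (hξ : ξ ≠ 0) (x : Space (2 + 1))
    {ε : ℕ → ℝ} (hε : Filter.Tendsto ε Filter.atTop (nhds 0)) :
    Filter.Tendsto (fun k ↦ partialKernel 2 t (ε k) x ξ) Filter.atTop
      (nhds (partialKernel 2 t 0 x ξ)) := by
  simp only [partialKernel_two]
  have hw : Filter.Tendsto (fun k ↦ ((ε k : ℂ) - 2 * Real.pi * t * ξ * Complex.I)) Filter.atTop
      (nhds (((0 : ℝ) : ℂ) - 2 * Real.pi * t * ξ * Complex.I)) :=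
    ((Complex.continuous_ofReal.tendsto 0).comp hε).sub_const _
  have hw0 : (((0 : ℝ) : ℂ) - 2 * Real.pi * t * ξ * Complex.I) ≠ 0 := by
    have : (2 * Real.pi * t * ξ : ℂ) ≠ 0 := by
      exact_mod_cast (by positivity : 2 * Real.pi * t * ξ ≠ 0)
    simpa using this
  have hpi : (((2 * Real.pi : ℝ) : ℂ) ^ 2) ≠ 0 := by
    exact_mod_cast (by positivity : (2 * Real.pi) ^ 2 ≠ 0)
  refine (tendsto_const_nhds.div (hw.const_mul _) (mul_ne_zero hpi hw0)).mul
    ((Complex.continuous_exp.tendsto _).comp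
      (tendsto_const_nhds.div (hw.const_mul 4) (mul_ne_zero (by norm_num) hw0)))

/-- The Gaussian in η makes the symbol integrable and its kernel explicit. As ε → 0 the symbols tend
to the sharp cut-off in ξ, and the kernels tend to the integral bounded above. -/
theorem norm_band_op_le {t δ R : ℝ} (ht : t ≠ 0) (hδ : 0 < δ) (hR : δ ≤ R) (h : L2 (2 + 1))
    (hh : Integrable h) :
    ∀ᵐ x, ‖((phaseMultiplier t).comp
      (indicatorMultiplier (measurableSet_bandSet δ R))).op h x‖ ≤ 2 / |t| * ∫ y, ‖h y‖ := by
  have ht' : 0 < |t| := abs_pos.2 ht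
  set ε : ℕ → ℝ := fun k ↦ 1 / ((k : ℝ) + 1) with hε
  have hε0 : ∀ k, 0 < ε k := fun k ↦ by positivity
  have hεlim : Filter.Tendsto ε Filter.atTop (nhds 0) := tendsto_one_div_add_atTop_nhds_zero_nat
  have hχ := integrable_indicator_band δ R
  have hχ01 : ∀ ξ, (band δ R).indicator (1 : ℝ → ℝ) ξ = 1 ∧ ξ ∈ band δ R ∨
      (band δ R).indicator (1 : ℝ → ℝ) ξ = 0 := fun ξ ↦ by
    by_cases hξ : ξ ∈ band δ R
    · exact Or.inl ⟨by simp [hξ], hξ⟩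
    · exact Or.inr (by simp [hξ])
  have hker : ∀ k x, 𝓕⁻ ((phaseMultiplier t).comp (bandGaussMultiplier δ R (hε0 k))).toFun x =
      ∫ ξ, Complex.exp ((2 * Real.pi * ξ * x 0 + t * (2 * Real.pi * ξ) ^ 3 : ℝ) *
      Complex.I) * (((band δ R).indicator 1 ξ : ℝ) : ℂ) * partialKernel 2 t (ε k) x ξ :=
    fun k x ↦ fourierInv_phase_gaussian hχ (hε0 k) t (bandGauss_symbol_consSpace δ R (hε0 k) t) x
  have hbound : ∀ k x ξ, ‖Complex.exp ((2 * Real.pi * ξ * x 0 + t * (2 * Real.pi * ξ) ^ 3 : ℝ) *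
      Complex.I) * (((band δ R).indicator 1 ξ : ℝ) : ℂ) * partialKernel 2 t (ε k) x ξ‖ ≤
      1 / (|t| * δ) * (band δ R).indicator 1 ξ := by
    intro k x ξ
    rw [norm_mul, norm_mul, Complex.norm_exp_ofReal_mul_I, one_mul, Complex.norm_real]
    rcases hχ01 ξ with ⟨h1, hξ⟩ | h1
    · rw [h1, norm_one, one_mul, mul_one]
      exact norm_partialKernel_two_le ht (hε0 k) hδ hξ x
    · rw [h1, norm_zero, zero_mul, mul_zero]
  refine UnitMultiplier.norm_op_le_of_tendsto_kernel
    (m := fun k ↦ (phaseMultiplier t).comp (bandGaussMultiplier δ R (hε0 k)))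
    (B := ∫ ξ, 1 / (|t| * δ) * (band δ R).indicator 1 ξ)
    (K := fun x ↦ ∫ ξ, Complex.exp ((2 * Real.pi * ξ * x 0 + t * (2 * Real.pi * ξ) ^ 3 : ℝ) *
      Complex.I) * (((band δ R).indicator 1 ξ : ℝ) : ℂ) * partialKernel 2 t 0 x ξ)
    (fun k ↦ ?_) (fun ζ ↦ ?_) (fun k x ↦ ?_) (fun x ↦ ?_)
    (norm_integral_partialKernel_zero_le ht hδ hR) h hh
  · rw [← integrable_consSpace_iff]
    simp only [bandGauss_symbol_consSpace]
    exact integrable_phase_gaussian hχ (hε0 k) t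
  · simp only [UnitMultiplier.comp, bandGaussMultiplier, indicatorMultiplier]
    refine Filter.Tendsto.const_mul _ ?_
    have h1 : (bandSet δ R).indicator (1 : Space (2 + 1) → ℂ) ζ =
        (((band δ R).indicator 1 (ζ 0) : ℝ) : ℂ) *
        (Real.exp (-(0 * (2 * Real.pi * ‖tailSpace ζ‖) ^ 2)) : ℂ) := by
      by_cases hζ : ζ ∈ bandSet δ R
      · have hζ' : ζ 0 ∈ band δ R := hζ
        simp [hζ, hζ']
      · have hζ' : ζ 0 ∉ band δ R := hζ
        simp [hζ, hζ']
    rw [h1]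
    refine Filter.Tendsto.const_mul _ ?_
    exact ((by fun_prop : Continuous fun e : ℝ ↦
      ((Real.exp (-(e * (2 * Real.pi * ‖tailSpace ζ‖) ^ 2)) : ℝ) : ℂ)).tendsto 0).comp hεlim
  · rw [hker]
    exact norm_integral_le_of_norm_le (hχ.const_mul _)
      (Filter.Eventually.of_forall (hbound k x))
  · simp only [hker]
    refine tendsto_integral_of_dominated_convergence
      (fun ξ ↦ 1 / (|t| * δ) * (band δ R).indicator 1 ξ) (fun k ↦ ?_) (hχ.const_mul _)
      (fun k ↦ Filter.Eventually.of_forall (hbound k x)) (Filter.Eventually.of_forall fun ξ ↦ ?_)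
    · have hm : Measurable fun ξ ↦ partialKernel 2 t (ε k) x ξ := by
        simp only [partialKernel_two]
        fun_prop
      have hm2 : Measurable ((band δ R).indicator (1 : ℝ → ℝ)) :=
        measurable_one.indicator (measurableSet_band δ R)
      exact Measurable.aestronglyMeasurable (by fun_prop)
    · rcases hχ01 ξ with ⟨h1, hξ⟩ | h1
      · have hξ0 : ξ ≠ 0 := by
          rintro rfl
          have h1 : δ ≤ |2 * Real.pi * 0| := hξ.1
          simp only [mul_zero, abs_zero] at h1
          linarith
        exact (tendsto_partialKernel_two ht hξ0 x hεlim).const_mul _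
      · simp only [h1, Complex.ofReal_zero, mul_zero, zero_mul]
        exact tendsto_const_nhds

theorem ae_coord_ne_zero {d : ℕ} [NeZero d] : ∀ᵐ ζ : Space d, ζ 0 ≠ 0 := by
  have hne : LinearMap.ker (EuclideanSpace.proj (𝕜 := ℝ) (0 : Fin d)).toLinearMap ≠ ⊤ := by
    intro h
    have h1 := LinearMap.ker_eq_top.1 h
    have h2 := LinearMap.congr_fun h1 (EuclideanSpace.single 0 (1 : ℝ))
    simp at h2
  have := Measure.addHaar_submodule (volume : Measure (Space d)) _ hne
  rw [ae_iff]
  refine measure_mono_null (fun ζ hζ ↦ ?_) this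
  simpa using hζ

/-- On this edge σ = 1 and s = 0. The band cut-off has kernel decay 2/|t| uniformly in the band, so
the estimate holds with one constant for all bands, which then exhaust frequency space. -/
theorem exists_strichartz_endpoint {a b : ℝ} (ha : 0 < a) (hb : 0 < b) (hab : a + b = 1 / 2) :
    ∃ C : ℝ≥0, ∀ u : L2 (2 + 1),
      strichartzNorm (ENNReal.ofReal (1 / b)) (ENNReal.ofReal (1 / a)) (fun t ↦ U t u) ≤
        C * sobolevNorm 0 u := by
  have hq : 2 < 1 / a := by rw [lt_div_iff₀ ha]; linarith
  have hr : 2 < 1 / b := by rw [lt_div_iff₀ hb]; linarith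
  have hexp : -(2 * (1 / a) / (1 / b * (1 / a - 2))) = -1 := by
    have h3 : 1 / a - 2 ≠ 0 := by linarith
    have h4 : 1 - 2 * a ≠ 0 := by linarith
    have h5 : b = (1 - 2 * a) / 2 := by linarith
    rw [h5]
    field_simp
  obtain ⟨C₁, -, h1⟩ := exists_integral_norm_le (2 + 1)
  set D : ℝ := ((4 * (1 / a) / (1 / a - 2) * 2 ^ (1 / a - 2)) ^ (1 / (1 / a)) *
    rieszConst (1 / b)) ^ (1 / 2 : ℝ) * 2 ^ ((1 / 2 - 1 / (1 / a) : ℝ)) with hD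
  have hrc := rieszConst_pos hr
  have hD0 : 0 ≤ D := by
    have : 0 < 1 / a - 2 := by linarith
    positivity
  refine ⟨D.toNNReal, fun u ↦ ?_⟩
  have hrhs : (D.toNNReal : ℝ≥0∞) * sobolevNorm 0 u = ENNReal.ofReal (D * ‖u‖) := by
    rw [sobolevNorm_zero, ENNReal.ofReal_mul hD0]
    rfl
  rw [hrhs]
  set g : L2 (2 + 1) := 𝓕 u with hg
  set S : ℕ → Set (Space (2 + 1)) := fun k ↦ bandSet (1 / ((k : ℝ) + 1)) (k + 1) with hS
  have hSm : ∀ k, MeasurableSet (S k) := fun k ↦ measurableSet_bandSet _ _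
  -- Truncation to a ball makes the data integrable in frequency, hence the flow bounded, as the T
  -- T* argument requires; the constant does not see it.
  set g' : ℕ → L2 (2 + 1) := fun k ↦
    (indicatorMultiplier (measurableSet_freqBall (2 + 1) k)).act g with hg'
  have hgn : ∀ k, ‖g' k‖ ≤ ‖u‖ := fun k ↦
    (UnitMultiplier.norm_act_le _ _).trans_eq ((Lp.fourierTransformₗᵢ (Space (2 + 1)) ℂ).norm_map u)
  refine strichartzNorm_le_of_tendsto (ENNReal.ofReal_pos.2 (by positivity)).ne'
    (v := fun k t ↦ 𝓕⁻ ((phaseMultiplier t).act ((indicatorMultiplier (hSm k)).act (g' k))))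
    (fun k ↦ continuous_flow _) (fun t ↦ tendsto_flow ?_ t) (fun k ↦ ?_)
  · simp only [hg', UnitMultiplier.act_act]
    refine tendsto_act ?_
    -- Every frequency off the null hyperplane ξ = 0 eventually lies in the band and in the ball.
    filter_upwards [ae_coord_ne_zero] with ζ hζ
    refine tendsto_const_nhds.congr' ?_
    have hpos : 0 < |2 * Real.pi * ζ 0| := abs_pos.2 (by positivity)
    have hev1 : ∀ᶠ k : ℕ in Filter.atTop, 1 / ((k : ℝ) + 1) < |2 * Real.pi * ζ 0| :=
      (tendsto_one_div_add_atTop_nhds_zero_nat (𝕜 := ℝ)).eventually_lt_const hpos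
    have hev2 : ∀ᶠ k : ℕ in Filter.atTop, |2 * Real.pi * ζ 0| ≤ k :=
      tendsto_natCast_atTop_atTop.eventually_ge_atTop _
    filter_upwards [hev1, hev2, eventually_mem_freqBall ζ] with k hk1 hk2 hk3
    have hmem : ζ ∈ S k := ⟨hk1.le, by linarith⟩
    simp [UnitMultiplier.comp, indicatorMultiplier, hmem, hk3, g]
  -- An indicator is real and idempotent, so the T T* multiplier is the band cut-off itself.
  · have hmm : (indicatorMultiplier (hSm k)).comp (indicatorMultiplier (hSm k)).conj =
        indicatorMultiplier (hSm k) := by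
      ext ζ
      by_cases hζ : ζ ∈ S k <;>
        simp [UnitMultiplier.comp, UnitMultiplier.conj, indicatorMultiplier, hζ]
    have hsupp : ∀ᵐ ζ, (2 : ℝ) ^ k < 2 * Real.pi * ‖ζ‖ →
        (indicatorMultiplier (hSm k)).act (g' k) ζ = 0 := by
      filter_upwards [(indicatorMultiplier (hSm k)).coeFn_act (g' k),
        indicator_act_ae (measurableSet_freqBall (2 + 1) k) g] with ζ h1 h2 hζ
      have hn : ζ ∉ freqBall (2 + 1) k := not_le.2 hζ
      rw [h1, hg']
      simp only
      rw [h2, Set.indicator_of_notMem hn, mul_zero]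
    refine (strichartz_of_kernel hq hr (K := 2) two_pos (indicatorMultiplier (hSm k))
      (fun t ht h hh ↦ ?_) (g' k) (B := ∫ ζ, ‖(indicatorMultiplier (hSm k)).act (g' k) ζ‖)
      (norm_flow_le_integral _ (h1 _ (by positivity) _ hsupp).1)).trans
      (ENNReal.ofReal_le_ofReal (mul_le_mul_of_nonneg_left (hgn k) hD0))
    rw [hmm, hexp, Real.rpow_neg_one, ← div_eq_mul_inv]
    refine norm_band_op_le ht (by positivity) ?_ h hh
    rw [div_le_iff₀ (by positivity)]
    nlinarith [(Nat.cast_nonneg k : (0 : ℝ) ≤ k)]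

end ZK

end

/-! ### The theorem: cases of the admissible triangle -/

theorem mainTheorem2 (d : ℕ) [NeZero d] (hd : 3 ≤ d) (q r : ℝ≥0∞)
    (hq : 2 ≤ q) (hq_top : q ≠ ∞) (hr : 2 ≤ r) (hqr : 2 / q + 2 / r ≤ 1)
    (s : ℝ) (hs : s = (d : ℝ) * (1 / 2 - (1 / q).toReal) - 3 * (1 / r).toReal) :
    ∃ C : ℝ≥0, ∀ u₀ : ZK.L2 d,
      MemSobolev s 2 (u₀ : 𝓢'(ZK.Space d, ℂ)) →
        ZK.strichartzNorm r q (fun t ↦ ZK.U t u₀) ≤ C * ZK.sobolevNorm s u₀ := by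
  suffices h : ∃ C : ℝ≥0, ∀ u : ZK.L2 d,
      ZK.strichartzNorm r q (fun t ↦ ZK.U t u) ≤ C * ZK.sobolevNorm s u from
    h.imp fun C hC u _ ↦ hC u
  have hq0 : q ≠ 0 := (two_pos.trans_le hq).ne'
  have hr0 : r ≠ 0 := (two_pos.trans_le hr).ne'
  set a := (1 / q).toReal with ha_def
  set b := (1 / r).toReal with hb_def
  have haq : a = 1 / q.toReal := by rw [ha_def, ENNReal.toReal_div, ENNReal.toReal_one]
  have ha : 0 < a := haq ▸ one_div_pos.2 (ENNReal.toReal_pos hq0 hq_top)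
  have hqa : q = ENNReal.ofReal (1 / a) := by
    rw [haq, one_div_one_div, ENNReal.ofReal_toReal hq_top]
  have hab : a + b ≤ 1 / 2 := by
    have h := ENNReal.toReal_mono ENNReal.one_ne_top hqr
    rw [ENNReal.toReal_add (ENNReal.div_ne_top ENNReal.ofNat_ne_top hq0)
      (ENNReal.div_ne_top ENNReal.ofNat_ne_top hr0), ENNReal.toReal_div, ENNReal.toReal_div,
      ENNReal.toReal_ofNat, ENNReal.toReal_one] at h
    have hbr : b = 1 / r.toReal := by rw [hb_def, ENNReal.toReal_div, ENNReal.toReal_one]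
    rw [haq, hbr]
    have e : ∀ x : ℝ, 2 / x = 2 * (1 / x) := fun x ↦ by ring
    rw [e, e] at h
    linarith
  obtain ⟨n, rfl⟩ : ∃ n, d = n + 1 := ⟨d - 1, by omega⟩
  rcases eq_or_ne r ∞ with rfl | hr_top
  · have hb : b = 0 := by simp [hb_def]
    rw [hb, mul_zero, sub_zero] at hs
    rw [hb, add_zero] at hab
    -- On the edge r = ∞ the vertex q = 2 is separate, since 1/q cannot be moved above 1/2 there.
    rcases hab.eq_or_lt with h | h
    · rw [h, sub_self, mul_zero] at hs
      rw [h, one_div_one_div, ENNReal.ofReal_ofNat] at hqa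
      refine ⟨1, fun u ↦ ?_⟩
      rw [hs, hqa, ENNReal.coe_one, one_mul]
      exact ZK.strichartzNorm_top_two u
    · rw [hs, hqa]
      exact ZK.exists_strichartz_top ha h
  · have hbr : b = 1 / r.toReal := by rw [hb_def, ENNReal.toReal_div, ENNReal.toReal_one]
    have hb : 0 < b := hbr ▸ one_div_pos.2 (ENNReal.toReal_pos hr0 hr_top)
    have hrb : r = ENNReal.ofReal (1 / b) := by
      rw [hbr, one_div_one_div, ENNReal.ofReal_toReal hr_top]
    push_cast at hs
    rw [hqa, hrb]
    rcases hab.lt_or_eq with h | h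
    · rw [hs]
      exact ZK.exists_strichartz_of_lt (by omega) ha hb h
    -- On the edge a + b = 1/2 the loss s equals (n-2)b, which vanishes in dimension three.
    · rcases (show 2 ≤ n by omega).eq_or_lt with rfl | hn
      · have hs0 : s = 0 := by
          rw [hs]
          push_cast
          linarith
        rw [hs0]
        exact ZK.exists_strichartz_endpoint ha hb h
      · rw [hs]
        exact ZK.exists_strichartz_of_eq hn ha hb h
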